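/- **Conventions.** For a full-rank lattice $L\subset\mathbb R^n$ and $s>0$ let $\rho_s(x)=e^{-\pi\|x\|^2/s^2}$, and let $D_{L,s}$ be the distribution on $L$ in which $y\in L$ has probability $\rho_s(y)/\sum_{x\in L}\rho_s(x)$. For $\varepsilon>0$ the smoothing parameter $\eta_\varepsilon(L)$ is the smallest $s>0$ with $\sum_{w\in L^*}\rho_{1/s}(w)=1+\varepsilon$, where $L^*$ is the dual lattice. Two discrete random variables $X,Y$ are $\delta$-close if $\tfrac12\sum_z|\Pr[X=z]-\Pr[Y=z]|\le\delta$. Algorithms are programs of a random access machine with integer registers, a read-only input and a write-only output. Lattice vectors are input and output by their integer coordinates in a given basis of the lattice. Time is the number of executed instructions, memory is the number of work cells (input and output excluded), and all stored integers must have bit-length polynomial in $n$ and the largest bit-length of an input integer. **Theorem.** There are a single (deterministic) algorithm, a function $f(n)=o(n)$ and a polynomial $p$ such that the following holds for all positive integers $n,q,d,C$ with $q\ge 2$ and $d\le n$, and every full-rank lattice $L\subset\mathbb R^n$ with a given basis. Put $N=\lceil 160\,d^2\,C\,q^{n/d}\rceil$ and $K=\lceil C\,q^{n/d}\rceil$.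 1. (Cost.) On input $n,q,d,C$ and any $N$ vectors $x_1,\dots,x_N$ of $L$, the algorithm outputs a list of vectors of $L$ in time at most $$C\,(10\,e\,d)^{8d}\,q^{8n+n/d+f(n)},$$ using memory at most $p(d)\,q^{n/d}$ (excluding input and output). Every output vector has the form $\frac1q\bigl(\sum_{i\in I}x_i-x_j\bigr)$ with $I\subset\{1,\dots,N\}$, $|I|=8d$ and $j\notin I$. 2. (Output distribution.) Let $\varepsilon>0$ and $s\ge 2\sqrt d\,q\,\eta_\varepsilon(L)$ with $s>0$. If $x_1,\dots,x_N$ are independent samples from $D_{L,s}$, then the output list is $$\bigl(4\varepsilon^{2d}N+11\,C\,q^{-5n/2}\bigr)\text{-close}$$ to a list of $K$ independent samples from $D_{L,\,s\sqrt{8d+1}/q}$. -/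

import Mathlib

open Filter Asymptotics
open scoped ENNReal

/-! ### Lattices, Gaussian masses, the smoothing parameter, the discrete Gaussian -/

section Gaussian

variable {E : Type*} [NormedAddCommGroup E] [InnerProductSpace ℝ E]

/-- The Gaussian function `ρ_s(x) = exp (-π ‖x‖² / s²)`. -/
noncomputable def gaussianRho (s : ℝ) (x : E) : ℝ :=
  Real.exp (-(Real.pi * ‖x‖ ^ 2 / s ^ 2))

/-- The Gaussian mass `ρ_s(S) = ∑_{x ∈ S} ρ_s(x)` of a discrete set `S`. -/
noncomputable def gaussianMass (s : ℝ) (S : Set E) : ℝ :=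
  ∑' x : S, gaussianRho s (x : E)

/-- The dual lattice: the vectors of the real span of `L` whose inner product with every vector
of `L` is an integer. -/
def latticeDual (L : Submodule ℤ E) : Set E :=
  {w | w ∈ Submodule.span ℝ (L : Set E) ∧ ∀ y ∈ L, ∃ k : ℤ, inner ℝ w y = (k : ℝ)}

/-- The smoothing parameter `η_ε(L)`: the smallest `s > 0` such that `ρ_{1/s}(L*) = 1 + ε`. -/
noncomputable def smoothingParam (ε : ℝ) (L : Submodule ℤ E) : ℝ :=
  sInf {s : ℝ | 0 < s ∧ gaussianMass (1 / s) (latticeDual L) = 1 + ε}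

theorem summable_gaussianRho [FiniteDimensional ℝ E] (L : Submodule ℤ E) [DiscreteTopology L]
    {s : ℝ} (hs : 0 < s) : Summable fun x : L => gaussianRho s (x : E) := by
  set k : ℕ := Module.finrank ℤ L + 1 with hk
  have h1 : Summable fun z : L => (k.factorial : ℝ) * (s ^ 2 / Real.pi) ^ k * (‖z‖ ^ (2 * k))⁻¹ := by
    refine Summable.mul_left _ ?_
    simpa [inv_pow] using ZLattice.summable_norm_pow_inv L (2 * k) (by omega)
  refine Summable.of_norm_bounded_eventually h1 ?_
  refine (Set.finite_singleton (0 : L)).subset ?_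
  intro z hz
  by_contra hne
  apply hz
  have hz0 : 0 < ‖z‖ := norm_pos_iff.2 hne
  have hx : 0 < Real.pi * ‖z‖ ^ 2 / s ^ 2 := by have := Real.pi_pos; positivity
  have h2 := Real.pow_div_factorial_le_exp _ hx.le k
  have h3 : 0 < (Real.pi * ‖z‖ ^ 2 / s ^ 2) ^ k / (k.factorial : ℝ) := by positivity
  have h4 := inv_anti₀ h3 h2
  have hpi := Real.pi_pos
  rw [Set.mem_ofPred_eq, gaussianRho, Real.norm_of_nonneg (Real.exp_pos _).le, Real.exp_neg]
  refine h4.trans (le_of_eq ?_)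
  rw [pow_mul, div_pow, div_pow, mul_pow]
  field_simp

/-- The discrete Gaussian distribution `D_{L,s}`: the probability of `y ∈ L` is proportional to
`ρ_s(y)`. It is used for `s > 0` only (a point mass elsewhere). -/
noncomputable def discreteGaussian [FiniteDimensional ℝ E] (L : Submodule ℤ E)
    [DiscreteTopology L] (s : ℝ) : PMF L :=
  open Classical in
  if hs : 0 < s then
    PMF.normalize (fun y : L => ENNReal.ofReal (gaussianRho s (y : E)))
      (fun h => by
        have := ENNReal.tsum_eq_zero.1 h 0
        rw [ENNReal.ofReal_eq_zero] at this
        exact absurd this (not_le.2 (Real.exp_pos _)))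
      (summable_gaussianRho L hs).tsum_ofReal_ne_top
  else PMF.pure 0

end Gaussian

/-- The lattice `{∑ zᵢ bᵢ : zᵢ ∈ ℤ}` generated by a basis `b` of `ℝⁿ`. -/
abbrev latticeOf {n : ℕ} (b : Module.Basis (Fin n) ℝ (EuclideanSpace ℝ (Fin n))) :
    Submodule ℤ (EuclideanSpace ℝ (Fin n)) :=
  Submodule.span ℤ (Set.range b)

/-- The law of a list of `k` independent samples from `p`. -/
noncomputable def iidSamples {α : Type*} (p : PMF α) : ℕ → PMF (List α)
  | 0 => PMF.pure []
  | k + 1 => p.bind fun x => (iidSamples p k).map fun l => x :: l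

/-- Statistical distance: half the `ℓ¹` distance of the probability mass functions. -/
noncomputable def statDist {α : Type*} (p q : PMF α) : ℝ :=
  1 / 2 * ∑' z : α, |(p z).toReal - (q z).toReal|

/-! ### Random access machines -/

/-- The binary integer operations of the machine. -/
inductive RamOp
  | add | sub | mul | div | mod

/-- `div` and `mod` are the Euclidean quotient and remainder. -/
def RamOp.eval : RamOp → ℤ → ℤ → ℤ
  | .add, x, y => x + y
  | .sub, x, y => x - y
  | .mul, x, y => x * y
  | .div, x, y => x / y
  | .mod, x, y => x % y

/-- Programs of a random access machine, in structured form. Below `M` is the work memory. -/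
inductive RamProg
  /-- do nothing -/
  | skip
  /-- `M[a] := k` -/
  | const (a : ℕ) (k : ℤ)
  /-- `M[a] := M[b] op M[c]` -/
  | arith (op : RamOp) (a b c : ℕ)
  /-- `M[a] := M[M[b]]` -/
  | load (a b : ℕ)
  /-- `M[M[a]] := M[b]` -/
  | store (a b : ℕ)
  /-- `M[a] := input[M[b]]` -/
  | read (a b : ℕ)
  /-- append `M[a]` to the output -/
  | emit (a : ℕ)
  /-- run `p`, then `p'` -/
  | seq (p p' : RamProg)
  /-- if `0 < M[a]` then `p` else `p'` -/
  | ite (a : ℕ) (p p' : RamProg)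
  /-- while `0 < M[a]` do `p` -/
  | loop (a : ℕ) (p : RamProg)

/-- The work memory (initially zero) and what has been written on the output so far. The input is
read-only, the output is write-only; neither is part of the work memory. -/
structure RamState where
  mem : ℕ → ℤ
  out : List ℤ

/-- `M[a] := v`. -/
def RamState.set (σ : RamState) (a : ℕ) (v : ℤ) : RamState :=
  { σ with mem := Function.update σ.mem a v }

/-- `RamExec S W inp p σ σ' t`: on the read-only input `inp`, the program `p`, started in state
`σ`, halts in state `σ'` after exactly `t` elementary instructions and tests, using only the
memory cells with addresses `< S`, and writing into them only integers of at most `W` bits. -/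
inductive RamExec (S W : ℕ) (inp : List ℤ) : RamProg → RamState → RamState → ℕ → Prop
  | skip (σ : RamState) : RamExec S W inp .skip σ σ 1
  | const (σ : RamState) (a : ℕ) (k : ℤ) (ha : a < S) (hW : k.natAbs < 2 ^ W) :
      RamExec S W inp (.const a k) σ (σ.set a k) 1
  | arith (σ : RamState) (op : RamOp) (a b c : ℕ) (ha : a < S) (hb : b < S) (hc : c < S)
      (hW : (op.eval (σ.mem b) (σ.mem c)).natAbs < 2 ^ W) :
      RamExec S W inp (.arith op a b c) σ (σ.set a (op.eval (σ.mem b) (σ.mem c))) 1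
  | load (σ : RamState) (a b i : ℕ) (ha : a < S) (hb : b < S) (hi : σ.mem b = i) (hiS : i < S)
      (hW : (σ.mem i).natAbs < 2 ^ W) :
      RamExec S W inp (.load a b) σ (σ.set a (σ.mem i)) 1
  | store (σ : RamState) (a b i : ℕ) (ha : a < S) (hb : b < S) (hi : σ.mem a = i) (hiS : i < S)
      (hW : (σ.mem b).natAbs < 2 ^ W) :
      RamExec S W inp (.store a b) σ (σ.set i (σ.mem b)) 1
  | read (σ : RamState) (a b i : ℕ) (ha : a < S) (hb : b < S) (hi : σ.mem b = i)
      (hlen : i < inp.length) (hW : (inp.getD i 0).natAbs < 2 ^ W) :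
      RamExec S W inp (.read a b) σ (σ.set a (inp.getD i 0)) 1
  | emit (σ : RamState) (a : ℕ) (ha : a < S) :
      RamExec S W inp (.emit a) σ { σ with out := σ.out ++ [σ.mem a] } 1
  | seq (σ σ' σ'' : RamState) (p p' : RamProg) (t t' : ℕ) (h : RamExec S W inp p σ σ' t)
      (h' : RamExec S W inp p' σ' σ'' t') : RamExec S W inp (.seq p p') σ σ'' (t + t')
  | ite_pos (σ σ' : RamState) (a : ℕ) (p p' : RamProg) (t : ℕ) (ha : a < S) (hc : 0 < σ.mem a)
      (h : RamExec S W inp p σ σ' t) : RamExec S W inp (.ite a p p') σ σ' (t + 1)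
  | ite_neg (σ σ' : RamState) (a : ℕ) (p p' : RamProg) (t : ℕ) (ha : a < S) (hc : ¬ 0 < σ.mem a)
      (h : RamExec S W inp p' σ σ' t) : RamExec S W inp (.ite a p p') σ σ' (t + 1)
  | loop_done (σ : RamState) (a : ℕ) (p : RamProg) (ha : a < S) (hc : ¬ 0 < σ.mem a) :
      RamExec S W inp (.loop a p) σ σ 1
  | loop_step (σ σ' σ'' : RamState) (a : ℕ) (p : RamProg) (t t' : ℕ) (ha : a < S)
      (hc : 0 < σ.mem a) (h : RamExec S W inp p σ σ' t)
      (h' : RamExec S W inp (.loop a p) σ' σ'' t') :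
      RamExec S W inp (.loop a p) σ σ'' (t + t' + 1)

/-- Started on `inp` with zero memory and empty output, `p` halts after `t` steps with output
`out`, using `S` memory cells holding integers of at most `W` bits. -/
def RamComputes (p : RamProg) (S W : ℕ) (inp out : List ℤ) (t : ℕ) : Prop :=
  ∃ M : ℕ → ℤ, RamExec S W inp p ⟨fun _ => 0, []⟩ ⟨M, out⟩ t

/-- The largest bit-length of the integers in a list. -/
def maxBitLength (l : List ℤ) : ℕ :=
  (l.map fun z => z.natAbs.size).foldr max 0

/-- Lattice vectors are given to the machine, and returned by it, through their integer
coordinates in the basis `b`: this is the concatenation of the coordinate vectors of a list. -/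
noncomputable def coordList {n : ℕ} (b : Module.Basis (Fin n) ℝ (EuclideanSpace ℝ (Fin n)))
    (xs : List (latticeOf b)) : List ℤ :=
  xs.flatMap fun x => List.ofFn fun i => (b.restrictScalars ℤ).repr x i

/-! The algorithm looks at the samples modulo `q L` and searches by brute force. Put Q = q^(n/d) and
P = ⌈Q⌉. The input is cut into groups, each made of m = 8d blocks of B = 13dP samples followed by P
more samples, the targets. For each target all B^m ways of choosing one sample per block are tried.
A choice is accepted when the chosen sum minus the target lies in `q L` and none of the chosen
samples already serves another target of the group; the difference divided by q is output.

Why every target is served: the cosets of the samples are almost uniform in G = (ℤ/q)^n. For uniform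
cosets the number of choices that solve a given target has mean μ = B^m/|G|. Two different choices
differ in some block, so their sums are independent, and Chebyshev's inequality applies. It applies
as well to the solutions through one fixed sample, whose mean number is μ/B. The other targets of
the group occupy at most P - 1 samples of each block, and these destroy at most m(P-1)·(6/5)μ/B <
(4/5)μ solutions, so a fresh one remains. The argument is uniform in the set of occupied samples
(`RobustlySolvable`, `card_not_robustlySolvable_le`), so the history of the greedy search never has
to be conditioned on; `map_fst_greedy` turns it into success of the search.

Why the output is Gaussian: acceptance depends only on the cosets. Given the cosets, the samples are
independent Gaussians on cosets of `q L`, and the outputs are signed sums of 8d+1 of them over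
disjoint index sets. Completing the square (`gaussianRho_mul_gaussianRho`) reduces the addition of
one more sample to the Gaussian mass of a shifted coset of `q L` with parameter at least s/√2. By
Poisson summation this mass is the same for all shifts up to a factor 1 ± δ, where 1 + δ bounds the
dual mass. As s/√2 is at least √(2d)·q times the smoothing parameter, and scaling by √t raises each
dual term to the power t, δ = ε^(2d) is admissible (`dualMass_sub_one_le_pow`).

Only lower bounds for the output law are needed: if p ≥ θ·p' pointwise, the two laws are at distance
at most 1 - θ (`statDist_le_of_le`). So bad coset vectors are simply dropped, and
`le_map_iidSamples` multiplies the share of good coset vectors by the Poisson errors of the N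
samples.

The cost is established by symbolic execution of an explicit machine program. A tuple is a number
below B^m read in base B, and one flag per block sample of the current group records what is used,
so the work memory does not grow with C. -/

set_option linter.unusedSectionVars false

/-! ### Lattice sums of Gaussians and their periodization -/

section PoissonSummation

open MeasureTheory UnitAddTorus

variable {E : Type*} [NormedAddCommGroup E] [InnerProductSpace ℝ E]

theorem gaussianRho_pos (s : ℝ) (x : E) : 0 < gaussianRho s x := Real.exp_pos _

theorem continuous_gaussianRho (s : ℝ) : Continuous (gaussianRho s : E → ℝ) := by
  unfold gaussianRho; fun_prop

/-- From ‖x‖² ≤ 2‖x+u‖² + 2‖u‖². It dominates all bounded translates by one summable wider Gaussian,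
which justifies the later exchanges of sums with limits and integrals. -/
theorem gaussianRho_add_le {r R : ℝ} {u : E} (hu : ‖u‖ ≤ R) (x : E) :
    gaussianRho r (x + u) ≤ Real.exp (Real.pi * R ^ 2 / r ^ 2) * gaussianRho (√2 * r) x := by
  rw [gaussianRho, gaussianRho, ← Real.exp_add, Real.exp_le_exp]
  have h1 : ‖x‖ ≤ ‖x + u‖ + ‖u‖ := by simpa using norm_sub_le (x + u) u
  have h2 : ‖x‖ ^ 2 ≤ 2 * ‖x + u‖ ^ 2 + 2 * R ^ 2 := by
    nlinarith [norm_nonneg x, norm_nonneg u, norm_nonneg (x + u), sq_nonneg (‖x + u‖ - ‖u‖)]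
  have h3 : (√2 * r) ^ 2 = 2 * r ^ 2 := by rw [mul_pow, Real.sq_sqrt (by norm_num)]
  rw [h3]
  rcases eq_or_ne r 0 with rfl | hr
  · simp
  have h4 : 0 < r ^ 2 := by positivity
  have : Real.pi * ‖x‖ ^ 2 / (2 * r ^ 2) ≤ Real.pi * ‖x + u‖ ^ 2 / r ^ 2 + Real.pi * R ^ 2 / r ^ 2 := by
    rw [← add_div, div_le_div_iff₀ (by positivity) h4]
    have := mul_le_mul_of_nonneg_left h2 (mul_pos Real.pi_pos h4).le
    nlinarith
  linarith

variable {ι : Type*} [Fintype ι] (b : Module.Basis ι ℝ E)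

/-- The lattice vector with given integer coordinates in the basis `b`. -/
noncomputable def latticeVec (z : ι → ℤ) : E := b.equivFun.symm fun i => (z i : ℝ)

/-- The vector whose inner product with `b i` is `k i`. -/
noncomputable def dualVec [FiniteDimensional ℝ E] (k : ι → ℤ) : E :=
  (InnerProductSpace.toDual ℝ E).symm
    (LinearMap.toContinuousLinearMap (∑ i, (k i : ℝ) • b.coord i))

theorem inner_dualVec [FiniteDimensional ℝ E] (k : ι → ℤ) (x : E) :
    inner ℝ (dualVec b k) x = ∑ i, (k i : ℝ) * b.repr x i := by
  rw [dualVec, InnerProductSpace.toDual_symm_apply]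
  simp

theorem latticeVec_eq_repr_symm (z : ι → ℤ) :
    latticeVec b z = ((b.restrictScalars ℤ).equivFun.symm z : E) := by
  simp [latticeVec, Module.Basis.equivFun_symm_apply, Int.cast_smul_eq_zsmul]

theorem tsum_lattice_eq {α : Type*} [AddCommMonoid α] [TopologicalSpace α] (f : E → α) :
    ∑' y : Submodule.span ℤ (Set.range b), f y = ∑' z : ι → ℤ, f (latticeVec b z) := by
  rw [← (b.restrictScalars ℤ).equivFun.symm.toEquiv.tsum_eq]
  exact tsum_congr fun z => by rw [latticeVec_eq_repr_symm]; rfl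

variable [FiniteDimensional ℝ E]

theorem summable_gaussianRho_latticeVec {r : ℝ} (hr : 0 < r) :
    Summable fun z : ι → ℤ => gaussianRho r (latticeVec b z) := by
  have := ((b.restrictScalars ℤ).equivFun.symm.toEquiv.summable_iff).2
    (summable_gaussianRho (Submodule.span ℤ (Set.range b)) hr)
  exact this.congr fun z => by rw [latticeVec_eq_repr_symm]; rfl

theorem summable_gaussianRho_latticeVec_add {r : ℝ} (hr : 0 < r) (u : E) :
    Summable fun z : ι → ℤ => gaussianRho r (latticeVec b z + u) :=
  ((summable_gaussianRho_latticeVec b (r := √2 * r) (by positivity)).mul_left _).of_nonneg_of_le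
    (fun _ => (gaussianRho_pos _ _).le) fun _ => gaussianRho_add_le le_rfl _

theorem continuous_tsum_gaussianRho {r : ℝ} (hr : 0 < r) :
    Continuous fun u : E => ∑' z : ι → ℤ, gaussianRho r (latticeVec b z + u) := by
  rw [continuous_iff_continuousAt]
  intro u
  have : ContinuousOn (fun u : E => ∑' z : ι → ℤ, gaussianRho r (latticeVec b z + u))
      (Metric.ball 0 (‖u‖ + 1)) := by
    refine continuousOn_tsum (fun z => ((continuous_gaussianRho r).comp
      (continuous_const.add continuous_id)).continuousOn)
      ((summable_gaussianRho_latticeVec b (r := √2 * r) (by positivity)).mul_left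
        (Real.exp (Real.pi * (‖u‖ + 1) ^ 2 / r ^ 2))) ?_
    intro z x hx
    rw [Real.norm_of_nonneg (gaussianRho_pos _ _).le]
    exact gaussianRho_add_le (by simpa using (Metric.mem_ball.1 hx).le) _
  exact this.continuousAt (Metric.isOpen_ball.mem_nhds (by simp))

theorem isOpenQuotientMap_coe_unitAddTorus (ι : Type*) [Finite ι] :
    IsOpenQuotientMap fun (v : ι → ℝ) (i : ι) => (v i : UnitAddCircle) := by
  refine ⟨fun t => ?_, by fun_prop, ?_⟩
  · choose v hv using fun i => QuotientAddGroup.mk_surjective (t i)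
    exact ⟨v, funext hv⟩
  · exact IsOpenMap.piMap (fun _ => QuotientAddGroup.isOpenMap_coe) (Eventually.of_forall
      fun _ => QuotientAddGroup.mk_surjective)

/-- The periodization of the Gaussian along a lattice, as a function on the torus. -/
theorem exists_periodization {r : ℝ} (hr : 0 < r) :
    ∃ f : C(UnitAddTorus ι, ℂ), ∀ v : ι → ℝ, f (fun i => (v i : UnitAddCircle)) =
      ((∑' z : ι → ℤ, gaussianRho r (latticeVec b z + b.equivFun.symm v) : ℝ) : ℂ) := by
  have hT : Continuous (b.equivFun.symm : (ι → ℝ) → E) :=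
    LinearMap.continuous_of_finiteDimensional b.equivFun.symm.toLinearMap
  let F : C(ι → ℝ, ℂ) := ⟨fun v =>
      ((∑' z : ι → ℤ, gaussianRho r (latticeVec b z + b.equivFun.symm v) : ℝ) : ℂ),
    Complex.continuous_ofReal.comp ((continuous_tsum_gaussianRho b hr).comp hT)⟩
  let π : C(ι → ℝ, UnitAddTorus ι) :=
    ⟨fun v i => (v i : UnitAddCircle), (isOpenQuotientMap_coe_unitAddTorus ι).continuous⟩
  have hπ : Topology.IsQuotientMap π := (isOpenQuotientMap_coe_unitAddTorus ι).isQuotientMap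
  -- The torus is a topological quotient of `ι → ℝ`, so it suffices that the continuous function
  -- upstairs is invariant under integer translations, which merely reindex the lattice sum.
  have hF : Function.FactorsThrough F π := by
    intro v v' h
    have h1 : ∀ i, ∃ k : ℤ, (k : ℝ) = v' i - v i := fun i => by
      have := congrFun h i
      have h2 : ((v' i - v i : ℝ) : UnitAddCircle) = 0 := by
        rw [AddCircle.coe_sub, sub_eq_zero]; exact this.symm
      obtain ⟨k, hk⟩ := (AddCircle.coe_eq_zero_iff 1).1 h2
      exact ⟨k, by simpa using hk⟩
    choose k hk using h1
    have h3 : b.equivFun.symm v' = latticeVec b k + b.equivFun.symm v := by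
      rw [latticeVec, ← map_add]; congr 1; ext i; simp [hk]
    simp only [F, ContinuousMap.coe_mk, h3]
    congr 1
    rw [← (Equiv.addRight k).tsum_eq]
    refine tsum_congr fun z => ?_
    rw [Equiv.coe_addRight, ← add_assoc]
    congr 2
    simp only [latticeVec, ← map_add]; congr 1; ext i; simp
  exact ⟨hπ.lift F hF, fun v => by
    exact DFunLike.congr_fun (hπ.lift_comp F hF) v⟩

end PoissonSummation

/-! ### Fourier coefficients of the periodized Gaussian and Poisson summation -/

section PoissonSummation

open MeasureTheory UnitAddTorus

variable {E : Type*} [NormedAddCommGroup E] [InnerProductSpace ℝ E]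
variable {ι : Type*} [Fintype ι] (b : Module.Basis ι ℝ E)
variable [FiniteDimensional ℝ E]

/-- Uniqueness of Haar measure. The constant is the reciprocal of the covolume of the lattice, but
only its positivity is ever used. -/
theorem exists_integral_comp_equivFun_symm [MeasurableSpace E] [BorelSpace E] :
    ∃ c : ℝ, 0 < c ∧ ∀ h : E → ℂ,
      ∫ v : ι → ℝ, h (b.equivFun.symm v) = (c : ℂ) * ∫ x : E, h x := by
  let T : (ι → ℝ) ≃L[ℝ] E := b.equivFun.symm.toContinuousLinearEquiv
  let μ : Measure E := Measure.map T volume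
  have hμ : μ.IsAddHaarMeasure := T.isAddHaarMeasure_map volume
  refine ⟨(Measure.addHaarScalarFactor μ volume : ℝ), ?_, fun h => ?_⟩
  · exact_mod_cast Measure.addHaarScalarFactor_pos_of_isAddHaarMeasure μ volume
  · have h1 : ∫ v : ι → ℝ, h (b.equivFun.symm v) = ∫ x, h x ∂μ :=
      (T.toHomeomorph.measurableEmbedding.integral_map h).symm
    rw [h1]
    conv_lhs => rw [Measure.isAddLeftInvariant_eq_smul μ volume, integral_smul_nnreal_measure]
    rfl

/-- The integer translates of a unit cube tile the space; this is the unfolding step of Poisson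
summation. -/
theorem integral_eq_integral_box_tsum {H : (ι → ℝ) → ℂ} (hH : Integrable H) :
    ∫ v, H v = ∑' z : ι → ℤ,
      ∫ v in {x : ι → ℝ | ∀ i, x i ∈ Set.Ioc (0 : ℝ) (0 + 1)}, H ((fun i => (z i : ℝ)) + v) := by
  let e := Pi.basisFun ℝ ι
  have hfd := ZSpan.isAddFundamentalDomain e (volume : Measure (ι → ℝ))
  have : VAddInvariantMeasure (Submodule.span ℤ (Set.range e)) (ι → ℝ) volume :=
    inferInstanceAs <| VAddInvariantMeasure (Submodule.span ℤ (Set.range e)).toAddSubgroup _ volume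
  have h1 := hfd.integral_eq_tsum'' H hH
  -- `ZSpan` uses cubes closed on the left, Fourier coefficients on the torus use cubes closed on
  -- the right; both agree almost everywhere with the closed cube.
  have h2 : ZSpan.fundamentalDomain e =ᵐ[volume]
      {x : ι → ℝ | ∀ i, x i ∈ Set.Ioc (0 : ℝ) (0 + 1)} := by
    have e1 : ZSpan.fundamentalDomain e = Set.univ.pi fun _ : ι => Set.Ico (0 : ℝ) 1 := by
      ext x; simp [ZSpan.mem_fundamentalDomain, e]
    have e2 : {x : ι → ℝ | ∀ i, x i ∈ Set.Ioc (0 : ℝ) (0 + 1)} =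
        Set.univ.pi fun _ : ι => Set.Ioc (0 : ℝ) 1 := by
      ext x; simp
    rw [e1, e2]
    exact (Measure.univ_pi_Ico_ae_eq_Icc (f := fun _ : ι => (0 : ℝ)) (g := fun _ => 1)).trans
      (Measure.univ_pi_Ioc_ae_eq_Icc (f := fun _ : ι => (0 : ℝ)) (g := fun _ => 1)).symm
  rw [h1]
  simp_rw [setIntegral_congr_set h2]
  rw [← (e.restrictScalars ℤ).equivFun.symm.toEquiv.tsum_eq]
  refine tsum_congr fun z => ?_
  have h3 : (((e.restrictScalars ℤ).equivFun.symm z : Submodule.span ℤ (Set.range e)) : ι → ℝ)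
      = fun i => (z i : ℝ) := by
    classical
    rw [Module.Basis.equivFun_symm_apply]
    ext i
    simp [e, Finset.sum_apply, Pi.basisFun_apply, Pi.single_apply]
  refine integral_congr_ae (Eventually.of_forall fun v => ?_)
  change H (((e.restrictScalars ℤ).equivFun.symm z : ι → ℝ) + v) = _
  rw [h3]

theorem mFourier_neg_coe (k : ι → ℤ) (v : ι → ℝ) :
    mFourier (-k) (fun i => (v i : UnitAddCircle)) =
      Complex.exp (-(2 * Real.pi * Complex.I) * inner ℝ (dualVec b k) (b.equivFun.symm v)) := by
  rw [inner_dualVec, mFourier, ContinuousMap.coe_mk]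
  simp_rw [fourier_coe_apply]
  rw [← Complex.exp_sum]
  congr 1
  push_cast
  rw [Finset.mul_sum]
  refine Finset.sum_congr rfl fun i _ => ?_
  have : b.repr (b.equivFun.symm v) i = v i := by
    rw [← Module.Basis.equivFun_apply, LinearEquiv.apply_symm_apply]
  rw [this]; simp; ring

/-- Sum over the lattice and integral over one cell merge into an integral over the whole space,
which is the Fourier transform of a Gaussian at a dual vector. -/
theorem mFourierCoeff_periodization {r : ℝ} (hr : 0 < r) [MeasurableSpace E] [BorelSpace E]
    {c : ℝ} (hc : ∀ h : E → ℂ, ∫ v : ι → ℝ, h (b.equivFun.symm v) = (c : ℂ) * ∫ x : E, h x)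
    (f : UnitAddTorus ι → ℂ)
    (hf : ∀ v : ι → ℝ, f (fun i => (v i : UnitAddCircle)) =
      ((∑' z : ι → ℤ, gaussianRho r (latticeVec b z + b.equivFun.symm v) : ℝ) : ℂ))
    (k : ι → ℤ) :
    mFourierCoeff f k =
      ((c * r ^ Module.finrank ℝ E * gaussianRho (1 / r) (dualVec b k) : ℝ) : ℂ) := by
  set h : E → ℂ := fun x => Complex.exp (-((Real.pi / r ^ 2 : ℝ) : ℂ) * ‖x‖ ^ 2 +
    (-(2 * Real.pi * Complex.I)) * inner ℝ (dualVec b k) x) with hh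
  have hb : 0 < (((Real.pi / r ^ 2 : ℝ) : ℂ)).re := by
    rw [Complex.ofReal_re]; have := Real.pi_pos; positivity
  have hint : Integrable h :=
    GaussianFourier.integrable_cexp_neg_mul_sq_norm_add hb _ _
  have h_eq : ∀ x, h x = Complex.exp (-(2 * Real.pi * Complex.I) * inner ℝ (dualVec b k) x) *
      (gaussianRho r x : ℂ) := by
    intro x
    rw [hh, gaussianRho, Complex.ofReal_exp, ← Complex.exp_add]
    push_cast
    ring_nf
  set H : (ι → ℝ) → ℂ := fun v => h (b.equivFun.symm v)
  have hHint : Integrable H := by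
    let T : (ι → ℝ) ≃L[ℝ] E := b.equivFun.symm.toContinuousLinearEquiv
    have hμ : (Measure.map T volume).IsAddHaarMeasure := T.isAddHaarMeasure_map volume
    have : Integrable h (Measure.map T volume) := by
      rw [Measure.isAddLeftInvariant_eq_smul (Measure.map T volume) volume]
      exact hint.smul_measure_nnreal
    exact (T.toHomeomorph.measurableEmbedding.integrable_map_iff).1 this
  have hnorm : ∀ x, ‖h x‖ = gaussianRho r x := fun x => by
    rw [h_eq, norm_mul, Complex.norm_real, Real.norm_of_nonneg (gaussianRho_pos _ _).le]
    have : -(2 * Real.pi * Complex.I) * (inner ℝ (dualVec b k) x : ℂ) =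
      ((-(2 * Real.pi * inner ℝ (dualVec b k) x) : ℝ) : ℂ) * Complex.I := by push_cast; ring
    rw [this, Complex.norm_exp_ofReal_mul_I, one_mul]
  have hTz : ∀ (z : ι → ℤ) v, b.equivFun.symm ((fun i => (z i : ℝ)) + v) =
      latticeVec b z + b.equivFun.symm v := fun z v => by rw [map_add]; rfl
  -- The character is trivial on the lattice, so translating by a lattice vector only affects the
  -- Gaussian factor.
  have hper : ∀ (z : ι → ℤ) v, H ((fun i => (z i : ℝ)) + v) =
      mFourier (-k) (fun i => (v i : UnitAddCircle)) *
        (gaussianRho r (latticeVec b z + b.equivFun.symm v) : ℂ) := by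
    intro z v
    have : H ((fun i => (z i : ℝ)) + v) = mFourier (-k)
        (fun i => ((((fun i => (z i : ℝ)) + v : ι → ℝ) i : ℝ) : UnitAddCircle)) *
        (gaussianRho r (latticeVec b z + b.equivFun.symm v) : ℂ) := by
      rw [mFourier_neg_coe b, ← hTz]; exact h_eq _
    rw [this]
    congr 2
    ext i
    simp only [Pi.add_apply, AddCircle.coe_add]
    have : ((z i : ℝ) : UnitAddCircle) = 0 := (AddCircle.coe_eq_zero_iff 1).2 ⟨z i, by simp⟩
    rw [this, zero_add]
  have hTc : Continuous (b.equivFun.symm : (ι → ℝ) → E) :=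
    LinearMap.continuous_of_finiteDimensional b.equivFun.symm.toLinearMap
  calc mFourierCoeff f k
      = ∫ v in {x : ι → ℝ | ∀ i, x i ∈ Set.Ioc (0 : ℝ) (0 + 1)},
          ∑' z : ι → ℤ, H ((fun i => (z i : ℝ)) + v) := by
        rw [mFourierCoeff_eq_integral f k (fun _ => 0)]
        refine integral_congr_ae (Eventually.of_forall fun v => ?_)
        simp only [hf, hper, smul_eq_mul]
        rw [tsum_mul_left, Complex.ofReal_tsum]
    _ = ∑' z : ι → ℤ, ∫ v in {x : ι → ℝ | ∀ i, x i ∈ Set.Ioc (0 : ℝ) (0 + 1)},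
          H ((fun i => (z i : ℝ)) + v) := by
        refine (integral_tsum_of_summable_integral_norm (fun z => ?_) ?_).symm
        · exact (hHint.comp_add_left _).integrableOn
        · have hbox : volume {x : ι → ℝ | ∀ i, x i ∈ Set.Ioc (0 : ℝ) (0 + 1)} = 1 := by
            have : {x : ι → ℝ | ∀ i, x i ∈ Set.Ioc (0 : ℝ) (0 + 1)} =
              Set.univ.pi fun _ : ι => Set.Ioc (0 : ℝ) (0 + 1) := by ext; simp
            rw [this, volume_pi_pi]; simp
          -- On the bounded cell all translates are dominated by one wider Gaussian, which gives the
          -- summability of the integrals of norms.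
          obtain ⟨R, hR⟩ : ∃ R, ∀ v ∈ {x : ι → ℝ | ∀ i, x i ∈ Set.Ioc (0 : ℝ) (0 + 1)},
              ‖b.equivFun.symm v‖ ≤ R := by
            obtain ⟨R, hR⟩ := (isCompact_Icc (a := (0 : ι → ℝ)) (b := 1)).exists_bound_of_continuousOn
              hTc.continuousOn
            exact ⟨R, fun v hv => hR v ⟨fun i => (hv i).1.le, fun i => by simpa using (hv i).2⟩⟩
          refine ((summable_gaussianRho_latticeVec b (r := √2 * r) (by positivity)).mul_left
            (Real.exp (Real.pi * R ^ 2 / r ^ 2))).of_nonneg_of_le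
            (fun z => integral_nonneg fun v => norm_nonneg _) fun z => ?_
          have hle := norm_setIntegral_le_of_norm_le_const (μ := volume)
            (s := {x : ι → ℝ | ∀ i, x i ∈ Set.Ioc (0 : ℝ) (0 + 1)})
            (f := fun v => ‖H ((fun i => (z i : ℝ)) + v)‖)
            (C := Real.exp (Real.pi * R ^ 2 / r ^ 2) * gaussianRho (√2 * r) (latticeVec b z))
            (by rw [hbox]; simp) (fun v hv => by
              rw [norm_norm]
              change ‖h _‖ ≤ _
              rw [hnorm, hTz]
              exact gaussianRho_add_le (hR v hv) _)
          rw [measureReal_def, hbox] at hle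
          simpa using (le_abs_self _).trans hle
    _ = ∫ v, H v := (integral_eq_integral_box_tsum hHint).symm
    _ = c * ∫ x, h x := hc h
    _ = _ := by
        rw [hh, GaussianFourier.integral_cexp_neg_mul_sq_norm_add hb]
        have h1 : ((Real.pi : ℂ) / ((Real.pi / r ^ 2 : ℝ) : ℂ)) = ((r ^ 2 : ℝ) : ℂ) := by
          have := Real.pi_ne_zero
          rw [← Complex.ofReal_div]; congr 1; field_simp
        have h2 : (((r ^ 2 : ℝ) : ℂ)) ^ ((Module.finrank ℝ E : ℂ) / 2) =
            ((r ^ Module.finrank ℝ E : ℝ) : ℂ) := by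
          have : ((Module.finrank ℝ E : ℂ) / 2) = (((Module.finrank ℝ E : ℝ) / 2 : ℝ) : ℂ) := by
            push_cast; rfl
          rw [this, ← Complex.ofReal_cpow (by positivity)]
          congr 1
          rw [← Real.rpow_natCast r 2, ← Real.rpow_mul hr.le, ← Real.rpow_natCast]
          congr 1; push_cast; ring
        rw [h1, h2, gaussianRho]
        push_cast
        rw [← mul_assoc]
        congr 2
        have hpi : (Real.pi : ℂ) ≠ 0 := by exact_mod_cast Real.pi_ne_zero
        have hr' : (r : ℂ) ≠ 0 := by exact_mod_cast hr.ne'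
        field_simp
        rw [Complex.I_sq]; ring

/-- **Poisson summation** for Gaussians over a lattice. -/
theorem hasSum_gaussianRho_dual {r : ℝ} (hr : 0 < r) [MeasurableSpace E] [BorelSpace E]
    {c : ℝ} (hc : ∀ h : E → ℂ, ∫ v : ι → ℝ, h (b.equivFun.symm v) = (c : ℂ) * ∫ x : E, h x)
    (hs : Summable fun k : ι → ℤ => gaussianRho (1 / r) (dualVec b k)) (u : E) :
    HasSum (fun k : ι → ℤ => c * r ^ Module.finrank ℝ E * gaussianRho (1 / r) (dualVec b k) *
        Real.cos (2 * Real.pi * inner ℝ (dualVec b k) u))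
      (∑' z : ι → ℤ, gaussianRho r (latticeVec b z + u)) := by
  obtain ⟨f, hf⟩ := exists_periodization b hr
  have h1 := mFourierCoeff_periodization b hr hc f hf
  have h2 : Summable (mFourierCoeff f) := by
    rw [show mFourierCoeff f = _ from funext h1]
    exact_mod_cast hs.mul_left _
  have h3 := hasSum_mFourier_series_apply_of_summable h2
    (fun i => ((b.equivFun u i : ℝ) : UnitAddCircle))
  rw [hf, LinearEquiv.symm_apply_apply] at h3
  have h4 := Complex.hasSum_re h3
  rw [Complex.ofReal_re] at h4
  refine h4.congr_fun fun k => ?_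
  have h5 := mFourier_neg_coe b (-k) (b.equivFun u)
  rw [neg_neg, LinearEquiv.symm_apply_apply] at h5
  rw [h1, h5, smul_eq_mul, Complex.re_ofReal_mul]
  congr 1
  have : -(2 * Real.pi * Complex.I) * (inner ℝ (dualVec b (-k)) u : ℂ) =
      ((2 * Real.pi * inner ℝ (dualVec b k) u : ℝ) : ℂ) * Complex.I := by
    have h6 : inner ℝ (dualVec b (-k)) u = -inner ℝ (dualVec b k) u := by
      simp [inner_dualVec]
    rw [h6]; push_cast; ring
  rw [this, Complex.exp_ofReal_mul_I_re]

end PoissonSummation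

/-! ### Dual mass and the smoothing parameter -/

section Smoothing

variable {E : Type*} [NormedAddCommGroup E] [InnerProductSpace ℝ E] [FiniteDimensional ℝ E]
variable {ι : Type*} [Fintype ι] (b : Module.Basis ι ℝ E)

theorem dualVec_injective : Function.Injective (dualVec b : (ι → ℤ) → E) := by
  classical
  intro k k' h
  ext i
  have := congrArg (fun w => inner ℝ w (b i)) h
  simpa [inner_dualVec, Finsupp.single_apply] using this

theorem dualVec_zero : dualVec b (0 : ι → ℤ) = 0 := by simp [dualVec]

/-- Lets every sum over the dual lattice run over integer vectors instead. -/
theorem range_dualVec :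
    Set.range (dualVec b) = latticeDual (Submodule.span ℤ (Set.range b)) := by
  classical
  have hspan : Submodule.span ℝ ((Submodule.span ℤ (Set.range b) : Submodule ℤ E) : Set E) = ⊤ := by
    rw [eq_top_iff, ← b.span_eq]
    exact Submodule.span_mono Submodule.subset_span
  ext w
  constructor
  · rintro ⟨k, rfl⟩
    refine ⟨by rw [hspan]; trivial, fun y hy => ?_⟩
    obtain ⟨z, hz⟩ := (b.restrictScalars ℤ).equivFun.symm.surjective ⟨y, hy⟩
    have hz' : y = latticeVec b z := by rw [latticeVec_eq_repr_symm, hz]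
    refine ⟨∑ i, k i * z i, ?_⟩
    rw [hz', inner_dualVec, latticeVec]
    push_cast
    refine Finset.sum_congr rfl fun i _ => ?_
    rw [← Module.Basis.equivFun_apply, LinearEquiv.apply_symm_apply]
  · rintro ⟨-, hw⟩
    choose k hk using fun i => hw (b i) (Submodule.subset_span ⟨i, rfl⟩)
    refine ⟨k, ?_⟩
    refine ext_inner_right ℝ fun x => ?_
    rw [inner_dualVec]
    conv_rhs => rw [← b.sum_repr x, inner_sum]
    refine Finset.sum_congr rfl fun i _ => ?_
    rw [inner_smul_right, hk, mul_comm]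

theorem gaussianMass_latticeDual (s : ℝ) :
    gaussianMass s (latticeDual (Submodule.span ℤ (Set.range b))) =
      ∑' k : ι → ℤ, gaussianRho s (dualVec b k) := by
  rw [gaussianMass, ← range_dualVec]
  exact (Equiv.ofInjective _ (dualVec_injective b)).tsum_eq
    (fun x : Set.range (dualVec b) => gaussianRho s (x : E)) |>.symm

theorem gaussianRho_inv_eq {s : ℝ} (x : E) :
    gaussianRho (1 / s) x = Real.exp (-(Real.pi * ‖x‖ ^ 2 * s ^ 2)) := by
  rw [gaussianRho]; congr 1; rw [one_div, inv_pow, div_inv_eq_mul]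

theorem gaussianRho_zero (s : ℝ) : gaussianRho s (0 : E) = 1 := by simp [gaussianRho]

/-- The i-th coordinate of k is the inner product of `dualVec b k` with `b i`, so by Cauchy–Schwarz
the norm of the dual vector controls that of k, and the sum is dominated by a Gaussian sum over ℤ^ι.
-/
theorem summable_gaussianRho_dualVec {s : ℝ} (hs : 0 < s) :
    Summable fun k : ι → ℤ => gaussianRho s (dualVec b k) := by
  classical
  -- The summand 1 keeps `R` positive even when there are no coordinates.
  set R : ℝ := ∑ i, ‖b i‖ ^ 2 + 1
  have hR : 0 < R := by positivity
  have h1 := summable_gaussianRho_latticeVec (EuclideanSpace.basisFun ι ℝ).toBasis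
    (r := s * √R) (by positivity)
  refine h1.of_nonneg_of_le (fun _ => (gaussianRho_pos _ _).le) fun k => ?_
  rw [gaussianRho, gaussianRho, Real.exp_le_exp, neg_le_neg_iff]
  have h2 : ‖latticeVec (EuclideanSpace.basisFun ι ℝ).toBasis k‖ ^ 2 = ∑ i, (k i : ℝ) ^ 2 := by
    rw [EuclideanSpace.norm_sq_eq]
    refine Finset.sum_congr rfl fun i _ => ?_
    simp [latticeVec]
    rfl
  have h3 : ∑ i, (k i : ℝ) ^ 2 ≤ ‖dualVec b k‖ ^ 2 * R := by
    calc ∑ i, (k i : ℝ) ^ 2 ≤ ∑ i, ‖dualVec b k‖ ^ 2 * ‖b i‖ ^ 2 := by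
          refine Finset.sum_le_sum fun i _ => ?_
          have h4 := abs_real_inner_le_norm (dualVec b k) (b i)
          rw [inner_dualVec] at h4
          have h5 : ∑ j, (k j : ℝ) * b.repr (b i) j = k i := by simp [Finsupp.single_apply]
          rw [h5] at h4
          rw [← mul_pow, ← sq_abs]
          gcongr
      _ ≤ _ := by
          rw [← Finset.mul_sum]
          gcongr
          simp [R]
  rw [h2, mul_pow, Real.sq_sqrt hR.le, div_le_div_iff₀ (by positivity) (by positivity)]
  have hp := mul_le_mul_of_nonneg_left h3 (mul_pos Real.pi_pos (pow_pos hs 2)).le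
  nlinarith

/-- The mass outside the origin. -/
theorem tsum_dualVec_eq {s : ℝ} (hs : 0 < s) [DecidableEq (ι → ℤ)] :
    ∑' k : ι → ℤ, gaussianRho (1 / s) (dualVec b k) =
      1 + ∑' k : ι → ℤ, if k = 0 then 0 else gaussianRho (1 / s) (dualVec b k) := by
  rw [(summable_gaussianRho_dualVec b (one_div_pos.2 hs)).tsum_eq_add_tsum_ite 0, dualVec_zero,
    gaussianRho_zero]

theorem summable_ite_dualVec {s : ℝ} (hs : 0 < s) [DecidableEq (ι → ℤ)] :
    Summable fun k : ι → ℤ => if k = 0 then 0 else gaussianRho (1 / s) (dualVec b k) :=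
  (summable_gaussianRho_dualVec b (one_div_pos.2 hs)).of_nonneg_of_le
    (fun k => by split_ifs; exacts [le_rfl, (gaussianRho_pos _ _).le])
    (fun k => by split_ifs; exacts [(gaussianRho_pos _ _).le, le_rfl])

theorem gaussianRho_inv_antitone {s t : ℝ} (hs : 0 < s) (hst : s ≤ t) (x : E) :
    gaussianRho (1 / t) x ≤ gaussianRho (1 / s) x := by
  rw [gaussianRho_inv_eq, gaussianRho_inv_eq, Real.exp_le_exp, neg_le_neg_iff]
  have := Real.pi_pos
  gcongr

theorem dualMass_antitone {s t : ℝ} (hs : 0 < s) (hst : s ≤ t) :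
    ∑' k : ι → ℤ, gaussianRho (1 / t) (dualVec b k) ≤
      ∑' k : ι → ℤ, gaussianRho (1 / s) (dualVec b k) :=
  (summable_gaussianRho_dualVec b (one_div_pos.2 (hs.trans_le hst))).tsum_le_tsum
    (fun _ => gaussianRho_inv_antitone hs hst _) (summable_gaussianRho_dualVec b (one_div_pos.2 hs))

theorem continuousOn_dualMass :
    ContinuousOn (fun s : ℝ => ∑' k : ι → ℤ, gaussianRho (1 / s) (dualVec b k)) (Set.Ioi 0) := by
  intro s hs
  have hs' : 0 < s / 2 := half_pos hs
  have : ContinuousOn (fun s : ℝ => ∑' k : ι → ℤ, gaussianRho (1 / s) (dualVec b k))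
      (Set.Ioi (s / 2)) := by
    refine continuousOn_tsum (fun k => ?_) (summable_gaussianRho_dualVec b (one_div_pos.2 hs')) ?_
    · simp_rw [gaussianRho_inv_eq]; fun_prop
    · intro k x hx
      rw [Real.norm_of_nonneg (gaussianRho_pos _ _).le]
      exact gaussianRho_inv_antitone hs' (Set.mem_Ioi.1 hx).le _
  exact (this.continuousAt (Ioi_mem_nhds (half_lt_self hs))).continuousWithinAt

/-- Intermediate value theorem: the mass tends to 1 as s grows, and becomes arbitrarily large near 0
because more and more dual vectors contribute almost 1. Without this the infimum defining
`smoothingParam` could be that of the empty set. -/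
theorem exists_dualMass_eq [Nonempty ι] {ε : ℝ} (hε : 0 < ε) :
    ∃ s : ℝ, 0 < s ∧ ∑' k : ι → ℤ, gaussianRho (1 / s) (dualVec b k) = 1 + ε := by
  classical
  obtain ⟨s₁, hs₁, h₁⟩ : ∃ s : ℝ, 0 < s ∧
      ∑' k : ι → ℤ, gaussianRho (1 / s) (dualVec b k) ≤ 1 + ε := by
    have ht : Tendsto (fun s : ℝ => ∑' k : ι → ℤ,
        if k = 0 then 0 else gaussianRho (1 / s) (dualVec b k)) atTop
        (nhds (∑' k : ι → ℤ, (0 : ℝ))) := by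
      refine tendsto_tsum_of_dominated_convergence (summable_ite_dualVec b one_pos)
        (fun k => ?_) ?_
      · by_cases hk : k = 0
        · simp [hk]
        · simp only [hk, if_false, gaussianRho_inv_eq]
          refine Real.tendsto_exp_neg_atTop_nhds_zero.comp ?_
          have hk' : dualVec b k ≠ 0 := fun h => hk (dualVec_injective b (h.trans (dualVec_zero b).symm))
          have : 0 < Real.pi * ‖dualVec b k‖ ^ 2 := by
            have := norm_pos_iff.2 hk'; have := Real.pi_pos; positivity
          exact (tendsto_pow_atTop two_ne_zero).const_mul_atTop this
      · filter_upwards [eventually_ge_atTop 1] with s hs k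
        split_ifs
        · simp
        · rw [Real.norm_of_nonneg (gaussianRho_pos _ _).le]
          exact gaussianRho_inv_antitone one_pos hs _
    rw [tsum_zero] at ht
    obtain ⟨s, hs1, hs2⟩ := ((ht.eventually (gt_mem_nhds hε)).and (eventually_gt_atTop 0)).exists
    exact ⟨s, hs2, by rw [tsum_dualVec_eq b hs2]; linarith⟩
  obtain ⟨s₀, hs₀, h₀⟩ : ∃ s : ℝ, 0 < s ∧
      1 + ε ≤ ∑' k : ι → ℤ, gaussianRho (1 / s) (dualVec b k) := by
    obtain ⟨J, hJ⟩ := exists_nat_gt (1 + ε)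
    obtain ⟨i⟩ := ‹Nonempty ι›
    let A : Finset (ι → ℤ) := (Finset.range J).image fun j : ℕ => Pi.single i (j : ℤ)
    have hA : A.card = J := by
      rw [Finset.card_image_of_injective, Finset.card_range]
      intro x y h
      simpa using Pi.single_injective i h
    have hc : Continuous fun s : ℝ => ∑ k ∈ A, gaussianRho (1 / s) (dualVec b k) := by
      simp_rw [gaussianRho_inv_eq]; fun_prop
    -- With the convention for division by zero the finite sum extends continuously to s = 0, where
    -- every term is 1.
    have h0 : ∑ k ∈ A, gaussianRho (1 / (0 : ℝ)) (dualVec b k) = J := by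
      simp [gaussianRho, hA]
    have he : ∀ᶠ s in nhds (0 : ℝ), 1 + ε < ∑ k ∈ A, gaussianRho (1 / s) (dualVec b k) :=
      hc.continuousAt.eventually (lt_mem_nhds (by beta_reduce; rw [h0]; exact hJ))
    obtain ⟨s, hs1, hs2⟩ := ((he.filter_mono nhdsWithin_le_nhds).and
      (self_mem_nhdsWithin (a := (0 : ℝ)) (s := Set.Ioi 0))).exists
    exact ⟨s, hs2, hs1.le.trans ((summable_gaussianRho_dualVec b (one_div_pos.2 hs2)).sum_le_tsum _
      fun _ _ => (gaussianRho_pos _ _).le)⟩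
  have hpc : IsPreconnected (Set.Ioi (0 : ℝ)) := isPreconnected_Ioi
  obtain ⟨s, hs, h⟩ := hpc.intermediate_value hs₁ hs₀ (continuousOn_dualMass b) ⟨h₁, h₀⟩
  exact ⟨s, hs, h⟩

/-- That the infimum is attained is not needed: above any t > s there is a smaller point where the
mass is 1 + ε, monotonicity transports the bound to t, and t decreases to s by continuity. -/
theorem dualMass_le_of_smoothingParam_le [Nonempty ι] {ε s : ℝ} (hε : 0 < ε) (hs : 0 < s)
    (h : smoothingParam ε (Submodule.span ℤ (Set.range b)) ≤ s) :
    ∑' k : ι → ℤ, gaussianRho (1 / s) (dualVec b k) ≤ 1 + ε := by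
  have hgt : ∀ t, s < t → ∑' k : ι → ℤ, gaussianRho (1 / t) (dualVec b k) ≤ 1 + ε := by
    -- The member s₁ of the defining set lies below t, and the mass is antitone.
    intro t ht
    obtain ⟨s₀, hs₀, h₀⟩ := exists_dualMass_eq b hε
    obtain ⟨s₁, ⟨hs₁, h₁⟩, hlt⟩ := exists_lt_of_csInf_lt
      (s := {s : ℝ | 0 < s ∧ gaussianMass (1 / s)
        (latticeDual (Submodule.span ℤ (Set.range b))) = 1 + ε})
      ⟨s₀, hs₀, by rw [gaussianMass_latticeDual]; exact h₀⟩ (h.trans_lt ht)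
    rw [gaussianMass_latticeDual] at h₁
    exact (dualMass_antitone b hs₁ hlt.le).trans h₁.le
  have hcont := ((continuousOn_dualMass b).continuousAt (Ioi_mem_nhds hs)).continuousWithinAt
    (s := Set.Ioi s)
  exact le_of_tendsto hcont.tendsto (by filter_upwards [self_mem_nhdsWithin] with t ht using hgt t ht)

/-- Scaling the parameter by √t raises each nonzero dual term to the power t, and ∑ aᵏ with exponent
t is at most (∑ a)^t for nonnegative terms. This is where the exponent of ε in the final error comes
from. -/
theorem dualMass_sub_one_le_pow {s ε : ℝ} (hs : 0 < s) {t : ℕ} (ht : t ≠ 0)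
    (h : ∑' k : ι → ℤ, gaussianRho (1 / s) (dualVec b k) ≤ 1 + ε) :
    ∑' k : ι → ℤ, gaussianRho (1 / (√t * s)) (dualVec b k) ≤ 1 + ε ^ t := by
  classical
  have ht' : 0 < √(t : ℝ) := Real.sqrt_pos.2 (by positivity)
  rw [tsum_dualVec_eq b (by positivity)]
  rw [tsum_dualVec_eq b hs] at h
  set a : (ι → ℤ) → ℝ := fun k => if k = 0 then 0 else gaussianRho (1 / s) (dualVec b k) with ha
  have hsum : Summable a := summable_ite_dualVec b hs
  have ha0 : ∀ k, 0 ≤ a k := fun k => by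
    simp only [ha]; split_ifs; exacts [le_rfl, (gaussianRho_pos _ _).le]
  have hA : ∑' k, a k ≤ ε := by linarith
  have hak : ∀ k, a k ≤ ε := fun k => (hsum.le_tsum k fun j _ => ha0 j).trans hA
  have hε : 0 ≤ ε := (ha0 0).trans (hak 0)
  have hpow : ∀ k, (if k = 0 then 0 else gaussianRho (1 / (√t * s)) (dualVec b k)) = a k ^ t := by
    intro k
    simp only [ha]
    split_ifs
    · rw [zero_pow ht]
    · rw [gaussianRho_inv_eq, gaussianRho_inv_eq, ← Real.exp_nat_mul, mul_pow,
        Real.sq_sqrt (by positivity)]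
      congr 1; ring
  simp_rw [hpow]
  obtain ⟨j, rfl⟩ := Nat.exists_eq_succ_of_ne_zero ht
  have hle : ∀ k, a k ^ (j + 1) ≤ ε ^ j * a k := fun k => by
    rw [pow_succ]
    exact mul_le_mul_of_nonneg_right (pow_le_pow_left₀ (ha0 k) (hak k) j) (ha0 k)
  have h2 := (((hsum.mul_left (ε ^ j)).of_nonneg_of_le (fun k => pow_nonneg (ha0 k) _) hle)).tsum_le_tsum
    hle (hsum.mul_left _)
  rw [tsum_mul_left] at h2
  have h3 : ε ^ j * ∑' k, a k ≤ ε ^ (j + 1) := by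
    rw [pow_succ]; exact mul_le_mul_of_nonneg_left hA (by positivity)
  simpa using h2.trans h3

/-- Above smoothing, every translate of the lattice has nearly the same Gaussian mass. -/
theorem exists_abs_tsum_gaussianRho_sub_le :
    ∃ c : ℝ, 0 < c ∧ ∀ r : ℝ, 0 < r →
      c * r ^ Module.finrank ℝ E ≤ ∑' z : ι → ℤ, gaussianRho r (latticeVec b z) ∧
      ∀ δ : ℝ, ∑' k : ι → ℤ, gaussianRho (1 / r) (dualVec b k) ≤ 1 + δ → ∀ u : E,
        |∑' z : ι → ℤ, gaussianRho r (latticeVec b z + u) - c * r ^ Module.finrank ℝ E| ≤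
          c * r ^ Module.finrank ℝ E * δ := by
  classical
  let _ : MeasurableSpace E := borel E
  have : BorelSpace E := ⟨rfl⟩
  obtain ⟨c, hc0, hc⟩ := exists_integral_comp_equivFun_symm b
  refine ⟨c, hc0, fun r hr => ?_⟩
  set V := c * r ^ Module.finrank ℝ E
  have hV : 0 < V := by positivity
  have hsum := summable_gaussianRho_dualVec b (one_div_pos.2 hr)
  have hP := hasSum_gaussianRho_dual b hr hc hsum
  refine ⟨?_, fun δ hδ u => ?_⟩
  -- At the origin every term of the Poisson series is nonnegative, so the zero frequency alone is a
  -- lower bound; no smoothing assumption enters.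
  · have h := hP 0
    simp only [inner_zero_right, mul_zero, Real.cos_zero, mul_one, add_zero] at h
    have h1 := le_hasSum h 0 fun k _ => by have := gaussianRho_pos (1 / r) (dualVec b k); positivity
    rwa [dualVec_zero, gaussianRho_zero, mul_one] at h1
  · have h := hP u
    rw [← h.tsum_eq, h.summable.tsum_eq_add_tsum_ite 0, dualVec_zero, gaussianRho_zero,
      inner_zero_left, mul_zero, Real.cos_zero, mul_one, mul_one]
    rw [tsum_dualVec_eq b hr] at hδ
    have hb : ∀ k : ι → ℤ, ‖(if k = 0 then 0 else V * gaussianRho (1 / r) (dualVec b k) *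
        Real.cos (2 * Real.pi * inner ℝ (dualVec b k) u))‖ ≤
        V * (if k = 0 then 0 else gaussianRho (1 / r) (dualVec b k)) := by
      intro k
      split_ifs
      · simp
      · rw [norm_mul, norm_mul, Real.norm_of_nonneg hV.le,
          Real.norm_of_nonneg (gaussianRho_pos _ _).le]
        exact mul_le_of_le_one_right (by have := gaussianRho_pos (1 / r) (dualVec b k); positivity)
          (Real.abs_cos_le_one _)
    have h2 := tsum_of_norm_bounded ((summable_ite_dualVec b hr).mul_left V).hasSum hb
    rw [tsum_mul_left, Real.norm_eq_abs] at h2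
    rw [add_sub_cancel_left]
    exact h2.trans (mul_le_mul_of_nonneg_left (by linarith) hV.le)

end Smoothing

/-! ### Adding one sample in a coset of `q L` to a Gaussian sum -/

section Convolution

variable {E : Type*} [NormedAddCommGroup E] [InnerProductSpace ℝ E]

/-- Completing the square in x. The sign e = ±1 treats added samples and the subtracted target
alike. -/
theorem gaussianRho_mul_gaussianRho {s t : ℝ} (ht : 0 < t) {e : ℤ} (he : e * e = 1)
    (x z : E) :
    gaussianRho s x * gaussianRho (s * √t) (z - e • x) =
      gaussianRho (s * √(t + 1)) z *
        gaussianRho (s * √(t / (t + 1))) (x - ((e : ℝ) / (t + 1)) • z) := by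
  rcases eq_or_ne s 0 with rfl | hs
  · simp [gaussianRho]
  simp only [gaussianRho, ← Real.exp_add]
  congr 1
  have he' : (e : ℝ) * e = 1 := by exact_mod_cast he
  have h1 : ‖z - e • x‖ ^ 2 = ‖z‖ ^ 2 - 2 * (e * inner ℝ z x) + ‖x‖ ^ 2 := by
    rw [← Int.cast_smul_eq_zsmul ℝ, norm_sub_sq_real, inner_smul_right, norm_smul, mul_pow,
      Real.norm_eq_abs, sq_abs, pow_two (e : ℝ), he', one_mul]
  have h2 : ‖x - ((e : ℝ) / (t + 1)) • z‖ ^ 2 =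
      ‖x‖ ^ 2 - 2 * (e / (t + 1) * inner ℝ z x) + (1 / (t + 1)) ^ 2 * ‖z‖ ^ 2 := by
    have h3 : ((e : ℝ) / (t + 1)) ^ 2 = (1 / (t + 1)) ^ 2 := by
      rw [div_pow, div_pow, pow_two (e : ℝ), he', one_pow]
    rw [norm_sub_sq_real, inner_smul_right, norm_smul, mul_pow, Real.norm_eq_abs, sq_abs,
      real_inner_comm, h3]
  rw [h1, h2, mul_pow, mul_pow, mul_pow, Real.sq_sqrt ht.le, Real.sq_sqrt (by positivity),
    Real.sq_sqrt (by positivity)]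
  have : t + 1 ≠ 0 := by positivity
  field_simp
  ring

theorem gaussianRho_smul {r q : ℝ} (hq : q ≠ 0) (x : E) :
    gaussianRho r (q • x) = gaussianRho (r / q) x := by
  rcases eq_or_ne r 0 with rfl | hr
  · simp [gaussianRho]
  simp only [gaussianRho, norm_smul, mul_pow, Real.norm_eq_abs, sq_abs]
  congr 1; field_simp

variable {ι : Type*} [Fintype ι] (b : Module.Basis ι ℝ E)

/-- Reduction of a lattice vector modulo `q` times the lattice. -/
noncomputable def latticeMod (q : ℕ) : Submodule.span ℤ (Set.range b) →+ (ι → ZMod q) where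
  toFun x i := (((b.restrictScalars ℤ).repr x i : ℤ) : ZMod q)
  map_zero' := by ext; simp
  map_add' x y := by ext; simp

theorem latticeMod_apply (q : ℕ) (x : Submodule.span ℤ (Set.range b)) (i : ι) :
    latticeMod b q x i = (((b.restrictScalars ℤ).repr x i : ℤ) : ZMod q) := rfl

theorem latticeMod_surjective (q : ℕ) [NeZero q] : Function.Surjective (latticeMod b q) := by
  intro c
  refine ⟨(b.restrictScalars ℤ).equivFun.symm fun i => ((c i).val : ℤ), ?_⟩
  ext i
  rw [latticeMod_apply, ← Module.Basis.equivFun_apply, LinearEquiv.apply_symm_apply]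
  simp

theorem latticeMod_nsmul (q : ℕ) (y : Submodule.span ℤ (Set.range b)) :
    latticeMod b q ((q : ℤ) • y) = 0 := by
  ext i; simp [latticeMod_apply]

theorem exists_eq_smul_of_latticeMod_eq_zero {q : ℕ} {x : Submodule.span ℤ (Set.range b)}
    (h : latticeMod b q x = 0) : ∃ y, x = (q : ℤ) • y := by
  have h1 : ∀ i, ∃ k : ℤ, (b.restrictScalars ℤ).repr x i = q * k := fun i => by
    have := congrFun h i
    rw [latticeMod_apply, Pi.zero_apply, ZMod.intCast_zmod_eq_zero_iff_dvd] at this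
    exact this
  choose k hk using h1
  refine ⟨(b.restrictScalars ℤ).equivFun.symm k, ?_⟩
  apply (b.restrictScalars ℤ).equivFun.injective
  rw [map_smul, LinearEquiv.apply_symm_apply]
  ext i
  simp [hk]

variable [FiniteDimensional ℝ E]

/-- A shifted coset of `q L` is q times a translate of `L`. The translation vector may stay
anonymous because the Poisson estimates are uniform in it. -/
theorem tsum_latticeMod_eq {q : ℕ} [NeZero q] {r : ℝ} (hr : 0 < r)
    (c : ι → ZMod q) (v : E) : ∃ u : E,
    ∑' x : Submodule.span ℤ (Set.range b),
      (if latticeMod b q x = c then ENNReal.ofReal (gaussianRho r ((x : E) - v)) else 0) =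
    ENNReal.ofReal (∑' z : ι → ℤ, gaussianRho (r / q) (latticeVec b z + u)) := by
  have hq : (q : ℝ) ≠ 0 := by exact_mod_cast NeZero.ne q
  have hq0 : (0 : ℝ) < q := by exact_mod_cast NeZero.pos q
  obtain ⟨a, ha⟩ := latticeMod_surjective b q c
  refine ⟨(1 / q : ℝ) • ((a : E) - v), ?_⟩
  let e : (ι → ℤ) ≃ Submodule.span ℤ (Set.range b) := (b.restrictScalars ℤ).equivFun.symm.toEquiv
  let g : (ι → ℤ) → Submodule.span ℤ (Set.range b) := fun z => a + (q : ℤ) • e z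
  have hg : Function.Injective g := by
    intro z z' h
    have h1 : (q : ℤ) • e z = (q : ℤ) • e z' := add_left_cancel h
    refine e.injective (Subtype.ext ?_)
    have h2 := congrArg (fun y : Submodule.span ℤ (Set.range b) => (y : E)) h1
    simp only [Submodule.coe_smul_of_tower, natCast_zsmul, ← Nat.cast_smul_eq_nsmul ℝ] at h2
    exact smul_right_injective E hq h2
  rw [ENNReal.ofReal_tsum_of_nonneg (fun _ => (gaussianRho_pos _ _).le)
    (summable_gaussianRho_latticeVec_add b (by positivity) _)]
  rw [← hg.tsum_eq]
  · refine tsum_congr fun z => ?_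
    have h1 : latticeMod b q (g z) = c := by
      rw [map_add, latticeMod_nsmul, ha, add_zero]
    rw [if_pos h1]
    congr 1
    rw [← gaussianRho_smul hq]
    congr 1
    rw [smul_add, smul_smul, mul_one_div_cancel hq, one_smul, latticeVec_eq_repr_symm]
    simp only [g, Submodule.coe_add, Submodule.coe_smul_of_tower,
      Nat.cast_smul_eq_nsmul]
    have : (e z : E) = ((b.restrictScalars ℤ).equivFun.symm z : E) := rfl
    rw [this]; abel
  · intro x hx
    have hx' : latticeMod b q x = c := by
      by_contra h
      exact hx (if_neg h)
    obtain ⟨y, hy⟩ := exists_eq_smul_of_latticeMod_eq_zero b (q := q) (x := x - a)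
      (by rw [map_sub, hx', ha, sub_self])
    refine ⟨e.symm y, ?_⟩
    simp only [g, Equiv.apply_symm_apply, ← hy]
    abel

/-- The weight of a lattice vector for the Gaussian restricted to a coset of `q` times the
lattice. -/
noncomputable def cosetWeight (q : ℕ) (s : ℝ) (c : ι → ZMod q)
    (x : Submodule.span ℤ (Set.range b)) : ℝ≥0∞ :=
  if latticeMod b q x = c then ENNReal.ofReal (gaussianRho s (x : E)) else 0

/-- The normalized Gaussian expected for a sum of `j` independent vectors. -/
noncomputable def sumWeight (q : ℕ) (s c₀ : ℝ) (j : ℕ) (z : Submodule.span ℤ (Set.range b)) :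
    ℝ≥0∞ :=
  open Classical in
  if j = 0 then (if z = 0 then 1 else 0)
  else ENNReal.ofReal
    (gaussianRho (s * √j) (z : E) / (c₀ * (s * √j / q) ^ Module.finrank ℝ E))

/-- `c₀` is the constant of the Poisson summation formula of the lattice. -/
def IsPoissonConst (c₀ : ℝ) : Prop :=
  0 < c₀ ∧ ∀ r : ℝ, 0 < r →
      c₀ * r ^ Module.finrank ℝ E ≤ ∑' z : ι → ℤ, gaussianRho r (latticeVec b z) ∧
      ∀ δ : ℝ, ∑' k : ι → ℤ, gaussianRho (1 / r) (dualVec b k) ≤ 1 + δ → ∀ u : E,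
        |∑' z : ι → ℤ, gaussianRho r (latticeVec b z + u) - c₀ * r ^ Module.finrank ℝ E| ≤
          c₀ * r ^ Module.finrank ℝ E * δ

variable {b}

theorem le_tsum_latticeMod {c₀ : ℝ} (hc₀ : IsPoissonConst b c₀) {q : ℕ} [NeZero q] {r δ : ℝ}
    (hr : 0 < r) (hδ : ∑' k : ι → ℤ, gaussianRho (1 / (r / q)) (dualVec b k) ≤ 1 + δ)
    (c : ι → ZMod q) (v : E) :
    ENNReal.ofReal (c₀ * (r / q) ^ Module.finrank ℝ E * (1 - δ)) ≤
    ∑' x : Submodule.span ℤ (Set.range b),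
      (if latticeMod b q x = c then ENNReal.ofReal (gaussianRho r ((x : E) - v)) else 0) := by
  have hq0 : (0 : ℝ) < q := by exact_mod_cast NeZero.pos q
  obtain ⟨u, hu⟩ := tsum_latticeMod_eq b hr c v
  rw [hu]
  refine ENNReal.ofReal_le_ofReal ?_
  have := (abs_le.1 ((hc₀.2 (r / q) (by positivity)).2 δ hδ u)).1
  linarith

theorem tsum_latticeMod_le {c₀ : ℝ} (hc₀ : IsPoissonConst b c₀) {q : ℕ} [NeZero q] {r δ : ℝ}
    (hr : 0 < r) (hδ : ∑' k : ι → ℤ, gaussianRho (1 / (r / q)) (dualVec b k) ≤ 1 + δ)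
    (c : ι → ZMod q) (v : E) :
    ∑' x : Submodule.span ℤ (Set.range b),
      (if latticeMod b q x = c then ENNReal.ofReal (gaussianRho r ((x : E) - v)) else 0) ≤
    ENNReal.ofReal (c₀ * (r / q) ^ Module.finrank ℝ E * (1 + δ)) := by
  have hq0 : (0 : ℝ) < q := by exact_mod_cast NeZero.pos q
  obtain ⟨u, hu⟩ := tsum_latticeMod_eq b hr c v
  rw [hu]
  refine ENNReal.ofReal_le_ofReal ?_
  have := (abs_le.1 ((hc₀.2 (r / q) (by positivity)).2 δ hδ u)).2
  linarith

theorem le_tsum_cosetWeight {c₀ : ℝ} (hc₀ : IsPoissonConst b c₀) {q : ℕ} [NeZero q] {s δ : ℝ}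
    (hs : 0 < s) (hδ : ∑' k : ι → ℤ, gaussianRho (1 / (s / √2 / q)) (dualVec b k) ≤ 1 + δ)
    (c : ι → ZMod q) :
    ENNReal.ofReal (c₀ * (s / q) ^ Module.finrank ℝ E * (1 - δ)) ≤
      ∑' x, cosetWeight b q s c x := by
  have hq0 : (0 : ℝ) < q := by exact_mod_cast NeZero.pos q
  have h2 : s / √2 ≤ s := div_le_self hs.le (Real.one_le_sqrt.2 (by norm_num))
  have := le_tsum_latticeMod hc₀ hs ((dualMass_antitone b (by positivity)
    (div_le_div_of_nonneg_right h2 hq0.le)).trans hδ) c 0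
  simpa only [sub_zero, cosetWeight] using this

/-- After completing the square the right side is a constant times the mass of a shifted coset
Gaussian, to which the Poisson lower bound applies. The hypothesis on cosets matters only for j = 0,
where nothing is left to average over. -/
theorem mul_sumWeight_succ_le {c₀ : ℝ} (hc₀ : IsPoissonConst b c₀) {q : ℕ} [NeZero q] {s δ : ℝ}
    (hs : 0 < s) (hδ0 : 0 ≤ δ)
    (hδ : ∑' k : ι → ℤ, gaussianRho (1 / (s / √2 / q)) (dualVec b k) ≤ 1 + δ)
    {e : ℤ} (he : e * e = 1) (j : ℕ) (c : ι → ZMod q) (z : Submodule.span ℤ (Set.range b))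
    (hz : j = 0 → latticeMod b q z = e • c) :
    ENNReal.ofReal (c₀ * (s / q) ^ Module.finrank ℝ E * (1 - δ)) * sumWeight b q s c₀ (j + 1) z ≤
      ∑' x, cosetWeight b q s c x * sumWeight b q s c₀ j (z - e • x) := by
  classical
  have hq0 : (0 : ℝ) < q := by exact_mod_cast NeZero.pos q
  have hc0 := hc₀.1
  -- For j = 0 the previous law is a point mass at 0, so the single term x = e • z carries the whole
  -- sum.
  rcases Nat.eq_zero_or_pos j with rfl | hj
  · have h1 : latticeMod b q (e • z) = c := by
      rw [map_zsmul, hz rfl, smul_smul, he, one_smul]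
    refine le_trans ?_ (ENNReal.le_tsum (e • z))
    rw [cosetWeight, if_pos h1, sumWeight, sumWeight, if_neg (by omega), if_pos rfl, smul_smul, he,
      one_smul, sub_self, if_pos rfl, mul_one]
    have h2 : gaussianRho s ((e • z : Submodule.span ℤ (Set.range b)) : E) = gaussianRho s (z : E) := by
      have h3 : ‖((e • z : Submodule.span ℤ (Set.range b)) : E)‖ = ‖(z : E)‖ := by
        rcases mul_self_eq_one_iff.1 he with rfl | rfl <;> simp
      rw [gaussianRho, gaussianRho, h3]
    rw [h2]
    -- Truncation by `ENNReal.ofReal` makes the left side vanish in this case.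
    by_cases h1δ : 1 - δ ≤ 0
    · rw [ENNReal.ofReal_of_nonpos (mul_nonpos_of_nonneg_of_nonpos (by positivity) h1δ), zero_mul]
      exact zero_le
    push Not at h1δ
    rw [← ENNReal.ofReal_mul (by positivity)]
    refine ENNReal.ofReal_le_ofReal ?_
    simp only [zero_add, Nat.cast_one, Real.sqrt_one, mul_one]
    rw [mul_div_assoc', div_le_iff₀ (by positivity)]
    have := gaussianRho_pos s (z : E)
    have h4 : (1 - δ) ≤ 1 := by linarith
    calc c₀ * (s / q) ^ Module.finrank ℝ E * (1 - δ) * gaussianRho s (z : E)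
        ≤ c₀ * (s / q) ^ Module.finrank ℝ E * 1 * gaussianRho s (z : E) := by gcongr
      _ = _ := by ring
  · have hj' : (0 : ℝ) < j := by exact_mod_cast hj
    have hj1 : (1 : ℝ) ≤ j := by exact_mod_cast hj
    set r := s * √((j : ℝ) / (j + 1)) with hrdef
    have hr : 0 < r := by positivity
    -- The residual width s√(j/(j+1)) is smallest at j = 1; this is the reason for s/√2 in the
    -- smoothing hypothesis.
    have hr2 : s / √2 ≤ r := by
      rw [hrdef, div_eq_mul_inv, ← Real.sqrt_inv]
      refine mul_le_mul_of_nonneg_left (Real.sqrt_le_sqrt ?_) hs.le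
      rw [inv_eq_one_div, div_le_div_iff₀ (by norm_num) (by positivity)]; linarith
    have key := le_tsum_latticeMod hc₀ hr ((dualMass_antitone b (by positivity)
      (div_le_div_of_nonneg_right hr2 hq0.le)).trans hδ) c (((e : ℝ) / (j + 1)) • (z : E))
    set D := c₀ * (s * √j / q) ^ Module.finrank ℝ E with hD
    have hDpos : 0 < D := by positivity
    have hterm : ∀ x : Submodule.span ℤ (Set.range b),
        cosetWeight b q s c x * sumWeight b q s c₀ j (z - e • x) =
        ENNReal.ofReal (gaussianRho (s * √((j : ℝ) + 1)) (z : E) / D) *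
        (if latticeMod b q x = c then
          ENNReal.ofReal (gaussianRho r ((x : E) - ((e : ℝ) / (j + 1)) • (z : E))) else 0) := by
      intro x
      rw [cosetWeight, sumWeight, if_neg hj.ne']
      split_ifs with h
      · rw [← ENNReal.ofReal_mul (gaussianRho_pos _ _).le, ← ENNReal.ofReal_mul
          (div_nonneg (gaussianRho_pos _ _).le hDpos.le)]
        congr 1
        rw [mul_div_assoc', div_mul_eq_mul_div, ← gaussianRho_mul_gaussianRho hj' he]
        simp [hD]
      · simp
    simp_rw [hterm]
    rw [ENNReal.tsum_mul_left]
    refine le_trans (le_of_eq ?_) (mul_le_mul_right key _)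
    rw [sumWeight, if_neg (by omega), ← ENNReal.ofReal_mul' (div_nonneg (gaussianRho_pos _ _).le (by positivity)),
      ← ENNReal.ofReal_mul (div_nonneg (gaussianRho_pos _ _).le hDpos.le)]
    congr 1
    -- The product of the widths is unchanged by completing the square, so the normalizing constants
    -- match exactly.
    have hkey : (s / q) * (s * √j / q) = (r / q) * (s * √(j + 1) / q) := by
      rw [hrdef, Real.sqrt_div hj'.le]
      have : √((j : ℝ) + 1) ≠ 0 := by positivity
      field_simp
    have hkey' := congrArg (· ^ Module.finrank ℝ E) hkey
    simp only [mul_pow] at hkey'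
    push_cast
    rw [hD, mul_div_assoc', div_mul_eq_mul_div, div_eq_div_iff (by positivity) (by positivity)]
    linear_combination (c₀ ^ 2 * (1 - δ) * gaussianRho (s * √((j : ℝ) + 1)) (z : E)) * hkey'

end Convolution

/-! ### Lists of independent samples and statistical distance -/

section Samples

theorem ENNReal.tsum_fin_succ {α : Type*} {N : ℕ} (f : (Fin (N + 1) → α) → ℝ≥0∞) :
    ∑' x, f x = ∑' a, ∑' x : Fin N → α, f (Fin.cons a x) := by
  rw [← ENNReal.tsum_prod (f := fun a (x : Fin N → α) => f (Fin.cons a x))]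
  exact ((Fin.consEquiv fun _ : Fin (N + 1) => α).tsum_eq f).symm

theorem iidSamples_ofFn {α : Type*} (p : PMF α) {N : ℕ} (x : Fin N → α) :
    iidSamples p N (List.ofFn x) = ∏ i, p (x i) := by
  classical
  induction N with
  | zero => simp [iidSamples]
  | succ N ih =>
    rw [iidSamples, PMF.bind_apply, List.ofFn_succ, Fin.prod_univ_succ, ← ih fun i => x i.succ]
    rw [tsum_eq_single (x 0)]
    · congr 1
      rw [PMF.map_apply, tsum_eq_single (List.ofFn fun i => x i.succ)]
      · simp
      · intro l hl
        rw [if_neg]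
        intro h
        exact hl (List.cons.inj h).2.symm
    · intro a ha
      rw [PMF.map_apply, ENNReal.tsum_eq_zero.2, mul_zero]
      intro l
      rw [if_neg]
      intro h
      exact ha (List.cons.inj h).1.symm

theorem length_of_mem_support_iidSamples {α : Type*} (p : PMF α) {N : ℕ} {l : List α}
    (h : l ∈ (iidSamples p N).support) : l.length = N := by
  induction N generalizing l with
  | zero => simp_all [iidSamples]
  | succ N ih =>
    rw [iidSamples, PMF.mem_support_bind_iff] at h
    obtain ⟨a, -, h⟩ := h
    rw [PMF.mem_support_map_iff] at h
    obtain ⟨l', hl', rfl⟩ := h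
    simp [ih hl']

/-- Lists of length N account for all the mass, but a lower bound suffices and needs only the
injectivity of `List.ofFn`. -/
theorem tsum_ofFn_le_map_iidSamples {α β : Type*} [DecidableEq β] (p : PMF α) (N : ℕ) (f : List α → β) (y : β) :
    ∑' x : Fin N → α, (if f (List.ofFn x) = y then ∏ i, p (x i) else 0) ≤
      (iidSamples p N).map f y := by
  classical
  rw [PMF.map_apply]
  refine le_trans (le_of_eq ?_) (ENNReal.tsum_comp_le_tsum_of_injective
    (List.ofFn_injective (n := N)) _)
  refine tsum_congr fun x => ?_
  rw [iidSamples_ofFn]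
  by_cases h : f (List.ofFn x) = y
  · rw [if_pos h, if_pos h.symm]
  · rw [if_neg h, if_neg (Ne.symm h)]

/-- The law p consists of θ·q and a remainder of mass 1 - θ. Thanks to this the whole analysis of
the output law needs only one-sided estimates, and bad events may be discarded. -/
theorem statDist_le_of_le {α : Type*} (p q : PMF α) {θ : ℝ} (hθ : 0 ≤ θ)
    (h : ∀ z, ENNReal.ofReal θ * q z ≤ p z) : statDist p q ≤ 1 - θ := by
  have hsum : ∀ r : PMF α, HasSum (fun z => (r z).toReal) 1 := fun r => by
    have h1 := ENNReal.hasSum_toReal (f := r) (by rw [r.tsum_coe]; exact ENNReal.one_ne_top)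
    rwa [← ENNReal.tsum_toReal_eq fun a => r.apply_ne_top a, r.tsum_coe, ENNReal.toReal_one] at h1
  have hle : ∀ z, θ * (q z).toReal ≤ (p z).toReal := fun z => by
    have h1 := ENNReal.toReal_mono (p.apply_ne_top z) (h z)
    rwa [ENNReal.toReal_mul, ENNReal.toReal_ofReal hθ] at h1
  have hθ1 : θ ≤ 1 := by
    have := hasSum_le hle ((hsum q).mul_left θ) (hsum p)
    simpa using this
  -- Compare both laws with their common part θ·q.
  have hb : ∀ z, |(p z).toReal - (q z).toReal| ≤
      ((p z).toReal - θ * (q z).toReal) + (1 - θ) * (q z).toReal := fun z => by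
    have h1 := hle z
    have h2 : 0 ≤ (1 - θ) * (q z).toReal := mul_nonneg (by linarith) ENNReal.toReal_nonneg
    rw [abs_le]; constructor <;> linarith
  have hs := ((hsum p).sub ((hsum q).mul_left θ)).add ((hsum q).mul_left (1 - θ))
  have h3 : ∑' z, |(p z).toReal - (q z).toReal| ≤ 1 - θ * 1 + (1 - θ) * 1 := by
    rw [← hs.tsum_eq]
    exact (hs.summable.of_nonneg_of_le (fun _ => abs_nonneg _) hb).tsum_le_tsum hb hs.summable
  rw [statDist]
  linarith

end Samples

/-! ### Joint law of signed sums over disjoint sets of samples -/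

section SumLaw

variable {E : Type*} [NormedAddCommGroup E] [InnerProductSpace ℝ E] [FiniteDimensional ℝ E]
variable {ι : Type*} [Fintype ι] {b : Module.Basis ι ℝ E}

/-- Lower bound for the joint weight of several signed sums over disjoint sets of independent
Gaussian vectors in prescribed cosets. -/
theorem prod_sumWeight_le [DecidableEq (Submodule.span ℤ (Set.range b))]
    {c₀ : ℝ} (hc₀ : IsPoissonConst b c₀) {q : ℕ} [NeZero q] {s δ : ℝ}
    (hs : 0 < s) (hδ0 : 0 ≤ δ)
    (hδ : ∑' k : ι → ℤ, gaussianRho (1 / (s / √2 / q)) (dualVec b k) ≤ 1 + δ)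
    {K : ℕ} (N : ℕ) (c : Fin N → ι → ZMod q) (e : Fin N → Fin K → ℤ)
    (he : ∀ i, e i = 0 ∨ ∃ k, ∃ σ : ℤ, σ * σ = 1 ∧ e i = Pi.single k σ)
    (z : Fin K → Submodule.span ℤ (Set.range b))
    (hz : ∀ k, latticeMod b q (z k) = ∑ i, e i k • c i) :
    ENNReal.ofReal (c₀ * (s / q) ^ Module.finrank ℝ E * (1 - δ)) ^ N *
        ∏ k, sumWeight b q s c₀ (Finset.univ.filter fun i => e i k ≠ 0).card (z k) ≤
      ∑' x : Fin N → Submodule.span ℤ (Set.range b),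
        if ∀ k, ∑ i, e i k • x i = z k then ∏ i, cosetWeight b q s (c i) (x i) else 0 := by
  classical
  set v := ENNReal.ofReal (c₀ * (s / q) ^ Module.finrank ℝ E * (1 - δ))
  -- Remove one sample at a time. The prescribed sums must stay general because removing a sample
  -- shifts them.
  induction N generalizing z with
  | zero =>
    refine le_trans ?_ (ENNReal.le_tsum default)
    by_cases hz0 : ∀ k, z k = 0
    · simp [hz0, sumWeight]
    · push Not at hz0
      obtain ⟨k, hk⟩ := hz0
      rw [Finset.prod_eq_zero (Finset.mem_univ k), mul_zero]
      · exact zero_le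
      · simp [sumWeight, hk]
  | succ N ih =>
    rw [ENNReal.tsum_fin_succ]
    set c' : Fin N → ι → ZMod q := fun i => c i.succ
    set e' : Fin N → Fin K → ℤ := fun i => e i.succ
    have hcard : ∀ k, (Finset.univ.filter fun i => e i k ≠ 0).card =
        (if e 0 k ≠ 0 then 1 else 0) + (Finset.univ.filter fun i => e' i k ≠ 0).card := by
      intro k
      rw [Fin.card_filter_univ_succ]
      split_ifs <;> simp [e', add_comm]
    have hinner : ∀ a : Submodule.span ℤ (Set.range b),
        (∑' x : Fin N → Submodule.span ℤ (Set.range b),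
          if ∀ k, ∑ i, e i k • (Fin.cons a x : Fin (N + 1) → _) i = z k then
            ∏ i, cosetWeight b q s (c i) ((Fin.cons a x : Fin (N + 1) → _) i) else 0) =
        cosetWeight b q s (c 0) a * ∑' x : Fin N → Submodule.span ℤ (Set.range b),
          if ∀ k, ∑ i, e' i k • x i = z k - e 0 k • a then
            ∏ i, cosetWeight b q s (c' i) (x i) else 0 := by
      intro a
      rw [← ENNReal.tsum_mul_left]
      refine tsum_congr fun x => ?_
      have : (∀ k, ∑ i, e i k • (Fin.cons a x : Fin (N + 1) → Submodule.span ℤ (Set.range b)) i = z k) ↔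
          ∀ k, ∑ i, e' i k • x i = z k - e 0 k • a := by
        refine forall_congr' fun k => ?_
        rw [Fin.sum_univ_succ, eq_sub_iff_add_eq']
        simp [e']
      rw [if_congr this rfl rfl, Fin.prod_univ_succ]
      split_ifs <;> simp [c']
    simp_rw [hinner]
    have hstep : ∀ a, cosetWeight b q s (c 0) a * (v ^ N *
        ∏ k, sumWeight b q s c₀ (Finset.univ.filter fun i => e' i k ≠ 0).card (z k - e 0 k • a)) ≤
        cosetWeight b q s (c 0) a * ∑' x : Fin N → Submodule.span ℤ (Set.range b),
          if ∀ k, ∑ i, e' i k • x i = z k - e 0 k • a then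
            ∏ i, cosetWeight b q s (c' i) (x i) else 0 := by
      intro a
      -- Outside the prescribed coset the weight of the sample is zero; inside it the remaining sums
      -- have the coset that the induction hypothesis requires.
      by_cases ha : latticeMod b q a = c 0
      · refine mul_le_mul_right (ih c' e' (fun i => he i.succ) _ fun k => ?_) _
        rw [map_sub, map_zsmul, hz, ha, Fin.sum_univ_succ, add_sub_cancel_left]
      · simp [cosetWeight, ha]
    refine le_trans ?_ (ENNReal.tsum_le_tsum hstep)
    -- A sample used by no sum contributes its total coset mass; otherwise it belongs to exactly one
    -- sum, and the convolution estimate changes only that factor.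
    rcases he 0 with h0 | ⟨k₀, σ, hσ, h0⟩
    · simp only [h0, Pi.zero_apply, zero_smul, sub_zero, ne_eq, not_true_eq_false, if_false,
        zero_add] at hcard ⊢
      rw [ENNReal.tsum_mul_right, pow_succ', mul_assoc]
      simp_rw [hcard]
      exact mul_le_mul_left (le_tsum_cosetWeight hc₀ hs hδ _) _
    · have hσ0 : σ ≠ 0 := by rintro rfl; simp at hσ
      set M := ∏ k ∈ Finset.univ.erase k₀,
        sumWeight b q s c₀ (Finset.univ.filter fun i => e' i k ≠ 0).card (z k)
      have h1 : ∀ a, ∏ k, sumWeight b q s c₀ (Finset.univ.filter fun i => e' i k ≠ 0).card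
          (z k - e 0 k • a) =
          sumWeight b q s c₀ (Finset.univ.filter fun i => e' i k₀ ≠ 0).card (z k₀ - σ • a) * M := by
        intro a
        rw [← Finset.mul_prod_erase _ _ (Finset.mem_univ k₀)]
        congr 1
        · rw [h0, Pi.single_eq_same]
        · refine Finset.prod_congr rfl fun k hk => ?_
          rw [h0, Pi.single_eq_of_ne (Finset.ne_of_mem_erase hk), zero_smul, sub_zero]
      have h2 : ∏ k, sumWeight b q s c₀ (Finset.univ.filter fun i => e i k ≠ 0).card (z k) =
          sumWeight b q s c₀ ((Finset.univ.filter fun i => e' i k₀ ≠ 0).card + 1) (z k₀) * M := by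
        rw [← Finset.mul_prod_erase _ _ (Finset.mem_univ k₀)]
        congr 1
        · rw [hcard, h0, Pi.single_eq_same, if_pos hσ0, add_comm]
        · refine Finset.prod_congr rfl fun k hk => ?_
          rw [hcard, h0, Pi.single_eq_of_ne (Finset.ne_of_mem_erase hk)]
          simp
      simp_rw [h1]
      rw [h2]
      have h3 := mul_sumWeight_succ_le hc₀ hs hδ0 hδ hσ
        -- If this is the only sample of the sum `k₀`, the coset of `z k₀` is that of the sample up
        -- to sign.
        (Finset.univ.filter fun i => e' i k₀ ≠ 0).card (c 0) (z k₀) (fun hj => by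
          rw [hz, Fin.sum_univ_succ, h0, Pi.single_eq_same, add_eq_left]
          refine Finset.sum_eq_zero fun i _ => ?_
          have : e' i k₀ = 0 := by
            by_contra hne
            exact (Finset.card_ne_zero_of_mem (Finset.mem_filter.2 ⟨Finset.mem_univ i, hne⟩)) hj
          simp only [e'] at this
          rw [this, zero_smul])
      calc v ^ (N + 1) * (sumWeight b q s c₀ ((Finset.univ.filter fun i => e' i k₀ ≠ 0).card + 1) (z k₀) * M)
          = (v ^ N * M) * (v * sumWeight b q s c₀ ((Finset.univ.filter fun i => e' i k₀ ≠ 0).card + 1) (z k₀)) := by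
            ring
        _ ≤ (v ^ N * M) * ∑' a, cosetWeight b q s (c 0) a *
            sumWeight b q s c₀ (Finset.univ.filter fun i => e' i k₀ ≠ 0).card (z k₀ - σ • a) :=
            mul_le_mul_right h3 _
        _ = _ := by
            rw [← ENNReal.tsum_mul_left]
            exact tsum_congr fun a => by ring

end SumLaw

/-! ### Domination of the output law by independent discrete Gaussians -/

section SumLaw

variable {E : Type*} [NormedAddCommGroup E] [InnerProductSpace ℝ E] [FiniteDimensional ℝ E]
variable {ι : Type*} [Fintype ι] {b : Module.Basis ι ℝ E}

theorem discreteGaussian_apply (L : Submodule ℤ E) [DiscreteTopology L] {s : ℝ} (hs : 0 < s)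
    (x : L) : discreteGaussian L s x =
      ENNReal.ofReal (gaussianRho s (x : E)) *
        (∑' y : L, ENNReal.ofReal (gaussianRho s (y : E)))⁻¹ := by
  rw [discreteGaussian, dif_pos hs, PMF.normalize_apply]

/-- The Poisson constant underestimates the mass of the lattice at every width, so dividing by it
instead of the true mass can only increase the weight. -/
theorem discreteGaussian_le_sumWeight {c₀ : ℝ} (hc₀ : IsPoissonConst b c₀) {q : ℕ} [NeZero q]
    {s : ℝ} (hs : 0 < s) {m : ℕ} (hm : m ≠ 0) (y : Submodule.span ℤ (Set.range b)) :
    discreteGaussian (Submodule.span ℤ (Set.range b)) (s * √m / q) y ≤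
      sumWeight b q s c₀ m ((q : ℤ) • y) := by
  have hq0 : (0 : ℝ) < q := by exact_mod_cast NeZero.pos q
  have hm0 : (0 : ℝ) < m := by exact_mod_cast Nat.pos_of_ne_zero hm
  have hr : 0 < s * √m / q := by positivity
  have hV : 0 < c₀ * (s * √m / q) ^ Module.finrank ℝ E := by have := hc₀.1; positivity
  rw [discreteGaussian_apply _ hr, sumWeight, if_neg hm, ENNReal.ofReal_div_of_pos hV]
  have h1 : gaussianRho (s * √m) (((q : ℤ) • y : Submodule.span ℤ (Set.range b)) : E) =
      gaussianRho (s * √m / q) (y : E) := by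
    rw [← gaussianRho_smul hq0.ne']
    congr 1
    rw [Submodule.coe_smul_of_tower, ← Int.cast_smul_eq_zsmul ℝ, Int.cast_natCast]
  rw [h1, div_eq_mul_inv (ENNReal.ofReal _)]
  refine mul_le_mul_right (ENNReal.inv_le_inv.2 ?_) _
  rw [← ENNReal.ofReal_tsum_of_nonneg (fun _ => (gaussianRho_pos _ _).le)
    (summable_gaussianRho _ hr), tsum_lattice_eq b (fun x => gaussianRho (s * √m / q) x)]
  exact ENNReal.ofReal_le_ofReal ((hc₀.2 _ hr).1)

/-- Split the lattice into its q^n cosets modulo `q L`, each of nearly the same mass. -/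
theorem tsum_gaussianRho_le {c₀ : ℝ} (hc₀ : IsPoissonConst b c₀) {q : ℕ} [NeZero q] {s δ : ℝ}
    (hs : 0 < s) (hδ : ∑' k : ι → ℤ, gaussianRho (1 / (s / √2 / q)) (dualVec b k) ≤ 1 + δ) :
    ∑' y : Submodule.span ℤ (Set.range b), ENNReal.ofReal (gaussianRho s (y : E)) ≤
      (q : ℝ≥0∞) ^ Fintype.card ι *
        ENNReal.ofReal (c₀ * (s / q) ^ Module.finrank ℝ E * (1 + δ)) := by
  classical
  have hq0 : (0 : ℝ) < q := by exact_mod_cast NeZero.pos q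
  have h2 : s / √2 ≤ s := div_le_self hs.le (Real.one_le_sqrt.2 (by norm_num))
  have h1 : ∀ y : Submodule.span ℤ (Set.range b), ENNReal.ofReal (gaussianRho s (y : E)) =
      ∑ c : ι → ZMod q, if latticeMod b q y = c then
        ENNReal.ofReal (gaussianRho s ((y : E) - 0)) else 0 := fun y => by
    rw [Finset.sum_ite_eq, if_pos (Finset.mem_univ _), sub_zero]
  simp_rw [h1]
  rw [Summable.tsum_finsetSum fun _ _ => ENNReal.summable]
  refine (Finset.sum_le_sum fun c _ => tsum_latticeMod_le hc₀ hs ((dualMass_antitone b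
    (by positivity) (div_le_div_of_nonneg_right h2 hq0.le)).trans hδ) c 0).trans (le_of_eq ?_)
  rw [Finset.sum_const, Finset.card_univ, Fintype.card_fun, ZMod.card, nsmul_eq_mul]
  push_cast; rfl

/-- If an algorithm outputs, for a large set of cosets of the samples, signed sums of `m`
samples over disjoint sets, divided by `q`, then the law of its output dominates a multiple of the
law of independent discrete Gaussians. -/
theorem le_map_iidSamples {c₀ : ℝ} (hc₀ : IsPoissonConst b c₀) {q : ℕ} [NeZero q] {s δ : ℝ}
    (hs : 0 < s) (hδ0 : 0 ≤ δ) (hδ1 : δ ≤ 1)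
    (hδ : ∑' k : ι → ℤ, gaussianRho (1 / (s / √2 / q)) (dualVec b k) ≤ 1 + δ)
    {N K m : ℕ} (hm : m ≠ 0) (good : Finset (Fin N → ι → ZMod q))
    (e : (Fin N → ι → ZMod q) → Fin N → Fin K → ℤ)
    (he : ∀ c ∈ good, ∀ i, e c i = 0 ∨ ∃ k, ∃ σ : ℤ, σ * σ = 1 ∧ e c i = Pi.single k σ)
    (hcard : ∀ c ∈ good, ∀ k, (Finset.univ.filter fun i => e c i k ≠ 0).card = m)
    (hsum : ∀ c ∈ good, ∀ k, ∑ i, e c i k • c i = 0)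
    (alg : List (Submodule.span ℤ (Set.range b)) → List (Submodule.span ℤ (Set.range b)))
    (halg : ∀ c ∈ good, ∀ x : Fin N → Submodule.span ℤ (Set.range b),
      (∀ i, latticeMod b q (x i) = c i) → ∀ y : Fin K → Submodule.span ℤ (Set.range b),
      (∀ k, ∑ i, e c i k • x i = (q : ℤ) • y k) → alg (List.ofFn x) = List.ofFn y)
    (z : List (Submodule.span ℤ (Set.range b))) :
    ENNReal.ofReal (good.card / ((q : ℝ) ^ Fintype.card ι) ^ N * ((1 - δ) / (1 + δ)) ^ N) *
      iidSamples (discreteGaussian (Submodule.span ℤ (Set.range b)) (s * √m / q)) K z ≤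
    ((iidSamples (discreteGaussian (Submodule.span ℤ (Set.range b)) s) N).map alg) z := by
  classical
  by_cases hz : iidSamples (discreteGaussian (Submodule.span ℤ (Set.range b)) (s * √m / q)) K z = 0
  · rw [hz, mul_zero]; exact zero_le
  have hlen := length_of_mem_support_iidSamples _ ((PMF.mem_support_iff _ _).2 hz)
  subst hlen
  set y : Fin z.length → Submodule.span ℤ (Set.range b) := z.get
  have hzy : z = List.ofFn y := (List.ofFn_get z).symm
  set p := discreteGaussian (Submodule.span ℤ (Set.range b)) s
  set Z : ℝ≥0∞ := ∑' y : Submodule.span ℤ (Set.range b), ENNReal.ofReal (gaussianRho s (y : E))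
    with hZ
  set V := c₀ * (s / q) ^ Module.finrank ℝ E with hVdef
  have hq0 : (0 : ℝ) < q := by exact_mod_cast NeZero.pos q
  have hV : 0 < V := by have := hc₀.1; positivity
  set v := ENNReal.ofReal (V * (1 - δ))
  have hp : ∀ x, p x = ENNReal.ofReal (gaussianRho s (x : E)) * Z⁻¹ := discreteGaussian_apply _ hs
  -- Each sample lies in a given coset with probability at least q^(-n) times (1-δ)/(1+δ); taken
  -- over N samples this produces the factors in the claim.
  have hratio : ENNReal.ofReal ((1 - δ) / (1 + δ) / (q : ℝ) ^ Fintype.card ι) ≤ v * Z⁻¹ := by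
    have h1 := ENNReal.inv_le_inv.2 (tsum_gaussianRho_le hc₀ hs hδ)
    refine le_trans (le_of_eq ?_) (mul_le_mul_right h1 v)
    have h2 : (q : ℝ≥0∞) ^ Fintype.card ι = ENNReal.ofReal ((q : ℝ) ^ Fintype.card ι) := by
      rw [ENNReal.ofReal_pow hq0.le, ENNReal.ofReal_natCast]
    rw [h2, ← ENNReal.ofReal_mul (by positivity), ← ENNReal.ofReal_inv_of_pos (by positivity),
      ← ENNReal.ofReal_mul (mul_nonneg hV.le (by linarith))]
    congr 1
    rw [← hVdef]
    field_simp
  have hbound : ∀ c ∈ good, v ^ N * ∏ k, discreteGaussian (Submodule.span ℤ (Set.range b))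
      (s * √m / q) (y k) ≤ ∑' x : Fin N → Submodule.span ℤ (Set.range b),
        if ∀ k, ∑ i, e c i k • x i = (q : ℤ) • y k then ∏ i, cosetWeight b q s (c i) (x i) else 0 := by
    intro c hc
    refine le_trans ?_ (prod_sumWeight_le hc₀ hs hδ0 hδ N c (e c) (he c hc)
      (fun k => (q : ℤ) • y k) fun k => by rw [latticeMod_nsmul, hsum c hc k])
    refine mul_le_mul_right (Finset.prod_le_prod' fun k _ => ?_) _
    rw [hcard c hc]
    exact discreteGaussian_le_sumWeight hc₀ hs hm _
  have hpt : ∀ x : Fin N → Submodule.span ℤ (Set.range b),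
      (∑ c ∈ good, if ∀ k, ∑ i, e c i k • x i = (q : ℤ) • y k then
        ∏ i, cosetWeight b q s (c i) (x i) else 0) * (Z⁻¹) ^ N ≤
      if alg (List.ofFn x) = z then ∏ i, p (x i) else 0 := by
    intro x
    set c : Fin N → ι → ZMod q := fun i => latticeMod b q (x i)
    -- A fixed list of samples has only one coset vector, so the contributions of different coset
    -- vectors do not overlap.
    have h0 : ∀ c' ∈ good, c' ≠ c → (if ∀ k, ∑ i, e c' i k • x i = (q : ℤ) • y k then
        ∏ i, cosetWeight b q s (c' i) (x i) else 0) = 0 := by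
      intro c' _ hne
      obtain ⟨i, hi⟩ := Function.ne_iff.1 hne
      rw [ite_eq_right_iff]
      intro _
      exact Finset.prod_eq_zero (Finset.mem_univ i) (if_neg (Ne.symm hi))
    by_cases hc : c ∈ good
    · rw [Finset.sum_eq_single_of_mem c hc h0]
      split_ifs with h1 h2 h2
      · rw [← Fin.prod_const, ← Finset.prod_mul_distrib]
        refine le_of_eq (Finset.prod_congr rfl fun i _ => ?_)
        rw [hp, cosetWeight, if_pos rfl]
      · exact absurd ((halg c hc x (fun _ => rfl) y h1).trans hzy.symm) h2
      · simp
      · simp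
    · rw [Finset.sum_eq_zero fun c' hc' => h0 c' hc' fun h => hc (h ▸ hc'), zero_mul]
      exact zero_le
  refine le_trans ?_ (tsum_ofFn_le_map_iidSamples p N alg z)
  refine le_trans ?_ (ENNReal.tsum_le_tsum hpt)
  rw [ENNReal.tsum_mul_right, Summable.tsum_finsetSum fun _ _ => ENNReal.summable]
  refine le_trans ?_ (mul_le_mul_left (Finset.sum_le_sum hbound) _)
  rw [Finset.sum_const, nsmul_eq_mul]
  have hQ : iidSamples (discreteGaussian (Submodule.span ℤ (Set.range b)) (s * √m / q)) z.length z
      = ∏ k, discreteGaussian (Submodule.span ℤ (Set.range b)) (s * √m / q) (y k) := by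
    rw [← iidSamples_ofFn, ← hzy]
  rw [hQ]
  calc _ = (good.card : ℝ≥0∞) * ENNReal.ofReal ((1 - δ) / (1 + δ) / (q : ℝ) ^ Fintype.card ι) ^ N *
        ∏ k, discreteGaussian (Submodule.span ℤ (Set.range b)) (s * √m / q) (y k) := by
        congr 1
        rw [← ENNReal.ofReal_pow (div_nonneg (div_nonneg (by linarith) (by linarith)) (by positivity)),
          ← ENNReal.ofReal_natCast, ← ENNReal.ofReal_mul (Nat.cast_nonneg _)]
        congr 1
        rw [div_pow ((1 - δ) / (1 + δ)) _ N, mul_div_assoc', div_mul_eq_mul_div]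
    _ ≤ (good.card : ℝ≥0∞) * (v * Z⁻¹) ^ N *
        ∏ k, discreteGaussian (Submodule.span ℤ (Set.range b)) (s * √m / q) (y k) := by
        gcongr
    _ = _ := by rw [mul_pow]; ring

/-- Bernoulli's inequality applied to (1-δ)/(1+δ) ≥ 1 - 2δ. -/
theorem one_sub_two_mul_le_pow {δ : ℝ} (hδ0 : 0 ≤ δ) (hδ1 : δ ≤ 1) (N : ℕ) :
    1 - 2 * N * δ ≤ ((1 - δ) / (1 + δ)) ^ N := by
  have h1 : 1 + (-2 * δ) ≤ (1 - δ) / (1 + δ) := by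
    rw [le_div_iff₀ (by linarith)]; nlinarith
  by_cases h : 1 - 2 * N * δ ≤ 0
  · exact h.trans (pow_nonneg (div_nonneg (by linarith) (by linarith)) _)
  push Not at h
  rcases Nat.eq_zero_or_pos N with rfl | hN
  · simp
  have hN1 : (1 : ℝ) ≤ N := by exact_mod_cast hN
  have h2 : 2 * δ ≤ 1 := by nlinarith
  have h3 := one_add_mul_le_pow (a := -2 * δ) (by linarith) N
  calc 1 - 2 * N * δ = 1 + N * (-2 * δ) := by ring
    _ ≤ (1 + (-2 * δ)) ^ N := h3
    _ ≤ _ := pow_le_pow_left₀ (by linarith) h1 N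

end SumLaw

/-! ### Second moment method for the number of solving tuples -/

section Counting

variable {Ω G : Type*} [AddCommGroup Ω] [Fintype Ω] [AddCommGroup G] [Fintype G] [DecidableEq G]

/-- A surjective homomorphism is equidistributed, so it vanishes with probability 1/|G|. Applied to
a pair of homomorphisms it gives pairwise independence. -/
theorem card_filter_eq_zero_mul_card {f : Ω →+ G} (hf : Function.Surjective f) :
    (Finset.univ.filter fun ω => f ω = 0).card * Fintype.card G = Fintype.card Ω := by
  have h1 := f.ker.card_mul_index
  rw [AddSubgroup.index_ker, AddMonoidHom.range_eq_top.2 hf] at h1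
  simp only [Nat.card_eq_fintype_card, AddSubgroup.card_top] at h1
  rw [← h1]
  congr 1
  rw [← Fintype.card_subtype]
  exact Fintype.card_congr (Equiv.refl _)

/-- Chebyshev's inequality for the number of members of a pairwise independent family of
homomorphisms that vanish at a random point. -/
theorem card_filter_abs_sub_ge_mul_le {T : Type*} [DecidableEq T] (S : Finset T) (f : T → Ω →+ G)
    (h1 : ∀ τ ∈ S, Function.Surjective (f τ))
    (h2 : ∀ τ ∈ S, ∀ τ' ∈ S, τ ≠ τ' → Function.Surjective ((f τ).prod (f τ')))
    {μ : ℝ} (hμ : μ = S.card / Fintype.card G) {t : ℝ} (ht : 0 ≤ t) :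
    ((Finset.univ.filter fun ω => t ≤ |((S.filter fun τ => f τ ω = 0).card : ℝ) - μ|).card : ℝ) *
      t ^ 2 ≤ Fintype.card Ω * μ := by
  classical
  have hG : (0 : ℝ) < Fintype.card G := by exact_mod_cast Fintype.card_pos
  have hμ0 : 0 ≤ μ := by rw [hμ]; positivity
  set X : Ω → ℝ := fun ω => ((S.filter fun τ => f τ ω = 0).card : ℝ) with hX
  have hXsum : ∀ ω, X ω = ∑ τ ∈ S, if f τ ω = 0 then (1 : ℝ) else 0 := fun ω => by
    simp [hX]
  have hone : ∀ τ ∈ S, ∑ ω, (if f τ ω = 0 then (1 : ℝ) else 0) =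
      Fintype.card Ω / Fintype.card G := fun τ hτ => by
    rw [eq_div_iff hG.ne', Finset.sum_boole]
    exact_mod_cast card_filter_eq_zero_mul_card (h1 τ hτ)
  have htwo : ∀ τ ∈ S, ∀ τ' ∈ S, τ ≠ τ' →
      ∑ ω, ((if f τ ω = 0 then (1 : ℝ) else 0) * if f τ' ω = 0 then (1 : ℝ) else 0) =
      Fintype.card Ω / Fintype.card G ^ 2 := fun τ hτ τ' hτ' hne => by
    have h3 := card_filter_eq_zero_mul_card (h2 τ hτ τ' hτ' hne)
    rw [eq_div_iff (by positivity)]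
    have h4 : ∀ ω, ((if f τ ω = 0 then (1 : ℝ) else 0) * if f τ' ω = 0 then (1 : ℝ) else 0) =
        if ((f τ).prod (f τ')) ω = 0 then 1 else 0 := fun ω => by
      simp only [AddMonoidHom.prod_apply, Prod.mk_eq_zero]
      split_ifs <;> simp_all
    simp_rw [h4]
    rw [Finset.sum_boole, ← h3, Fintype.card_prod]
    push_cast; ring
  have hE1 : ∑ ω, X ω = Fintype.card Ω * μ := by
    simp_rw [hXsum]
    rw [Finset.sum_comm, Finset.sum_congr rfl hone, Finset.sum_const, nsmul_eq_mul, hμ]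
    ring
  -- Diagonal pairs give the first term; distinct pairs are independent, and extending their sum to
  -- all pairs gives the second.
  have hE2 : ∑ ω, X ω ^ 2 ≤ Fintype.card Ω * μ + Fintype.card Ω * μ ^ 2 := by
    calc ∑ ω, X ω ^ 2 = ∑ τ ∈ S, ∑ τ' ∈ S, ∑ ω, ((if f τ ω = 0 then (1 : ℝ) else 0) *
          if f τ' ω = 0 then (1 : ℝ) else 0) := by
          simp_rw [hXsum, pow_two, Finset.sum_mul_sum]
          rw [Finset.sum_comm]
          exact Finset.sum_congr rfl fun τ _ => Finset.sum_comm
      _ ≤ ∑ τ ∈ S, ∑ τ' ∈ S, ((if τ = τ' then (Fintype.card Ω / Fintype.card G : ℝ) else 0) +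
          Fintype.card Ω / Fintype.card G ^ 2) := by
          refine Finset.sum_le_sum fun τ hτ => Finset.sum_le_sum fun τ' hτ' => ?_
          by_cases h : τ = τ'
          · subst h
            rw [if_pos rfl, ← hone τ hτ]
            refine le_add_of_le_of_nonneg (Finset.sum_le_sum fun ω _ => ?_) (by positivity)
            split_ifs <;> simp
          · rw [if_neg h, zero_add, htwo τ hτ τ' hτ' h]
      _ = Fintype.card Ω * μ + Fintype.card Ω * μ ^ 2 := by
          simp only [Finset.sum_add_distrib, Finset.sum_ite_eq, Finset.sum_const, nsmul_eq_mul]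
          rw [Finset.sum_congr rfl fun τ hτ => if_pos hτ, Finset.sum_const, nsmul_eq_mul, hμ]
          field_simp
  have hvar : ∑ ω, (X ω - μ) ^ 2 ≤ Fintype.card Ω * μ := by
    have : ∑ ω, (X ω - μ) ^ 2 = ∑ ω, X ω ^ 2 - 2 * μ * ∑ ω, X ω + Fintype.card Ω * μ ^ 2 := by
      rw [Finset.mul_sum, ← Finset.sum_sub_distrib, ← Finset.card_univ, ← nsmul_eq_mul,
        ← Finset.sum_const, ← Finset.sum_add_distrib]
      exact Finset.sum_congr rfl fun ω _ => by ring
    rw [this, hE1]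
    nlinarith
  refine le_trans ?_ hvar
  rw [← nsmul_eq_mul, ← Finset.sum_const]
  refine (Finset.sum_le_sum fun ω hω => ?_).trans
    (Finset.sum_le_univ_sum_of_nonneg fun ω => sq_nonneg (X ω - μ))
  rw [← sq_abs (X ω - μ)]
  exact pow_le_pow_left₀ ht (Finset.mem_filter.1 hω).2 2

variable {J : Type*} [Fintype J] [DecidableEq J] {m B : ℕ}

/-- The signed sum of the entries of `c` selected by a tuple, as a homomorphism. -/
def tupleSum (idx : Fin m → Fin B → J) (tgt : J) (τ : Fin m → Fin B) : (J → G) →+ G where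
  toFun c := ∑ i, c (idx i (τ i)) - c tgt
  map_zero' := by simp
  map_add' c c' := by simp only [Pi.add_apply, Finset.sum_add_distrib]; abel

theorem tupleSum_apply (idx : Fin m → Fin B → J) (tgt : J) (τ : Fin m → Fin B) (c : J → G) :
    tupleSum idx tgt τ c = ∑ i, c (idx i (τ i)) - c tgt := rfl

variable {idx : Fin m → Fin B → J} {tgt : J}

theorem tupleSum_single (hidx : ∀ i i' a a', idx i a = idx i' a' → i = i' ∧ a = a')
    (htgt : ∀ i a, idx i a ≠ tgt) (τ : Fin m → Fin B) (i : Fin m) (a : Fin B) (g : G) :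
    tupleSum idx tgt τ (Pi.single (idx i a) g) = if τ i = a then g else 0 := by
  rw [tupleSum_apply, Pi.single_eq_of_ne (htgt i a).symm, sub_zero, Finset.sum_eq_single i]
  · by_cases h : τ i = a
    · rw [if_pos h, h, Pi.single_eq_same]
    · rw [if_neg h, Pi.single_eq_of_ne]
      exact fun h' => h (hidx _ _ _ _ h').2
  · intro j _ hj
    exact Pi.single_eq_of_ne (fun h' => hj (hidx _ _ _ _ h').1) _
  · simp

theorem tupleSum_surjective (hm : 0 < m) (hidx : ∀ i i' a a', idx i a = idx i' a' → i = i' ∧ a = a')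
    (htgt : ∀ i a, idx i a ≠ tgt) (τ : Fin m → Fin B) :
    Function.Surjective (tupleSum idx tgt τ : (J → G) →+ G) := fun g =>
  ⟨Pi.single (idx ⟨0, hm⟩ (τ ⟨0, hm⟩)) g, by rw [tupleSum_single hidx htgt, if_pos rfl]⟩

/-- In a block where the tuples differ they select different entries, and each of these two entries
moves only one of the two sums. -/
theorem tupleSum_prod_surjective (hidx : ∀ i i' a a', idx i a = idx i' a' → i = i' ∧ a = a')
    (htgt : ∀ i a, idx i a ≠ tgt) {τ τ' : Fin m → Fin B} (h : τ ≠ τ') :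
    Function.Surjective ((tupleSum idx tgt τ : (J → G) →+ G).prod (tupleSum idx tgt τ')) := by
  rintro ⟨g, g'⟩
  obtain ⟨i, hi⟩ := Function.ne_iff.1 h
  refine ⟨Pi.single (idx i (τ i)) g + Pi.single (idx i (τ' i)) g', ?_⟩
  rw [AddMonoidHom.prod_apply, map_add, map_add]
  simp only [tupleSum_single hidx htgt, if_neg hi, if_neg (Ne.symm hi), if_true, add_zero, zero_add]

/-- Whatever few entries are removed, some tuple avoiding them has the prescribed sum. -/
def RobustlySolvable (idx : Fin m → Fin B → J) (tgt : J) (r : ℕ) (c : J → G) : Prop :=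
  ∀ used : Fin m → Finset (Fin B), (∀ i, (used i).card ≤ r) →
    ∃ τ : Fin m → Fin B, tupleSum idx tgt τ c = 0 ∧ ∀ i, τ i ∉ used i

theorem card_filter_apply_eq (i : Fin m) (a : Fin B) :
    (Finset.univ.filter fun τ : Fin m → Fin B => τ i = a).card * B = B ^ m := by
  have h := Finset.card_eq_sum_card_fiberwise (f := fun τ : Fin m → Fin B => τ i)
    (s := Finset.univ) (t := Finset.univ) (by intro x _; simp)
  have h2 : ∀ a' : Fin B, (Finset.univ.filter fun τ : Fin m → Fin B => τ i = a').card =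
      (Finset.univ.filter fun τ : Fin m → Fin B => τ i = a).card := by
    intro a'
    refine Finset.card_bij' (fun τ _ => Function.update τ i a)
      (fun τ _ => Function.update τ i a') ?_ ?_ ?_ ?_
    · simp
    · simp
    · intro τ hτ
      simp only [Finset.mem_filter, Finset.mem_univ, true_and] at hτ
      simp [← hτ]
    · intro τ hτ
      simp only [Finset.mem_filter, Finset.mem_univ, true_and] at hτ
      simp [← hτ]
  rw [Finset.sum_congr rfl fun a' _ => h2 a'] at h
  simp only [Finset.card_univ, Fintype.card_fun, Fintype.card_fin, Finset.sum_const,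
    smul_eq_mul] at h
  rw [h, mul_comm]

/-- If the total number of solutions and the number through each sample are all within 1/5 of their
means, then r samples removed from each block cannot meet every solution. The bound is Chebyshev's
inequality for these 1 + mB counts, with variance at most the mean in each case. -/
theorem card_not_robustlySolvable_le [DecidableEq (J → G)] (hm : 0 < m) (hB : 0 < B)
    (hidx : ∀ i i' a a', idx i a = idx i' a' → i = i' ∧ a = a') (htgt : ∀ i a, idx i a ≠ tgt)
    {r : ℕ} (hr : 3 * (m * r) < 2 * B)
    [DecidablePred fun c : J → G => ¬ RobustlySolvable idx tgt r c] :
    ((Finset.univ.filter fun c : J → G => ¬ RobustlySolvable idx tgt r c).card : ℝ) ≤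
      Fintype.card (J → G) * (25 * Fintype.card G / B ^ m * (1 + m * B ^ 2)) := by
  classical
  set μ : ℝ := (B : ℝ) ^ m / Fintype.card G with hμ
  have hG : (0 : ℝ) < Fintype.card G := by exact_mod_cast Fintype.card_pos
  have hB0 : (0 : ℝ) < B := by exact_mod_cast hB
  have hμ0 : 0 < μ := by positivity
  let X : (J → G) → ℕ := fun c => (Finset.univ.filter fun τ => tupleSum idx tgt τ c = 0).card
  let Y : Fin m → Fin B → (J → G) → ℕ := fun i a c =>
    ((Finset.univ.filter fun τ : Fin m → Fin B => τ i = a).filter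
      fun τ => tupleSum idx tgt τ c = 0).card
  -- A failure forces one of the counts to deviate from its mean by a fifth.
  have hsub : (Finset.univ.filter fun c : J → G => ¬ RobustlySolvable idx tgt r c) ⊆
      (Finset.univ.filter fun c => μ / 5 ≤ |(X c : ℝ) - μ|) ∪
      (Finset.univ : Finset (Fin m × Fin B)).biUnion fun ia =>
        Finset.univ.filter fun c => μ / B / 5 ≤ |(Y ia.1 ia.2 c : ℝ) - μ / B| := by
    intro c hc
    simp only [Finset.mem_filter, Finset.mem_univ, true_and] at hc
    by_contra hcon
    simp only [Finset.mem_union, Finset.mem_filter, Finset.mem_univ, true_and, Finset.mem_biUnion,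
      not_or, not_exists, not_le, Prod.forall] at hcon
    obtain ⟨hX, hY⟩ := hcon
    refine hc fun used hused => ?_
    by_contra hno
    push Not at hno
    have h1 : (Finset.univ.filter fun τ => tupleSum idx tgt τ c = 0) ⊆
        Finset.univ.biUnion fun i => (used i).biUnion fun a =>
          (Finset.univ.filter fun τ : Fin m → Fin B => τ i = a).filter
            fun τ => tupleSum idx tgt τ c = 0 := by
      intro τ hτ
      obtain ⟨i, hi⟩ := hno τ (Finset.mem_filter.1 hτ).2
      simp only [Finset.mem_biUnion, Finset.mem_filter, Finset.mem_univ, true_and]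
      exact ⟨i, τ i, hi, rfl, (Finset.mem_filter.1 hτ).2⟩
    have h2 : X c ≤ ∑ i, ∑ a ∈ used i, Y i a c :=
      (Finset.card_le_card h1).trans (Finset.card_biUnion_le.trans
        (Finset.sum_le_sum fun i _ => Finset.card_biUnion_le))
    have h3 : (X c : ℝ) ≤ m * (r * (6 / 5 * (μ / B))) := by
      calc (X c : ℝ) ≤ ∑ i, ∑ a ∈ used i, (Y i a c : ℝ) := by exact_mod_cast h2
        _ ≤ ∑ i : Fin m, (r * (6 / 5 * (μ / B))) := by
          refine Finset.sum_le_sum fun i _ => ?_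
          calc ∑ a ∈ used i, (Y i a c : ℝ) ≤ ∑ a ∈ used i, 6 / 5 * (μ / B) :=
                Finset.sum_le_sum fun a _ => by have := (abs_lt.1 (hY i a)).2; linarith
            _ = (used i).card * (6 / 5 * (μ / B)) := by rw [Finset.sum_const, nsmul_eq_mul]
            _ ≤ _ := by gcongr; exact hused i
        _ = _ := by simp
    have h4 := (abs_lt.1 hX).1
    have h5 : (3 * (m * r) : ℝ) < 2 * B := by exact_mod_cast hr
    -- The removed samples meet at most 6/5 · mr/B · μ solutions, and mr/B < 2/3 makes this less
    -- than the guaranteed 4/5 · μ.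
    have h6 : (m * (r * (6 / 5 * (μ / B))) : ℝ) < 4 / 5 * μ := by
      rw [show (m * (r * (6 / 5 * (μ / B))) : ℝ) = (3 * (m * r)) * (2 / 5 * μ) / B by ring,
        div_lt_iff₀ hB0]
      nlinarith
    linarith
  have haux : ∀ {A W ν : ℝ}, 0 < ν → A * (ν / 5) ^ 2 ≤ W * ν → A ≤ W * (25 / ν) := by
    intro A W ν hν h
    rw [mul_div_assoc', le_div_iff₀ hν]
    have : A * ν * ν ≤ W * 25 * ν := by nlinarith
    exact le_of_mul_le_mul_right this hν
  have hX : ((Finset.univ.filter fun c => μ / 5 ≤ |(X c : ℝ) - μ|).card : ℝ) ≤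
      Fintype.card (J → G) * (25 / μ) := by
    have h := card_filter_abs_sub_ge_mul_le (Ω := J → G) (G := G) Finset.univ (tupleSum idx tgt)
      (fun τ _ => tupleSum_surjective hm hidx htgt τ)
      (fun τ _ τ' _ h => tupleSum_prod_surjective hidx htgt h) (μ := μ)
      (by rw [hμ]; simp) (t := μ / 5) (by positivity)
    exact haux hμ0 h
  have hY : ∀ i a, ((Finset.univ.filter fun c => μ / B / 5 ≤ |(Y i a c : ℝ) - μ / B|).card : ℝ) ≤
      Fintype.card (J → G) * (25 / (μ / B)) := by
    intro i a
    have hμB : 0 < μ / B := by positivity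
    have hcard := card_filter_apply_eq (B := B) i a
    have h := card_filter_abs_sub_ge_mul_le (Ω := J → G) (G := G)
      (Finset.univ.filter fun τ : Fin m → Fin B => τ i = a) (tupleSum idx tgt)
      (fun τ _ => tupleSum_surjective hm hidx htgt τ)
      (fun τ _ τ' _ h => tupleSum_prod_surjective hidx htgt h) (μ := μ / B)
      (by
        have : ((Finset.univ.filter fun τ : Fin m → Fin B => τ i = a).card : ℝ) * B = (B : ℝ) ^ m := by
          exact_mod_cast hcard
        rw [hμ, ← this]; field_simp) (t := μ / B / 5) (by positivity)
    exact haux hμB h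
  calc ((Finset.univ.filter fun c : J → G => ¬ RobustlySolvable idx tgt r c).card : ℝ)
      ≤ (Finset.univ.filter fun c => μ / 5 ≤ |(X c : ℝ) - μ|).card +
        ∑ ia : Fin m × Fin B,
          ((Finset.univ.filter fun c => μ / B / 5 ≤ |(Y ia.1 ia.2 c : ℝ) - μ / B|).card : ℝ) := by
        exact_mod_cast (Finset.card_le_card hsub).trans ((Finset.card_union_le _ _).trans
          (Nat.add_le_add_left Finset.card_biUnion_le _))
    _ ≤ Fintype.card (J → G) * (25 / μ) +
        ∑ ia : Fin m × Fin B, Fintype.card (J → G) * (25 / (μ / B)) :=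
        add_le_add hX (Finset.sum_le_sum fun ia _ => hY ia.1 ia.2)
    _ = _ := by
        rw [Finset.sum_const, Finset.card_univ, Fintype.card_prod, Fintype.card_fin,
          Fintype.card_fin, nsmul_eq_mul, hμ]
        push_cast
        field_simp

end Counting

/-! ### The greedy selection of disjoint tuples -/

section Greedy

/-- The layout of the samples: each group of `m * B + P` samples consists of `m` blocks of length
`B`, followed by `P` targets. -/
structure Layout where
  m : ℕ
  B : ℕ
  P : ℕ

namespace Layout

variable (Λ : Layout)

/-- The number of samples in a group. -/
def size : ℕ := Λ.m * Λ.B + Λ.P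

/-- The digit of `τ` that selects a sample of block `i`. -/
def digit (τ i : ℕ) : ℕ := τ / Λ.B ^ i % Λ.B

/-- The index of the sample selected by the tuple `τ` in block `i` for the target `k`. -/
def src (k τ i : ℕ) : ℕ := k / Λ.P * Λ.size + (i * Λ.B + Λ.digit τ i)

/-- The index of the target `k`. -/
def tgt (k : ℕ) : ℕ := k / Λ.P * Λ.size + (Λ.m * Λ.B + k % Λ.P)

/-- The target `k` is already served, or the tuple `τ` meets a tuple that is already used. -/
def Conflict (ch : List (ℕ × ℕ)) (k τ : ℕ) : Prop :=
  ∃ p ∈ ch, p.1 = k ∨ (p.1 / Λ.P = k / Λ.P ∧ ∃ i < Λ.m, Λ.digit p.2 i = Λ.digit τ i)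

open Classical in
/-- Accept the pair `(k, τ)` if it is admissible and in conflict with no accepted pair. -/
noncomputable def step (ok : ℕ → ℕ → Prop) (ch : List (ℕ × ℕ)) (k τ : ℕ) : List (ℕ × ℕ) :=
  if ok k τ ∧ ¬ Λ.Conflict ch k τ then ch ++ [(k, τ)] else ch

/-- The accepted pairs after the first `t` tuples have been tried for the target `k`. -/
noncomputable def tryTuples (ok : ℕ → ℕ → Prop) (ch : List (ℕ × ℕ)) (k : ℕ) : ℕ → List (ℕ × ℕ)
  | 0 => ch
  | t + 1 => Λ.step ok (tryTuples ok ch k t) k t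

/-- The accepted pairs after the first `k` targets. -/
noncomputable def greedy (ok : ℕ → ℕ → Prop) : ℕ → List (ℕ × ℕ)
  | 0 => []
  | k + 1 => Λ.tryTuples ok (greedy ok k) k (Λ.B ^ Λ.m)

variable {Λ}

/-- The pairs are admissible, ordered by target, and use disjoint sets of samples. -/
structure Valid (Λ : Layout) (ok : ℕ → ℕ → Prop) (ch : List (ℕ × ℕ)) : Prop where
  ok : ∀ p ∈ ch, ok p.1 p.2
  pairwise : ch.Pairwise fun p p' => p.1 < p'.1 ∧
    (p.1 / Λ.P = p'.1 / Λ.P → ∀ i < Λ.m, Λ.digit p.2 i ≠ Λ.digit p'.2 i)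

theorem Conflict.mono {ch ch' : List (ℕ × ℕ)} (h : ch ⊆ ch') {k τ : ℕ} (hc : Λ.Conflict ch k τ) :
    Λ.Conflict ch' k τ := by
  obtain ⟨p, hp, h'⟩ := hc
  exact ⟨p, h hp, h'⟩

theorem subset_step (ok : ℕ → ℕ → Prop) (ch : List (ℕ × ℕ)) (k τ : ℕ) :
    ch ⊆ Λ.step ok ch k τ := by
  rw [step]; split_ifs <;> simp

theorem conflict_step {ok : ℕ → ℕ → Prop} (ch : List (ℕ × ℕ)) {k τ : ℕ} (h : ok k τ) :
    Λ.Conflict (Λ.step ok ch k τ) k τ := by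
  rw [step]
  split_ifs with h'
  · exact ⟨(k, τ), by simp, Or.inl rfl⟩
  · by_contra hc
    exact h' ⟨h, hc⟩

theorem Valid.step {ok : ℕ → ℕ → Prop} {ch : List (ℕ × ℕ)} (h : Valid Λ ok ch) {k : ℕ}
    (hk : ∀ p ∈ ch, p.1 ≤ k) (τ : ℕ) :
    Valid Λ ok (Λ.step ok ch k τ) ∧ ∀ p ∈ Λ.step ok ch k τ, p.1 ≤ k := by
  rw [Layout.step]
  split_ifs with h'
  · refine ⟨⟨?_, ?_⟩, ?_⟩
    · intro p hp
      rcases List.mem_append.1 hp with hp | hp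
      · exact h.ok p hp
      · rw [List.mem_singleton.1 hp]; exact h'.1
    · rw [List.pairwise_append]
      refine ⟨h.pairwise, List.pairwise_singleton _ _, fun p hp p' hp' => ?_⟩
      rw [List.mem_singleton.1 hp']
      refine ⟨lt_of_le_of_ne (hk p hp) fun hne => h'.2 ⟨p, hp, Or.inl hne⟩, fun hg i hi he => ?_⟩
      exact h'.2 ⟨p, hp, Or.inr ⟨hg, i, hi, he⟩⟩
    · intro p hp
      rcases List.mem_append.1 hp with hp | hp
      · exact hk p hp
      · rw [List.mem_singleton.1 hp]
  · exact ⟨h, hk⟩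

theorem valid_tryTuples {ok : ℕ → ℕ → Prop} {ch : List (ℕ × ℕ)} (h : Valid Λ ok ch) {k : ℕ}
    (hk : ∀ p ∈ ch, p.1 ≤ k) (t : ℕ) :
    Valid Λ ok (Λ.tryTuples ok ch k t) ∧ ∀ p ∈ Λ.tryTuples ok ch k t, p.1 ≤ k := by
  induction t with
  | zero => exact ⟨h, hk⟩
  | succ t ih => exact ih.1.step ih.2 t

theorem valid_greedy (ok : ℕ → ℕ → Prop) (k : ℕ) :
    Valid Λ ok (Λ.greedy ok k) ∧ ∀ p ∈ Λ.greedy ok k, p.1 < k := by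
  induction k with
  | zero => exact ⟨⟨by simp [greedy], by simp [greedy]⟩, by simp [greedy]⟩
  | succ k ih =>
    have := valid_tryTuples ih.1 (k := k) (fun p hp => (ih.2 p hp).le) (Λ.B ^ Λ.m)
    exact ⟨this.1, fun p hp => Nat.lt_succ_of_le (this.2 p hp)⟩

theorem subset_tryTuples (ok : ℕ → ℕ → Prop) (ch : List (ℕ × ℕ)) (k : ℕ) {s t : ℕ} (h : s ≤ t) :
    Λ.tryTuples ok ch k s ⊆ Λ.tryTuples ok ch k t := by
  induction t, h using Nat.le_induction with
  | base => exact fun _ h => h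
  | succ t _ ih => exact List.Subset.trans ih (subset_step _ _ _ _)

theorem greedy_subset (ok : ℕ → ℕ → Prop) {j k : ℕ} (h : j ≤ k) :
    Λ.greedy ok j ⊆ Λ.greedy ok k := by
  induction k, h using Nat.le_induction with
  | base => exact fun _ h => h
  | succ k _ ih => exact List.Subset.trans ih (subset_tryTuples _ _ _ (Nat.zero_le _))

/-- Maximality of the greedy choice: a rejected admissible pair was in conflict when it was tried,
an accepted one is in conflict with itself, and conflicts persist as the list grows. -/
theorem conflict_greedy {ok : ℕ → ℕ → Prop} {K k τ : ℕ} (hk : k < K) (hτ : τ < Λ.B ^ Λ.m)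
    (h : ok k τ) : Λ.Conflict (Λ.greedy ok K) k τ := by
  refine (conflict_step (Λ.tryTuples ok (Λ.greedy ok k) k τ) h).mono ?_
  exact List.Subset.trans (subset_tryTuples ok (Λ.greedy ok k) k (Nat.succ_le_of_lt hτ))
    (greedy_subset ok (Nat.succ_le_of_lt hk))

theorem digit_lt (hB : 0 < Λ.B) (τ i : ℕ) : Λ.digit τ i < Λ.B := Nat.mod_lt _ hB

theorem exists_digit_eq (f : Fin Λ.m → Fin Λ.B) :
    ∃ τ < Λ.B ^ Λ.m, ∀ i : Fin Λ.m, Λ.digit τ i = f i := by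
  refine ⟨finFunctionFinEquiv f, Fin.is_lt _, fun i => ?_⟩
  have := congrFun (finFunctionFinEquiv.symm_apply_apply f) i
  rw [← this]; rfl

/-- If every target is robustly solvable, the greedy algorithm serves every target. -/
theorem map_fst_greedy {ok : ℕ → ℕ → Prop} {K : ℕ} (hP : 0 < Λ.P)
    (h : ∀ k < K, ∀ used : Fin Λ.m → Finset (Fin Λ.B), (∀ i, (used i).card ≤ Λ.P - 1) →
      ∃ f : Fin Λ.m → Fin Λ.B, (∀ i, f i ∉ used i) ∧
        ∀ τ, (∀ i : Fin Λ.m, Λ.digit τ i = f i) → ok k τ) :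
    (Λ.greedy ok K).map Prod.fst = List.range K := by
  classical
  set ch := Λ.greedy ok K
  obtain ⟨hv, hlt⟩ := valid_greedy (Λ := Λ) ok K
  have hsorted : (ch.map Prod.fst).Pairwise (· < ·) :=
    List.pairwise_map.2 (hv.pairwise.imp fun h => h.1)
  have hnodup : (ch.map Prod.fst).Nodup := hsorted.imp fun h => h.ne
  have hmem : ∀ k, k ∈ ch.map Prod.fst ↔ k ∈ List.range K := by
    intro k
    rw [List.mem_range]
    refine ⟨fun hk => ?_, fun hk => ?_⟩
    · obtain ⟨p, hp, rfl⟩ := List.mem_map.1 hk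
      exact hlt p hp
    · by_contra hno
      have hno' : ∀ p ∈ ch, p.1 ≠ k := fun p hp he => hno (List.mem_map.2 ⟨p, hp, he⟩)
      -- All accepted pairs in the group of the supposedly unserved k. Their targets are distinct
      -- modulo P and avoid the residue of k, so there are at most P - 1 of them. A tuple that
      -- avoids their samples contradicts maximality.
      let S : Finset (ℕ × ℕ) := ch.toFinset.filter fun p => p.1 / Λ.P = k / Λ.P
      have hS : S.card ≤ Λ.P - 1 := by
        have hinj : Set.InjOn (fun p : ℕ × ℕ => p.1 % Λ.P) S := by
          intro p hp p' hp' he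
          simp only [S, Finset.coe_filter, List.mem_toFinset, Set.mem_ofPred_eq] at hp hp'
          have h1 : p.1 = p'.1 := by
            rw [← Nat.div_add_mod p.1 Λ.P, ← Nat.div_add_mod p'.1 Λ.P, hp.2, hp'.2]
            exact congrArg _ he
          exact List.inj_on_of_nodup_map hnodup hp.1 hp'.1 h1
        have hmaps : Set.MapsTo (fun p : ℕ × ℕ => p.1 % Λ.P) S
            ((Finset.range Λ.P).erase (k % Λ.P) : Finset ℕ) := by
          intro p hp
          simp only [S, Finset.coe_filter, List.mem_toFinset, Set.mem_ofPred_eq] at hp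
          rw [Finset.mem_coe, Finset.mem_erase, Finset.mem_range]
          refine ⟨fun he => hno' p hp.1 ?_, Nat.mod_lt _ hP⟩
          rw [← Nat.div_add_mod p.1 Λ.P, hp.2]
          exact (congrArg _ he).trans (Nat.div_add_mod k Λ.P)
        refine (Finset.card_le_card_of_injOn _ hmaps hinj).trans (le_of_eq ?_)
        rw [Finset.card_erase_of_mem (Finset.mem_range.2 (Nat.mod_lt _ hP)), Finset.card_range]
      let used : Fin Λ.m → Finset (Fin Λ.B) := fun i =>
        Finset.univ.filter fun a => ∃ p ∈ S, Λ.digit p.2 i = a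
      obtain ⟨f, hf, hok⟩ := h k hk used fun i => by
        refine le_trans ?_ hS
        have : (used i).image (fun a : Fin Λ.B => (a : ℕ)) ⊆ S.image fun p => Λ.digit p.2 i := by
          intro a ha
          obtain ⟨a', ha', rfl⟩ := Finset.mem_image.1 ha
          obtain ⟨p, hp, he⟩ := (Finset.mem_filter.1 ha').2
          exact Finset.mem_image.2 ⟨p, hp, he⟩
        rw [← Finset.card_image_of_injective (used i) Fin.val_injective]
        exact (Finset.card_le_card this).trans Finset.card_image_le
      obtain ⟨τ, hτ, hdig⟩ := exists_digit_eq f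
      obtain ⟨p, hp, he | ⟨hg, i, hi, he⟩⟩ := conflict_greedy hk hτ (hok τ hdig)
      · exact hno' p hp he
      · refine hf ⟨i, hi⟩ (Finset.mem_filter.2 ⟨Finset.mem_univ _, p,
          Finset.mem_filter.2 ⟨List.mem_toFinset.2 hp, hg⟩, ?_⟩)
        rw [← hdig ⟨i, hi⟩]; exact he
  refine List.Perm.eq_of_pairwise' (hsorted.imp le_of_lt)
    (List.pairwise_lt_range.imp le_of_lt) ?_
  exact (List.perm_ext_iff_of_nodup hnodup List.nodup_range).2 hmem

/-- A position determines group, block and digit by division with remainder, first by the group size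
and then by B. -/
theorem src_eq_src {k k' τ τ' i i' : ℕ} (hB : 0 < Λ.B) (hi : i < Λ.m) (hi' : i' < Λ.m)
    (h : Λ.src k τ i = Λ.src k' τ' i') :
    k / Λ.P = k' / Λ.P ∧ i = i' ∧ Λ.digit τ i = Λ.digit τ' i' := by
  have hlt : ∀ τ, ∀ i < Λ.m, i * Λ.B + Λ.digit τ i < Λ.m * Λ.B := fun τ i hi => by
    have := digit_lt hB τ i; nlinarith
  have hs : ∀ τ, ∀ i < Λ.m, i * Λ.B + Λ.digit τ i < Λ.size := fun τ i hi =>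
    (hlt τ i hi).trans_le (Nat.le_add_right _ _)
  have hpos : 0 < Λ.size := (Nat.zero_le _).trans_lt (hs τ i hi)
  have h1 : k / Λ.P = k' / Λ.P := by
    have := congrArg (· / Λ.size) h
    simpa [src, Nat.add_div_of_dvd_right, Nat.mul_div_cancel _ hpos, Nat.div_eq_of_lt (hs τ i hi),
      Nat.div_eq_of_lt (hs τ' i' hi')] using this
  have h2 : i * Λ.B + Λ.digit τ i = i' * Λ.B + Λ.digit τ' i' := by
    rw [src, src, h1] at h; exact Nat.add_left_cancel h
  have h3 : i = i' := by
    have := congrArg (· / Λ.B) h2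
    simpa [Nat.add_div_of_dvd_right, Nat.mul_div_cancel _ hB, Nat.div_eq_of_lt (digit_lt hB τ i),
      Nat.div_eq_of_lt (digit_lt hB τ' i')] using this
  exact ⟨h1, h3, by subst h3; exact Nat.add_left_cancel h2⟩

theorem src_ne_tgt {k k' τ i : ℕ} (hB : 0 < Λ.B) (hP : 0 < Λ.P) (hi : i < Λ.m) :
    Λ.src k τ i ≠ Λ.tgt k' := by
  intro h
  have h0 : i * Λ.B + Λ.digit τ i < Λ.m * Λ.B := by have := digit_lt hB τ i; nlinarith
  have h1 : i * Λ.B + Λ.digit τ i < Λ.size := h0.trans_le (Nat.le_add_right _ _)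
  have h2 : Λ.m * Λ.B + k' % Λ.P < Λ.size := Nat.add_lt_add_left (Nat.mod_lt _ hP) _
  have h3 := congrArg (· % Λ.size) h
  simp only [src, tgt, Nat.mul_add_mod_self_right, Nat.mod_eq_of_lt h1, Nat.mod_eq_of_lt h2] at h3
  omega

theorem tgt_injective {k k' : ℕ} (hP : 0 < Λ.P) (h : Λ.tgt k = Λ.tgt k') : k = k' := by
  have h2 : ∀ k, Λ.m * Λ.B + k % Λ.P < Λ.size := fun k => Nat.add_lt_add_left (Nat.mod_lt _ hP) _
  have h3 := congrArg (· % Λ.size) h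
  simp only [tgt, Nat.mul_add_mod_self_right, Nat.mod_eq_of_lt (h2 _)] at h3
  have hpos : 0 < Λ.size := (Nat.zero_le _).trans_lt (h2 k)
  have h4 : k / Λ.P = k' / Λ.P := by
    have := congrArg (· / Λ.size) h
    simpa [tgt, Nat.add_div_of_dvd_right, Nat.mul_div_cancel _ hpos, Nat.div_eq_of_lt (h2 k),
      Nat.div_eq_of_lt (h2 k')] using this
  rw [← Nat.div_add_mod k Λ.P, ← Nat.div_add_mod k' Λ.P, h4, Nat.add_left_cancel h3]

theorem src_lt {N k τ i : ℕ} (hN : (k / Λ.P + 1) * Λ.size ≤ N) (hB : 0 < Λ.B) (hi : i < Λ.m) :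
    Λ.src k τ i < N := by
  have h0 : i * Λ.B + Λ.digit τ i < Λ.m * Λ.B := by have := digit_lt hB τ i; nlinarith
  have h1 : i * Λ.B + Λ.digit τ i < Λ.size := h0.trans_le (Nat.le_add_right _ _)
  rw [src]; linarith

theorem tgt_lt {N k : ℕ} (hN : (k / Λ.P + 1) * Λ.size ≤ N) (hP : 0 < Λ.P) : Λ.tgt k < N := by
  have h2 : Λ.m * Λ.B + k % Λ.P < Λ.size := Nat.add_lt_add_left (Nat.mod_lt _ hP) _
  rw [tgt]; linarith

end Layout

end Greedy

/-! ### The greedy algorithm on lattice vectors and its output law -/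

section GreedyLattice

variable {E : Type*} [NormedAddCommGroup E] [InnerProductSpace ℝ E]
variable {ι : Type*} [Fintype ι] (b : Module.Basis ι ℝ E)

namespace Layout

variable (Λ : Layout)

/-- The signed sum of the samples selected by `τ` and the target `k`. -/
def tupleVec {M : Type*} [AddCommGroup M] (x : ℕ → M) (k τ : ℕ) : M :=
  ∑ i ∈ Finset.range Λ.m, x (Λ.src k τ i) - x (Λ.tgt k)

/-- Coordinatewise division of a lattice vector by `q`. -/
noncomputable def divVec (q : ℕ) (x : Submodule.span ℤ (Set.range b)) :
    Submodule.span ℤ (Set.range b) :=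
  (b.restrictScalars ℤ).equivFun.symm fun i => (b.restrictScalars ℤ).repr x i / q

theorem smul_divVec {q : ℕ} {x : Submodule.span ℤ (Set.range b)} (h : latticeMod b q x = 0) :
    (q : ℤ) • divVec b q x = x := by
  apply (b.restrictScalars ℤ).equivFun.injective
  rw [map_smul, divVec, LinearEquiv.apply_symm_apply]
  ext i
  have h1 := congrFun h i
  rw [latticeMod_apply, Pi.zero_apply, ZMod.intCast_zmod_eq_zero_iff_dvd] at h1
  rw [Pi.smul_apply, smul_eq_mul, Module.Basis.equivFun_apply]
  exact Int.mul_ediv_cancel' h1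

/-- The pairs accepted by the greedy algorithm on a sequence of lattice vectors. -/
noncomputable def accepted (q : ℕ) (x : ℕ → Submodule.span ℤ (Set.range b)) (K : ℕ) :
    List (ℕ × ℕ) :=
  Λ.greedy (fun k τ => latticeMod b q (Λ.tupleVec x k τ) = 0) K

/-- The output of the greedy algorithm on a list of lattice vectors. -/
noncomputable def latticeAlg (q K : ℕ) (xs : List (Submodule.span ℤ (Set.range b))) :
    List (Submodule.span ℤ (Set.range b)) :=
  (Λ.accepted b q (fun i => xs.getD i 0) K).map fun p =>
    divVec b q (Λ.tupleVec (fun i => xs.getD i 0) p.1 p.2)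

variable {Λ}

/-- Different blocks and the target zone are disjoint index ranges, so the chosen indices are
distinct. No randomness enters: admissibility itself makes the division by q exact. -/
theorem exists_of_mem_latticeAlg {q K : ℕ} (hB : 0 < Λ.B) (hP : 0 < Λ.P)
    {xs : List (Submodule.span ℤ (Set.range b))}
    (hN : ∀ k < K, (k / Λ.P + 1) * Λ.size ≤ xs.length)
    {y : Submodule.span ℤ (Set.range b)} (hy : y ∈ Λ.latticeAlg b q K xs) :
    ∃ (I : Finset (Fin xs.length)) (j : Fin xs.length),
      I.card = Λ.m ∧ j ∉ I ∧ (q : ℤ) • y = ∑ i ∈ I, xs.get i - xs.get j := by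
  classical
  obtain ⟨⟨k, τ⟩, hp, rfl⟩ := List.mem_map.1 hy
  obtain ⟨hv, hlt⟩ := valid_greedy (Λ := Λ)
    (fun k τ => latticeMod b q (Λ.tupleVec (fun i => xs.getD i 0) k τ) = 0) K
  have hk : k < K := hlt _ hp
  let s : Fin Λ.m → Fin xs.length := fun i => ⟨Λ.src k τ i, src_lt (hN k hk) hB i.2⟩
  have hs : Function.Injective s := fun i i' h =>
    Fin.ext (src_eq_src hB i.2 i'.2 (Fin.mk.inj_iff.1 h)).2.1
  refine ⟨Finset.univ.image s, ⟨Λ.tgt k, tgt_lt (hN k hk) hP⟩, ?_, ?_, ?_⟩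
  · rw [Finset.card_image_of_injective _ hs, Finset.card_univ, Fintype.card_fin]
  · intro h
    obtain ⟨i, -, hi⟩ := Finset.mem_image.1 h
    exact src_ne_tgt hB hP i.2 (Fin.mk.inj_iff.1 hi)
  · rw [smul_divVec b (hv.ok _ hp), tupleVec, Finset.sum_range, Finset.sum_image hs.injOn]
    congr 1
    · exact Finset.sum_congr rfl fun i _ => by
        rw [List.getD_eq_getElem _ _ (src_lt (hN k hk) hB i.2)]; rfl
    · rw [List.getD_eq_getElem _ _ (tgt_lt (hN k hk) hP)]; rfl

variable (Λ) in
/-- The coefficients of the signed sums computed by the greedy algorithm. -/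
def coeff {N K : ℕ} (τ : Fin K → ℕ) (i : Fin N) (k : Fin K) : ℤ :=
  (∑ j ∈ Finset.range Λ.m, if Λ.src k (τ k) j = i then 1 else 0) - if Λ.tgt k = i then 1 else 0

section

variable {N K : ℕ} {τ : Fin K → ℕ}

theorem sum_coeff_smul {M : Type*} [AddCommGroup M] (hB : 0 < Λ.B) (hP : 0 < Λ.P)
    (hN : ∀ k < K, (k / Λ.P + 1) * Λ.size ≤ N) {x : ℕ → M} {x' : Fin N → M}
    (hx : ∀ i : Fin N, x i = x' i) (k : Fin K) :
    ∑ i, Λ.coeff τ i k • x' i = Λ.tupleVec x k (τ k) := by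
  have h1 : ∀ j < N, ∑ i : Fin N, (if j = i then (1 : ℤ) else 0) • x' i = x j := by
    intro j hj
    rw [Finset.sum_eq_single ⟨j, hj⟩]
    · rw [if_pos rfl, one_smul, ← hx]
    · intro i _ hi
      rw [if_neg fun h => hi (Fin.ext h.symm), zero_smul]
    · simp
  simp only [coeff, sub_smul, Finset.sum_sub_distrib, Finset.sum_smul]
  rw [Finset.sum_comm, h1 _ (tgt_lt (hN k k.2) hP), tupleVec]
  congr 1
  exact Finset.sum_congr rfl fun j hj => h1 _ (src_lt (hN k k.2) hB (Finset.mem_range.1 hj))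

theorem coeff_of_src_eq (hB : 0 < Λ.B) (hP : 0 < Λ.P) {i : Fin N} {k : Fin K} {j : ℕ}
    (hj : j < Λ.m) (h : Λ.src k (τ k) j = i) : Λ.coeff τ i k = 1 := by
  rw [coeff, Finset.sum_eq_single_of_mem j (Finset.mem_range.2 hj), if_pos h, if_neg, sub_zero]
  · exact fun h' => src_ne_tgt hB hP hj (h.trans h'.symm)
  · intro j' hj' hne
    exact if_neg fun h' => hne (src_eq_src hB (Finset.mem_range.1 hj') hj (h'.trans h.symm)).2.1

theorem coeff_of_tgt_eq (hB : 0 < Λ.B) (hP : 0 < Λ.P) {i : Fin N} {k : Fin K}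
    (h : Λ.tgt k = i) : Λ.coeff τ i k = -1 := by
  rw [coeff, Finset.sum_eq_zero, if_pos h, zero_sub]
  intro j hj
  exact if_neg fun h' => src_ne_tgt hB hP (Finset.mem_range.1 hj) (h'.trans h.symm)

theorem coeff_of_ne {i : Fin N} {k : Fin K}
    (h : ∀ j < Λ.m, Λ.src k (τ k) j ≠ i) (h' : Λ.tgt k ≠ i) : Λ.coeff τ i k = 0 := by
  rw [coeff, Finset.sum_eq_zero, if_neg h', sub_zero]
  exact fun j hj => if_neg (h j (Finset.mem_range.1 hj))

theorem card_coeff_ne_zero (hB : 0 < Λ.B) (hP : 0 < Λ.P)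
    (hN : ∀ k < K, (k / Λ.P + 1) * Λ.size ≤ N) (k : Fin K) :
    (Finset.univ.filter fun i : Fin N => Λ.coeff τ i k ≠ 0).card = Λ.m + 1 := by
  classical
  let s : Fin Λ.m → Fin N := fun i => ⟨Λ.src k (τ k) i, src_lt (hN k k.2) hB i.2⟩
  have hs : Function.Injective s := fun i i' h =>
    Fin.ext (src_eq_src hB i.2 i'.2 (Fin.mk.inj_iff.1 h)).2.1
  have h1 : (Finset.univ.filter fun i : Fin N => Λ.coeff τ i k ≠ 0) =
      insert ⟨Λ.tgt k, tgt_lt (hN k k.2) hP⟩ (Finset.univ.image s) := by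
    ext i
    simp only [Finset.mem_filter, Finset.mem_univ, true_and, Finset.mem_insert, Finset.mem_image]
    constructor
    · intro hi
      by_contra hcon
      push Not at hcon
      refine hi (coeff_of_ne (fun j hj h => hcon.2 ⟨j, hj⟩ (Fin.ext h)) fun h => ?_)
      exact hcon.1 (Fin.ext h.symm)
    · rintro (rfl | ⟨j, rfl⟩)
      · rw [coeff_of_tgt_eq hB hP rfl]; decide
      · rw [coeff_of_src_eq hB hP j.2 rfl]; decide
  rw [h1, Finset.card_insert_of_notMem, Finset.card_image_of_injective _ hs, Finset.card_univ,
    Fintype.card_fin]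
  intro h
  obtain ⟨i, -, hi⟩ := Finset.mem_image.1 h
  exact src_ne_tgt hB hP i.2 (Fin.mk.inj_iff.1 hi)

/-- Serving as a target determines the sum, a block sample is used at most once in its group, and
targets and block samples occupy disjoint positions. -/
theorem coeff_eq_single (hB : 0 < Λ.B) (hP : 0 < Λ.P)
    (hdisj : ∀ k k' : Fin K, (k : ℕ) / Λ.P = k' / Λ.P → ∀ i < Λ.m,
      Λ.digit (τ k) i = Λ.digit (τ k') i → k = k') (i : Fin N) :
    Λ.coeff τ i = 0 ∨ ∃ k, ∃ σ : ℤ, σ * σ = 1 ∧ Λ.coeff τ i = Pi.single k σ := by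
  classical
  by_cases h1 : ∃ k : Fin K, Λ.tgt k = i
  · obtain ⟨k, hk⟩ := h1
    refine Or.inr ⟨k, -1, by norm_num, funext fun k' => ?_⟩
    by_cases hkk : k' = k
    · rw [hkk, Pi.single_eq_same, coeff_of_tgt_eq hB hP hk]
    · rw [Pi.single_eq_of_ne hkk]
      refine coeff_of_ne (fun j hj h => src_ne_tgt hB hP hj (h.trans hk.symm)) fun h => ?_
      exact hkk (Fin.ext (tgt_injective hP (h.trans hk.symm)))
  by_cases h2 : ∃ k : Fin K, ∃ j < Λ.m, Λ.src k (τ k) j = i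
  · obtain ⟨k, j, hj, hk⟩ := h2
    refine Or.inr ⟨k, 1, by norm_num, funext fun k' => ?_⟩
    by_cases hkk : k' = k
    · rw [hkk, Pi.single_eq_same, coeff_of_src_eq hB hP hj hk]
    · rw [Pi.single_eq_of_ne hkk]
      refine coeff_of_ne (fun j' hj' h => ?_) fun h => h1 ⟨k', h⟩
      obtain ⟨hg, rfl, hd⟩ := src_eq_src hB hj' hj (h.trans hk.symm)
      exact hkk (hdisj k' k hg _ hj hd)
  · left
    push Not at h1 h2
    exact funext fun k => coeff_of_ne (h2 k) (h1 k)

end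

variable [FiniteDimensional ℝ E] {b}

theorem tupleVec_map {M M' : Type*} [AddCommGroup M] [AddCommGroup M'] (f : M →+ M') (x : ℕ → M)
    (k τ : ℕ) : f (Λ.tupleVec x k τ) = Λ.tupleVec (fun i => f (x i)) k τ := by
  simp [tupleVec]

/-- Extension of a finite sequence by zero. -/
def extendZero {M : Type*} [Zero M] {N : ℕ} (c : Fin N → M) (i : ℕ) : M :=
  if h : i < N then c ⟨i, h⟩ else 0

theorem extendZero_apply {M : Type*} [Zero M] {N : ℕ} (c : Fin N → M) (i : Fin N) :
    extendZero c i = c i := dif_pos i.2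

/-- The output law of the greedy algorithm. -/
theorem statDist_latticeAlg_le {c₀ : ℝ} (hc₀ : IsPoissonConst b c₀) {q : ℕ} [NeZero q] {s δ : ℝ}
    (hs : 0 < s) (hδ0 : 0 ≤ δ) (hδ1 : δ ≤ 1)
    (hδ : ∑' k : ι → ℤ, gaussianRho (1 / (s / √2 / q)) (dualVec b k) ≤ 1 + δ)
    {N K : ℕ} (hm : 0 < Λ.m) (hB : 0 < Λ.B) (hP : 0 < Λ.P)
    (hPB : 3 * (Λ.m * (Λ.P - 1)) < 2 * Λ.B)
    (hN : ∀ k < K, (k / Λ.P + 1) * Λ.size ≤ N) :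
    statDist
      ((iidSamples (discreteGaussian (Submodule.span ℤ (Set.range b)) s) N).map
        (Λ.latticeAlg b q K))
      (iidSamples (discreteGaussian (Submodule.span ℤ (Set.range b))
        (s * √((Λ.m + 1 : ℕ) : ℝ) / q)) K) ≤
      2 * N * δ + K * (25 * (q : ℝ) ^ Fintype.card ι / (Λ.B : ℝ) ^ Λ.m * (1 + Λ.m * Λ.B ^ 2)) := by
  classical
  set β := K * (25 * (q : ℝ) ^ Fintype.card ι / (Λ.B : ℝ) ^ Λ.m * (1 + Λ.m * Λ.B ^ 2)) with hβ
  set G := ι → ZMod q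
  let idx : Fin K → Fin Λ.m → Fin Λ.B → Fin N := fun k i a =>
    ⟨k / Λ.P * Λ.size + (i * Λ.B + a), by
      have h0 : (i * Λ.B + a : ℕ) < Λ.m * Λ.B := by
        have := a.2; have := i.2; nlinarith
      have h1 := hN k k.2
      have h2 : Λ.m * Λ.B ≤ Λ.size := Nat.le_add_right _ _
      linarith⟩
  let tg : Fin K → Fin N := fun k => ⟨Λ.tgt k, tgt_lt (hN k k.2) hP⟩
  have hsrc : ∀ (k : Fin K) τ (f : Fin Λ.m → Fin Λ.B), (∀ i : Fin Λ.m, Λ.digit τ i = f i) →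
      ∀ i : Fin Λ.m, Λ.src k τ i = idx k i (f i) := fun k τ f hf i => by
    rw [src, hf]
  have hidx : ∀ k i i' a a', idx k i a = idx k i' a' → i = i' ∧ a = a' := by
    intro k i i' a a' h
    obtain ⟨τ, -, hτ⟩ := exists_digit_eq (Λ := Λ) (fun _ => a)
    obtain ⟨τ', -, hτ'⟩ := exists_digit_eq (Λ := Λ) (fun _ => a')
    have h2 := src_eq_src (k := k) (k' := k) (τ := τ) (τ' := τ') hB i.2 i'.2 (by
      rw [hsrc k τ _ hτ, hsrc k τ' _ hτ', h])
    refine ⟨Fin.ext h2.2.1, Fin.ext ?_⟩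
    rw [← hτ i, ← hτ' i']; exact h2.2.2
  have htg : ∀ k i a, idx k i a ≠ tg k := by
    intro k i a h
    obtain ⟨τ, -, hτ⟩ := exists_digit_eq (Λ := Λ) (fun _ => a)
    exact src_ne_tgt (k := k) (k' := k) (τ := τ) hB hP i.2
      ((hsrc k τ _ hτ i).trans (Fin.mk.inj_iff.1 h))
  -- The coset vectors for which every target survives the removal of the samples taken by the other
  -- P - 1 targets of its group.
  let good : Finset (Fin N → G) := Finset.univ.filter fun c =>
    ∀ k, RobustlySolvable (idx k) (tg k) (Λ.P - 1) c
  let ch : (Fin N → G) → List (ℕ × ℕ) := fun c =>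
    Λ.greedy (fun k τ => Λ.tupleVec (extendZero c) k τ = 0) K
  let tup : (Fin N → G) → Fin K → ℕ := fun c k => ((ch c).getD k (0, 0)).2
  -- On good coset vectors the greedy run, which sees only cosets, serves the targets 0, …, K-1 in
  -- order, one tuple each.
  have hch : ∀ c ∈ good, ch c = List.ofFn fun k : Fin K => ((k : ℕ), tup c k) := by
    intro c hc
    have h1 : (ch c).map Prod.fst = List.range K := by
      refine map_fst_greedy hP fun k hk used hused => ?_
      obtain ⟨f, hf0, hf⟩ := (Finset.mem_filter.1 hc).2 ⟨k, hk⟩ used hused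
      refine ⟨f, hf, fun τ hτ => ?_⟩
      rw [← hf0, tupleVec, tupleSum_apply, Finset.sum_range]
      congr 1
      · refine Finset.sum_congr rfl fun i _ => ?_
        rw [hsrc ⟨k, hk⟩ τ f hτ i, extendZero_apply]
      · exact extendZero_apply c (tg ⟨k, hk⟩)
    have hlen : (ch c).length = K := by
      have := congrArg List.length h1
      simpa using this
    refine List.ext_getElem (by simp [hlen]) fun i h2 h3 => ?_
    have h4 : (ch c)[i].1 = i := by
      have : ((ch c).map Prod.fst)[i]'(by simpa using h2) = i := by simp [h1]
      simpa using this
    rw [List.getElem_ofFn]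
    refine Prod.ext h4 ?_
    simp only [tup]
    rw [List.getD_eq_getElem _ _ h2]
  have hmemch : ∀ c ∈ good, ∀ k : Fin K, ((k : ℕ), tup c k) ∈ ch c := fun c hc k => by
    rw [hch c hc, List.mem_ofFn]; exact ⟨k, rfl⟩
  have hvalid := fun c : Fin N → G =>
    (valid_greedy (Λ := Λ) (fun k τ => Λ.tupleVec (extendZero c) k τ = 0) K).1
  have hdisj : ∀ c ∈ good, ∀ k k' : Fin K, (k : ℕ) / Λ.P = k' / Λ.P → ∀ i < Λ.m,
      Λ.digit (tup c k) i = Λ.digit (tup c k') i → k = k' := by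
    intro c hc
    have hp := (hvalid c).pairwise
    change (ch c).Pairwise _ at hp
    rw [hch c hc, List.pairwise_ofFn] at hp
    intro k k' hg i hi hd
    rcases lt_trichotomy k k' with hlt | heq | hlt
    · exact absurd hd ((hp hlt).2 hg i hi)
    · exact heq
    · exact absurd hd.symm ((hp hlt).2 hg.symm i hi)
  -- Union bound over the K targets.
  have hgood : Fintype.card (Fin N → G) * (1 - β) ≤ good.card := by
    have h1 : ((Finset.univ \ good).card : ℝ) ≤ Fintype.card (Fin N → G) * β := by
      have hsub : Finset.univ \ good ⊆ Finset.univ.biUnion fun k : Fin K =>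
          Finset.univ.filter fun c : Fin N → G =>
            ¬ RobustlySolvable (idx k) (tg k) (Λ.P - 1) c := by
        intro c hc
        simp only [good, Finset.mem_sdiff, Finset.mem_univ, true_and, Finset.mem_filter, not_forall,
          Finset.mem_biUnion] at hc ⊢
        exact hc
      calc ((Finset.univ \ good).card : ℝ) ≤ ∑ k : Fin K, ((Finset.univ.filter fun c : Fin N → G =>
            ¬ RobustlySolvable (idx k) (tg k) (Λ.P - 1) c).card : ℝ) := by
            exact_mod_cast (Finset.card_le_card hsub).trans Finset.card_biUnion_le
        _ ≤ ∑ k : Fin K, Fintype.card (Fin N → G) *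
            (25 * Fintype.card G / (Λ.B : ℝ) ^ Λ.m * (1 + Λ.m * Λ.B ^ 2)) :=
            Finset.sum_le_sum fun k _ => card_not_robustlySolvable_le hm hB (hidx k) (htg k) hPB
        _ = _ := by
            rw [Finset.sum_const, Finset.card_univ, Fintype.card_fin, nsmul_eq_mul, hβ]
            have : (Fintype.card G : ℝ) = (q : ℝ) ^ Fintype.card ι := by
              rw [Fintype.card_fun, ZMod.card]; push_cast; rfl
            rw [this]; ring
    have h2 : (Finset.univ \ good).card + good.card = Fintype.card (Fin N → G) := by
      rw [Finset.card_sdiff_add_card_eq_card (Finset.subset_univ _), Finset.card_univ]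
    have h3 : ((Finset.univ \ good).card : ℝ) + good.card = Fintype.card (Fin N → G) := by
      exact_mod_cast h2
    linarith
  have hcardG : (Fintype.card (Fin N → G) : ℝ) = ((q : ℝ) ^ Fintype.card ι) ^ N := by
    rw [Fintype.card_fun, Fintype.card_fun, ZMod.card, Fintype.card_fin]; push_cast; rfl
  have hq0 : (0 : ℝ) < q := by exact_mod_cast NeZero.pos q
  have hlaw := le_map_iidSamples hc₀ hs hδ0 hδ1 hδ (N := N) (K := K) (m := Λ.m + 1)
    (Nat.succ_ne_zero _) good (fun c => Λ.coeff (tup c))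
    (fun c hc i => coeff_eq_single hB hP (hdisj c hc) i)
    (fun c _ k => card_coeff_ne_zero hB hP hN k)
    (fun c hc k => by
      rw [sum_coeff_smul hB hP hN (extendZero_apply c) k]
      exact (hvalid c).ok _ (hmemch c hc k))
    (Λ.latticeAlg b q K)
    (fun c hc x hx y hy => by
      have hgetD : ∀ i, (List.ofFn x).getD i 0 = extendZero x i := by
        intro i
        simp only [extendZero]
        split_ifs with h
        · rw [List.getD_eq_getElem _ _ (by simpa using h)]; simp
        · exact List.getD_eq_default _ _ (by simpa using h)
      have hmod : ∀ k τ, latticeMod b q (Λ.tupleVec (fun i => (List.ofFn x).getD i 0) k τ) =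
          Λ.tupleVec (extendZero c) k τ := by
        intro k τ
        rw [tupleVec_map]
        congr 1
        ext1 i
        rw [hgetD]
        simp only [extendZero]
        split_ifs with h
        · exact hx _
        · exact map_zero _
      -- The actual run accepts what the run on cosets accepts, so the coefficients of the sums are
      -- functions of the cosets alone.
      have hacc : Λ.accepted b q (fun i => (List.ofFn x).getD i 0) K = ch c := by
        simp only [accepted, hmod, ch]
      rw [latticeAlg, hacc, hch c hc, List.map_ofFn]
      congr 1
      ext1 k
      have h1 : latticeMod b q (Λ.tupleVec (fun i => (List.ofFn x).getD i 0) k (tup c k)) = 0 := by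
        rw [hmod]; exact (hvalid c).ok _ (hmemch c hc k)
      have h2 := hy k
      rw [sum_coeff_smul hB hP hN (x := fun i => (List.ofFn x).getD i 0)
        (fun i => by rw [hgetD, extendZero_apply]) k] at h2
      have h3 := smul_divVec b h1
      rw [h2] at h3
      rw [Function.comp_apply]
      refine Subtype.ext (smul_right_injective E hq0.ne' ?_)
      have h4 := congrArg (fun z : Submodule.span ℤ (Set.range b) => (z : E)) (h3)
      simp only [Submodule.coe_smul_of_tower, ← Int.cast_smul_eq_zsmul ℝ, Int.cast_natCast] at h4
      rw [h2]
      exact h4)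
  have hθ0 : 0 ≤ (good.card : ℝ) / ((q : ℝ) ^ Fintype.card ι) ^ N * ((1 - δ) / (1 + δ)) ^ N :=
    mul_nonneg (div_nonneg (Nat.cast_nonneg _) (by positivity))
      (pow_nonneg (div_nonneg (by linarith) (by linarith)) _)
  refine (statDist_le_of_le _ _ hθ0 hlaw).trans ?_
  have h1 := one_sub_two_mul_le_pow hδ0 hδ1 N
  have h2 : 1 - β ≤ (good.card : ℝ) / ((q : ℝ) ^ Fintype.card ι) ^ N := by
    rw [le_div_iff₀ (by positivity), ← hcardG, mul_comm]; exact hgood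
  have h3 : (good.card : ℝ) / ((q : ℝ) ^ Fintype.card ι) ^ N ≤ 1 := by
    rw [div_le_one (by positivity), ← hcardG]; exact_mod_cast Finset.card_le_univ good
  have h4 : ((1 - δ) / (1 + δ)) ^ N ≤ 1 :=
    pow_le_one₀ (div_nonneg (by linarith) (by linarith))
      ((div_le_one (by linarith)).2 (by linarith))
  have h5 : 0 ≤ (good.card : ℝ) / ((q : ℝ) ^ Fintype.card ι) ^ N :=
    div_nonneg (Nat.cast_nonneg _) (by positivity)
  nlinarith [pow_nonneg (div_nonneg (by linarith) (by linarith) : 0 ≤ (1 - δ) / (1 + δ)) N]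

end Layout

end GreedyLattice

/-! ### A calculus for running times of machine programs -/

section RamLogic

/-- `p`, started in `σ`, halts within `T` steps in a state that satisfies `Q`. -/
def RamHalts (S W : ℕ) (inp : List ℤ) (p : RamProg) (T : ℕ) (Q : RamState → Prop)
    (σ : RamState) : Prop :=
  ∃ σ' t, RamExec S W inp p σ σ' t ∧ t ≤ T ∧ Q σ'

/-- Run the programs of a list one after the other. -/
def RamProg.chain : List RamProg → RamProg
  | [] => .skip
  | p :: ps => .seq p (chain ps)

/-- `for i := 0 to M[lim] - 1 do p`; the register `c` is the loop condition, `one` holds `1`. -/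
def RamProg.forLoop (i c lim one : ℕ) (p : RamProg) : RamProg :=
  .seq (.const i 0) (.seq (.arith .sub c lim i)
    (.loop c (.seq p (.seq (.arith .add i i one) (.arith .sub c lim i)))))

theorem RamState.set_mem (σ : RamState) (a : ℕ) (v : ℤ) (b : ℕ) :
    (σ.set a v).mem b = if b = a then v else σ.mem b := by
  simp [RamState.set, Function.update_apply]

theorem RamState.set_out (σ : RamState) (a : ℕ) (v : ℤ) : (σ.set a v).out = σ.out := rfl

namespace RamHalts

variable {S W : ℕ} {inp : List ℤ} {σ : RamState} {Q : RamState → Prop}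

theorem mono {p : RamProg} {T T' : ℕ} {Q' : RamState → Prop} (h : RamHalts S W inp p T Q σ)
    (hT : T ≤ T') (hQ : ∀ σ', Q σ' → Q' σ') : RamHalts S W inp p T' Q' σ := by
  obtain ⟨σ', t, h1, h2, h3⟩ := h
  exact ⟨σ', t, h1, h2.trans hT, hQ _ h3⟩

/-- The postcondition of the first program is that the rest halts in time, so programs are verified
by symbolic execution from front to back. -/
theorem seq {p p' : RamProg} {T T' : ℕ}
    (h : RamHalts S W inp p T (RamHalts S W inp p' T' Q) σ) :
    RamHalts S W inp (.seq p p') (T + T') Q σ := by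
  obtain ⟨σ', t, h1, h2, σ'', t', h3, h4, h5⟩ := h
  exact ⟨σ'', t + t', .seq _ _ _ _ _ _ _ h1 h3, by omega, h5⟩

/-- The empty chain is a `skip`, which costs one step; every chain is therefore one step longer than
its parts. -/
theorem nil (h : Q σ) : RamHalts S W inp (.chain []) 1 Q σ := ⟨σ, 1, .skip σ, le_rfl, h⟩

theorem skip (h : Q σ) : RamHalts S W inp .skip 1 Q σ := ⟨σ, 1, .skip σ, le_rfl, h⟩

theorem cons {p : RamProg} {ps : List RamProg} {T T' : ℕ}
    (h : RamHalts S W inp p T (RamHalts S W inp (.chain ps) T' Q) σ) :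
    RamHalts S W inp (.chain (p :: ps)) (T + T') Q σ := h.seq

theorem const {a : ℕ} {k : ℤ} (ha : a < S) (hW : k.natAbs < 2 ^ W) (h : Q (σ.set a k)) :
    RamHalts S W inp (.const a k) 1 Q σ := ⟨_, 1, .const σ a k ha hW, le_rfl, h⟩

theorem arith {op : RamOp} {a b c : ℕ} (v : ℤ) (ha : a < S) (hb : b < S) (hc : c < S)
    (hv : op.eval (σ.mem b) (σ.mem c) = v) (hW : v.natAbs < 2 ^ W) (h : Q (σ.set a v)) :
    RamHalts S W inp (.arith op a b c) 1 Q σ := by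
  subst hv
  exact ⟨_, 1, .arith σ op a b c ha hb hc hW, le_rfl, h⟩

theorem const_cons {a : ℕ} {k : ℤ} {ps : List RamProg} {T : ℕ} (ha : a < S)
    (hW : k.natAbs < 2 ^ W) (h : RamHalts S W inp (.chain ps) T Q (σ.set a k)) :
    RamHalts S W inp (.chain (.const a k :: ps)) (T + 1) Q σ :=
  (cons (const ha hW h)).mono (Nat.add_comm _ _).le fun _ h => h

theorem arith_cons {op : RamOp} {a b c : ℕ} {ps : List RamProg} {T : ℕ} (v : ℤ) (ha : a < S)
    (hb : b < S) (hc : c < S) (hv : op.eval (σ.mem b) (σ.mem c) = v) (hW : v.natAbs < 2 ^ W)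
    (h : RamHalts S W inp (.chain ps) T Q (σ.set a v)) :
    RamHalts S W inp (.chain (.arith op a b c :: ps)) (T + 1) Q σ :=
  (cons (arith v ha hb hc hv hW h)).mono (Nat.add_comm _ _).le fun _ h => h

theorem arithNat_cons {op : RamOp} {a b c : ℕ} {ps : List RamProg} {T : ℕ} (v : ℕ) (ha : a < S)
    (hb : b < S) (hc : c < S) (hv : op.eval (σ.mem b) (σ.mem c) = v) (hW : v < 2 ^ W)
    (h : RamHalts S W inp (.chain ps) T Q (σ.set a v)) :
    RamHalts S W inp (.chain (.arith op a b c :: ps)) (T + 1) Q σ :=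
  arith_cons v ha hb hc hv (by rwa [Int.natAbs_natCast]) h

theorem load_cons {a b : ℕ} {ps : List RamProg} {T : ℕ} (i : ℕ) (v : ℤ) (ha : a < S) (hb : b < S)
    (hi : σ.mem b = i) (hiS : i < S) (hv : σ.mem i = v) (hW : v.natAbs < 2 ^ W)
    (h : RamHalts S W inp (.chain ps) T Q (σ.set a v)) :
    RamHalts S W inp (.chain (.load a b :: ps)) (T + 1) Q σ := by
  subst hv
  exact (cons ⟨_, 1, .load σ a b i ha hb hi hiS hW, le_rfl, h⟩).mono (Nat.add_comm _ _).le
    fun _ h => h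

theorem store_cons {a b : ℕ} {ps : List RamProg} {T : ℕ} (i : ℕ) (v : ℤ) (ha : a < S) (hb : b < S)
    (hi : σ.mem a = i) (hiS : i < S) (hv : σ.mem b = v) (hW : v.natAbs < 2 ^ W)
    (h : RamHalts S W inp (.chain ps) T Q (σ.set i v)) :
    RamHalts S W inp (.chain (.store a b :: ps)) (T + 1) Q σ := by
  subst hv
  exact (cons ⟨_, 1, .store σ a b i ha hb hi hiS hW, le_rfl, h⟩).mono (Nat.add_comm _ _).le
    fun _ h => h

theorem read_cons {a b : ℕ} {ps : List RamProg} {T : ℕ} (i : ℕ) (v : ℤ) (ha : a < S) (hb : b < S)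
    (hi : σ.mem b = i) (hlen : i < inp.length) (hv : inp.getD i 0 = v) (hW : v.natAbs < 2 ^ W)
    (h : RamHalts S W inp (.chain ps) T Q (σ.set a v)) :
    RamHalts S W inp (.chain (.read a b :: ps)) (T + 1) Q σ := by
  subst hv
  exact (cons ⟨_, 1, .read σ a b i ha hb hi hlen hW, le_rfl, h⟩).mono (Nat.add_comm _ _).le
    fun _ h => h

theorem emit_cons {a : ℕ} {ps : List RamProg} {T : ℕ} (ha : a < S)
    (h : RamHalts S W inp (.chain ps) T Q { σ with out := σ.out ++ [σ.mem a] }) :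
    RamHalts S W inp (.chain (.emit a :: ps)) (T + 1) Q σ :=
  (cons ⟨_, 1, .emit σ a ha, le_rfl, h⟩).mono (Nat.add_comm _ _).le fun _ h => h

/-- Call a subprogram. -/
theorem call {p : RamProg} {ps : List RamProg} {Q' : RamState → Prop} (T₁ T₂ : ℕ) {T : ℕ}
    (h : RamHalts S W inp p T₁ Q' σ) (hT : T₁ + T₂ ≤ T)
    (h' : ∀ σ', Q' σ' → RamHalts S W inp (.chain ps) T₂ Q σ') :
    RamHalts S W inp (.chain (p :: ps)) T Q σ :=
  (cons (h.mono le_rfl h')).mono hT fun _ h => h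

theorem ite {a : ℕ} {p p' : RamProg} {T : ℕ} (ha : a < S)
    (h1 : 0 < σ.mem a → RamHalts S W inp p T Q σ)
    (h2 : ¬ 0 < σ.mem a → RamHalts S W inp p' T Q σ) :
    RamHalts S W inp (.ite a p p') (T + 1) Q σ := by
  by_cases hc : 0 < σ.mem a
  · obtain ⟨σ', t, h, ht, hQ⟩ := h1 hc
    exact ⟨σ', t + 1, .ite_pos _ _ _ _ _ _ ha hc h, by omega, hQ⟩
  · obtain ⟨σ', t, h, ht, hQ⟩ := h2 hc
    exact ⟨σ', t + 1, .ite_neg _ _ _ _ _ _ ha hc h, by omega, hQ⟩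

/-- Loop rule with a bound on the number of iterations. -/
theorem loop {a : ℕ} {p : RamProg} {T : ℕ} (ha : a < S) (Inv : ℕ → RamState → Prop)
    (hdone : ∀ σ, Inv 0 σ → ¬ 0 < σ.mem a)
    (hstep : ∀ r σ, Inv (r + 1) σ → 0 < σ.mem a ∧ RamHalts S W inp p T (Inv r) σ)
    (r : ℕ) (h : Inv r σ) :
    RamHalts S W inp (.loop a p) (r * (T + 1) + 1) (Inv 0) σ := by
  induction r generalizing σ with
  | zero => exact ⟨σ, 1, .loop_done σ a p ha (hdone σ h), by omega, h⟩
  | succ r ih =>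
    obtain ⟨hpos, σ', t, h1, ht, hI⟩ := hstep r σ h
    obtain ⟨σ'', t', h2, ht', hQ⟩ := ih hI
    refine ⟨σ'', t + t' + 1, .loop_step _ _ _ _ _ _ _ ha hpos h1 h2, ?_, hQ⟩
    rw [Nat.succ_mul]; omega

/-- `Inv j` describes the state with j rounds done, after the index and the condition register have
been updated. Each round costs the body, two updates and a test; the additive 3 is for two
initializations and the final test. -/
theorem forLoop {i c lim one : ℕ} {p : RamProg} {T m : ℕ} (Inv : ℕ → RamState → Prop)
    (hi : i < S) (hc : c < S) (hlim : lim < S) (hone : one < S) (hci : c ≠ i) (hlimi : lim ≠ i)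
    (hW : m < 2 ^ W) (hσ : σ.mem lim = m)
    (h0 : Inv 0 ((σ.set i 0).set c m))
    (hbody : ∀ j < m, ∀ σ : RamState, Inv j σ → σ.mem i = j → RamHalts S W inp p T
      (fun σ' => σ'.mem lim = m ∧ σ'.mem one = 1 ∧ σ'.mem i = j ∧
        Inv (j + 1) ((σ'.set i (j + 1 : ℕ)).set c ((m - (j + 1) : ℕ) : ℤ))) σ) :
    RamHalts S W inp (.forLoop i c lim one p) (m * (T + 3) + 3) (Inv m) σ := by
  let Inv' : ℕ → RamState → Prop := fun r σ =>
    r ≤ m ∧ σ.mem i = ((m - r : ℕ) : ℤ) ∧ σ.mem c = r ∧ Inv (m - r) σ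
  have h2 : (0 : ℕ) < 2 ^ W := by positivity
  have h := loop (S := S) (W := W) (inp := inp) (σ := (σ.set i 0).set c m)
    (p := .seq p (.seq (.arith .add i i one) (.arith .sub c lim i))) (T := T + (1 + 1)) hc Inv'
    (fun σ h => by rw [h.2.2.1]; simp) (fun r σ h => by
      obtain ⟨hr, hmi, hmc, hI⟩ := h
      refine ⟨by rw [hmc]; positivity, ?_⟩
      refine RamHalts.seq ((hbody (m - (r + 1)) (by omega) σ hI hmi).mono le_rfl fun σ' h' => ?_)
      obtain ⟨hl, ho, hi', hI'⟩ := h'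
      have e1 : m - (r + 1) + 1 = m - r := by omega
      have e2 : m - (m - r) = r := by omega
      rw [e1, e2] at hI'
      refine RamHalts.seq (RamHalts.arith ((m - r : ℕ) : ℤ) hi hi hone ?_ ?_
        (RamHalts.arith (r : ℤ) hc hlim hi ?_ ?_ ⟨by omega, ?_, ?_, hI'⟩))
      · rw [RamOp.eval, hi', ho, ← e1]; push_cast; rfl
      · rw [Int.natAbs_natCast]; omega
      · rw [RamOp.eval, RamState.set_mem, RamState.set_mem, if_neg hlimi, if_pos rfl, hl]
        push_cast [show r ≤ m by omega]; ring
      · rw [Int.natAbs_natCast]; omega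
      · rw [RamState.set_mem, RamState.set_mem, if_neg hci.symm, if_pos rfl]
      · rw [RamState.set_mem, if_pos rfl]) m
    ⟨le_rfl, by simp [RamState.set_mem, hci.symm], by simp [RamState.set_mem], by simpa using h0⟩
  refine ((RamHalts.seq (RamHalts.const hi (by simp) (RamHalts.seq (RamHalts.arith (m : ℤ) hc hlim hi
    ?_ ?_ h)))).mono ?_ fun σ' h' => ?_)
  · simp [RamOp.eval, RamState.set_mem, hlimi, hσ]
  · simpa using hW
  · rw [show T + (1 + 1) + 1 = T + 3 by ring]; omega
  · simpa using h'.2.2.2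

end RamHalts

/-- The states agree on the registers below `32` that are not in `l`. -/
def LowFrame (l : List ℕ) (σ σ' : RamState) : Prop := ∀ a < 32, a ∉ l → σ'.mem a = σ.mem a

/-- The states agree outside `l`. -/
def Frame (l : List ℕ) (σ σ' : RamState) : Prop := ∀ a ∉ l, σ'.mem a = σ.mem a

end RamLogic

/-! ### Register layout and computation of one coordinate of a signed sum -/

section RamSubprograms

/-- The input of the machine, the resources and the parameters of the algorithm fit together. -/
structure RamSetup (S W : ℕ) (inp : List ℤ) (Λ : Layout) (n q K X : ℕ) : Prop where
  n_pos : 0 < n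
  q_pos : 0 < q
  B_pos : 0 < Λ.B
  P_pos : 0 < Λ.P
  length : ∀ k < K, 4 + (k / Λ.P + 1) * Λ.size * n ≤ inp.length
  length_lt : inp.length < 2 ^ W
  entry_le : ∀ i, (inp.getD i 0).natAbs ≤ X
  sum_lt : (Λ.m + 1) * X < 2 ^ W
  tuples_lt : Λ.B ^ Λ.m < 2 ^ W
  K_lt : K < 2 ^ W
  bad_lt : 1 + Λ.m + n * q < 2 ^ W
  mem_le : 32 + Λ.m * Λ.B ≤ S
  mem_lt : 32 + Λ.m * Λ.B < 2 ^ W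

/-- The registers that hold the parameters. -/
structure RamRegs (Λ : Layout) (n q K : ℕ) (σ : RamState) : Prop where
  one : σ.mem 0 = 1
  n : σ.mem 1 = n
  q : σ.mem 2 = q
  m : σ.mem 5 = Λ.m
  P : σ.mem 6 = Λ.P
  B : σ.mem 7 = Λ.B
  K : σ.mem 8 = K
  block : σ.mem 9 = (Λ.m * Λ.B : ℕ)
  size : σ.mem 10 = Λ.size
  tuples : σ.mem 11 = (Λ.B ^ Λ.m : ℕ)

theorem Frame.low {l : List ℕ} {σ σ' : RamState} (h : Frame l σ σ') : LowFrame l σ σ' :=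
  fun a _ ha => h a ha

theorem RamRegs.of_lowFrame {Λ : Layout} {n q K : ℕ} {σ σ' : RamState} {l : List ℕ}
    (h : RamRegs Λ n q K σ) (hF : LowFrame l σ σ') (hl : ∀ a ∈ l, 12 ≤ a) :
    RamRegs Λ n q K σ' := by
  have h' : ∀ a < 12, σ'.mem a = σ.mem a := fun a ha =>
    hF a (by omega) fun hm => absurd (hl a hm) (by omega)
  constructor
  · rw [h' 0 (by omega), h.one]
  · rw [h' 1 (by omega), h.n]
  · rw [h' 2 (by omega), h.q]
  · rw [h' 5 (by omega), h.m]
  · rw [h' 6 (by omega), h.P]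
  · rw [h' 7 (by omega), h.B]
  · rw [h' 8 (by omega), h.K]
  · rw [h' 9 (by omega), h.block]
  · rw [h' 10 (by omega), h.size]
  · rw [h' 11 (by omega), h.tuples]

/-- Put `i * B + digit i` into register 26 and advance the remaining digits in register 24. -/
def digitProg : RamProg :=
  .chain [.arith .mod 26 24 7, .arith .div 24 24 7, .arith .mul 27 16 7, .arith .add 26 26 27]

/-- One coordinate of the signed sum of the selected samples, into register 25. -/
def coordProg : RamProg :=
  .chain [.const 26 0, .arith .add 24 14 26, .const 25 0,
    .forLoop 16 17 5 0 (.chain [digitProg, .arith .add 26 26 20, .arith .mul 26 26 1,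
      .arith .add 26 26 18, .const 27 4, .arith .add 26 26 27, .read 26 26, .arith .add 25 25 26]),
    .arith .mul 26 21 1, .arith .add 26 26 18, .const 27 4, .arith .add 26 26 27, .read 26 26,
    .arith .sub 25 25 26]

variable {S W : ℕ} {inp : List ℤ} {Λ : Layout} {n q K X : ℕ}

theorem digitProg_halts (hS : RamSetup S W inp Λ n q K X) {j τ : ℕ} (hj : j < Λ.m)
    (hτ : τ < Λ.B ^ Λ.m) {σ : RamState} (h7 : σ.mem 7 = Λ.B) (h16 : σ.mem 16 = j)
    (h24 : σ.mem 24 = (τ / Λ.B ^ j : ℕ)) :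
    RamHalts S W inp digitProg 5 (fun σ' => Frame [24, 26, 27] σ σ' ∧ σ'.out = σ.out ∧
      σ'.mem 24 = (τ / Λ.B ^ (j + 1) : ℕ) ∧ σ'.mem 26 = (j * Λ.B + Λ.digit τ j : ℕ)) σ := by
  have hB := hS.B_pos
  have hS1 := hS.mem_le
  have hS2 := hS.mem_lt
  have hT := hS.tuples_lt
  have hd := Layout.digit_lt hB τ j
  have h1 : j * Λ.B + Λ.B ≤ Λ.m * Λ.B := by
    rw [← Nat.succ_mul]; exact Nat.mul_le_mul_right _ hj
  have h2 : τ / Λ.B ^ (j + 1) ≤ τ := Nat.div_le_self _ _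
  refine .arithNat_cons (Λ.digit τ j) (by omega) (by omega) (by omega) ?_ (by omega) ?_
  · rw [RamOp.eval, h24, h7, Layout.digit]; push_cast; rfl
  refine .arithNat_cons (τ / Λ.B ^ (j + 1)) (by omega) (by omega) (by omega) ?_ (by omega) ?_
  · rw [pow_succ, ← Nat.div_div_eq_div_mul, Int.natCast_div, ← h24, ← h7]
    simp [RamOp.eval, RamState.set_mem]
  refine .arithNat_cons (j * Λ.B) (by omega) (by omega) (by omega) ?_ (by omega) ?_
  · simp [RamOp.eval, RamState.set_mem, h16, h7]
  refine .arithNat_cons (j * Λ.B + Λ.digit τ j) (by omega) (by omega) (by omega) ?_ (by omega) ?_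
  · simp [RamOp.eval, RamState.set_mem, add_comm]
  refine .nil ⟨fun a ha => ?_, rfl, ?_, ?_⟩
  · simp only [List.mem_cons, List.not_mem_nil, or_false, not_or] at ha
    simp [RamState.set_mem, ha]
  · simp [RamState.set_mem]
  · simp [RamState.set_mem]

theorem coordProg_halts (hS : RamSetup S W inp Λ n q K X) {k τ l : ℕ} (hk : k < K)
    (hτ : τ < Λ.B ^ Λ.m) (hl : l < n) {σ : RamState} (hr : RamRegs Λ n q K σ)
    (h14 : σ.mem 14 = τ) (h20 : σ.mem 20 = (k / Λ.P * Λ.size : ℕ)) (h21 : σ.mem 21 = Λ.tgt k)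
    (h18 : σ.mem 18 = l) :
    RamHalts S W inp coordProg (Λ.m * 16 + 13) (fun σ' => Frame [16, 17, 24, 25, 26, 27] σ σ' ∧
      σ'.out = σ.out ∧
      σ'.mem 25 = Λ.tupleVec (fun i => inp.getD (4 + i * n + l) 0) k τ) σ := by
  have hB := hS.B_pos
  have hS1 := hS.mem_le
  have hS2 := hS.mem_lt
  have hT := hS.tuples_lt
  have hlen := hS.length k hk
  have hlW := hS.length_lt
  have hpos := hS.n_pos
  set x : ℕ → ℤ := fun i => inp.getD (4 + i * n + l) 0 with hx
  -- The input begins with four parameters, hence the offset 4; afterwards each vector takes n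
  -- cells.
  have hidx : ∀ i, i < (k / Λ.P + 1) * Λ.size → 4 + i * n + l < inp.length := fun i hi => by
    have := Nat.mul_le_mul_right n (Nat.succ_le_of_lt hi)
    rw [Nat.succ_mul] at this; omega
  have hself : ∀ i, i ≤ i * n := fun i => Nat.le_mul_of_pos_right i hpos
  have hxX : ∀ i, (x i).natAbs ≤ X := fun i => hS.entry_le _
  have hXW : X < 2 ^ W := lt_of_le_of_lt (Nat.le_mul_of_pos_left X (Nat.succ_pos _)) hS.sum_lt
  have hsumX : ∀ j ≤ Λ.m, (∑ i ∈ Finset.range j, x (Λ.src k τ i)).natAbs ≤ Λ.m * X := fun j hj => by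
    refine (Int.natAbs_sum_le _ _).trans ((Finset.sum_le_card_nsmul _ _ X fun i _ => hxX _).trans ?_)
    rw [Finset.card_range, smul_eq_mul]
    exact Nat.mul_le_mul_right _ hj
  have hsW := hS.sum_lt
  rw [Nat.succ_mul] at hsW
  have hmB : Λ.m ≤ Λ.m * Λ.B := Nat.le_mul_of_pos_right _ hB
  refine .const_cons (by omega) (by simp) ?_
  -- Adding a zero register copies a register. Register 24 is consumed digit by digit while register
  -- 14 keeps the tuple.
  refine .arithNat_cons τ (by omega) (by omega) (by omega)
    (by simp [RamOp.eval, RamState.set_mem, h14]) (by omega) ?_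
  refine .const_cons (by omega) (by simp) ?_
  refine .call (Λ.m * 16 + 3) 7 (RamHalts.forLoop (m := Λ.m) (T := 13)
    (fun j σ' => Frame [16, 17, 24, 25, 26, 27] σ σ' ∧ σ'.out = σ.out ∧
      σ'.mem 24 = (τ / Λ.B ^ j : ℕ) ∧
      σ'.mem 25 = ∑ i ∈ Finset.range j, x (Λ.src k τ i))
    (by omega) (by omega) (by omega) (by omega) (by omega) (by omega) (by omega) ?_ ?_ ?_)
    (by omega) ?_
  · simp [RamState.set_mem, hr.m]
  · refine ⟨fun a ha => ?_, rfl, ?_, ?_⟩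
    · simp only [List.mem_cons, List.not_mem_nil, or_false, not_or] at ha
      simp [RamState.set_mem, ha]
    · simp [RamState.set_mem]
    · simp [RamState.set_mem]
  · rintro j hj σ₁ ⟨hF, ho, h24, h25⟩ h16
    have hR := hr.of_lowFrame hF.low (by decide)
    have f20 : σ₁.mem 20 = _ := (hF 20 (by decide)).trans h20
    have f18 : σ₁.mem 18 = _ := (hF 18 (by decide)).trans h18
    have hsl := Layout.src_lt (Λ := Λ) (k := k) (τ := τ) (N := (k / Λ.P + 1) * Λ.size) le_rfl hB hj
    have hil := hidx _ hsl
    have hs2 := hself (Λ.src k τ j)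
    refine .call 5 8 (digitProg_halts hS hj hτ hR.B h16 h24) (by omega) ?_
    rintro σ₂ ⟨hF2, ho2, h24', h26⟩
    have g20 : σ₂.mem 20 = _ := (hF2 20 (by decide)).trans f20
    have g18 : σ₂.mem 18 = _ := (hF2 18 (by decide)).trans f18
    have g1 : σ₂.mem 1 = _ := (hF2 1 (by decide)).trans hR.n
    have g25 : σ₂.mem 25 = _ := (hF2 25 (by decide)).trans h25
    have g16 : σ₂.mem 16 = _ := (hF2 16 (by decide)).trans h16
    have g0 : σ₂.mem 0 = _ := (hF2 0 (by decide)).trans hR.one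
    have g5 : σ₂.mem 5 = _ := (hF2 5 (by decide)).trans hR.m
    refine .arithNat_cons (Λ.src k τ j) (by omega) (by omega) (by omega)
      (by rw [RamOp.eval, h26, g20, Layout.src]; push_cast; ring)
      (by omega) ?_
    refine .arithNat_cons (Λ.src k τ j * n) (by omega) (by omega) (by omega)
      (by simp [RamOp.eval, RamState.set_mem, g1])
      (by omega) ?_
    refine .arithNat_cons (Λ.src k τ j * n + l) (by omega) (by omega) (by omega)
      (by simp [RamOp.eval, RamState.set_mem, g18])
      (by omega) ?_
    refine .const_cons (by omega) (by norm_num; omega) ?_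
    refine .arithNat_cons (4 + Λ.src k τ j * n + l) (by omega) (by omega) (by omega)
      (by simp [RamOp.eval, RamState.set_mem]; ring)
      (by omega) ?_
    refine .read_cons (4 + Λ.src k τ j * n + l) (x (Λ.src k τ j)) (by omega) (by omega)
      (by simp [RamState.set_mem]) hil rfl (by have := hxX (Λ.src k τ j); omega) ?_
    refine .arith_cons (∑ i ∈ Finset.range (j + 1), x (Λ.src k τ i)) (by omega) (by omega)
      (by omega) (by simp [RamOp.eval, RamState.set_mem, g25, Finset.sum_range_succ])
      (by have := hsumX (j + 1) hj; omega) ?_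
    refine .nil ⟨by simp [RamState.set_mem, g5], by simp [RamState.set_mem, g0],
      by simp [RamState.set_mem, g16], fun a ha => ?_, ?_, ?_, ?_⟩
    · have ha' := ha
      simp only [List.mem_cons, List.not_mem_nil, or_false, not_or] at ha'
      have h2 := hF2 a (by simp [ha'])
      have h1 := hF a ha
      simp [RamState.set_mem, ha', h2, h1]
    · simp [RamState.set_out, ho2, ho]
    · simp [RamState.set_mem, h24']
    · simp [RamState.set_mem]
  · rintro σ₁ ⟨hF, ho, h24, h25⟩
    have hR := hr.of_lowFrame hF.low (by decide)
    have f21 : σ₁.mem 21 = _ := (hF 21 (by decide)).trans h21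
    have f18 : σ₁.mem 18 = _ := (hF 18 (by decide)).trans h18
    have hil := hidx _ (Layout.tgt_lt (Λ := Λ) (k := k) le_rfl hS.P_pos)
    have hXt := hxX (Λ.tgt k)
    have hfin := hsumX Λ.m le_rfl
    refine .arithNat_cons (Λ.tgt k * n) (by omega) (by omega) (by omega)
      (by simp [RamOp.eval, f21, hR.n])
      (by omega) ?_
    refine .arithNat_cons (Λ.tgt k * n + l) (by omega) (by omega) (by omega)
      (by simp [RamOp.eval, RamState.set_mem, f18])
      (by omega) ?_
    refine .const_cons (by omega) (by norm_num; omega) ?_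
    refine .arithNat_cons (4 + Λ.tgt k * n + l) (by omega) (by omega) (by omega)
      (by simp [RamOp.eval, RamState.set_mem]; ring)
      (by omega) ?_
    refine .read_cons (4 + Λ.tgt k * n + l) (x (Λ.tgt k)) (by omega) (by omega)
      (by simp [RamState.set_mem]) hil rfl (by omega) ?_
    refine .arith_cons (Λ.tupleVec x k τ) (by omega) (by omega)
      (by omega) (by simp [RamOp.eval, RamState.set_mem, h25, Layout.tupleVec])
      (by rw [Layout.tupleVec]; omega) ?_
    refine .nil ⟨fun a ha => ?_, ?_, ?_⟩
    · have ha' := ha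
      simp only [List.mem_cons, List.not_mem_nil, or_false, not_or] at ha'
      have h1 := hF a ha
      simp [RamState.set_mem, ha', h1]
    · simp [RamState.set_out, ho]
    · simp [RamState.set_mem]

end RamSubprograms

/-! ### Testing and serving one tuple -/

section RamMain

/-- The sample `a` of a group is used by an accepted pair of the group of the target `k`. -/
def Layout.Used (Λ : Layout) (ch : List (ℕ × ℕ)) (k a : ℕ) : Prop :=
  ∃ p ∈ ch, p.1 / Λ.P = k / Λ.P ∧ ∃ i < Λ.m, i * Λ.B + Λ.digit p.2 i = a

/-- The coordinate `l` of the signed sum of input vectors selected by `τ` and the target `k`. -/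
def ramCoord (inp : List ℤ) (Λ : Layout) (n k τ l : ℕ) : ℤ :=
  Λ.tupleVec (fun i => inp.getD (4 + i * n + l) 0) k τ

/-- All coordinates of the signed sum are divisible by `q`. -/
def RamOk (inp : List ℤ) (Λ : Layout) (n q k τ : ℕ) : Prop :=
  ∀ l < n, (q : ℤ) ∣ ramCoord inp Λ n k τ l

/-- The output for a list of accepted pairs. -/
def ramOut (inp : List ℤ) (Λ : Layout) (n q : ℕ) (ch : List (ℕ × ℕ)) : List ℤ :=
  ch.flatMap fun p => (List.range n).map fun l => ramCoord inp Λ n p.1 p.2 l / q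

open Classical in
/-- The state of the machine while the target `k` is processed, with accepted pairs `ch`. -/
structure RamMain (inp : List ℤ) (Λ : Layout) (n q K : ℕ) (ch : List (ℕ × ℕ)) (k : ℕ)
    (σ : RamState) : Prop where
  regs : RamRegs Λ n q K σ
  target : σ.mem 12 = k
  base : σ.mem 20 = (k / Λ.P * Λ.size : ℕ)
  tgt : σ.mem 21 = Λ.tgt k
  found : σ.mem 22 = ((if ∃ p ∈ ch, p.1 = k then 1 else 0 : ℕ) : ℤ)
  flag : ∀ a < Λ.m * Λ.B, σ.mem (32 + a) = ((if Λ.Used ch k a then 1 else 0 : ℕ) : ℤ)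
  out : σ.out = ramOut inp Λ n q ch

variable {S W : ℕ} {inp : List ℤ} {Λ : Layout} {n q K X : ℕ}

/-- Subprograms may overwrite only scratch registers: the parameters, the current target and its
addresses, the success mark and all flags are protected. -/
theorem RamMain.of_frame {ch : List (ℕ × ℕ)} {k : ℕ} {σ σ' : RamState} {l : List ℕ}
    (h : RamMain inp Λ n q K ch k σ) (hF : Frame l σ σ') (ho : σ'.out = σ.out)
    (hl : ∀ a ∈ l, 12 < a ∧ a < 32 ∧ a ≠ 20 ∧ a ≠ 21 ∧ a ≠ 22) : RamMain inp Λ n q K ch k σ' := by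
  have h' : ∀ a, (a ≤ 12 ∨ 32 ≤ a ∨ a = 20 ∨ a = 21 ∨ a = 22) → σ'.mem a = σ.mem a := fun a ha =>
    hF a fun hm => by have := hl a hm; omega
  refine ⟨h.regs.of_lowFrame hF.low fun a ha => (hl a ha).1.le, ?_, ?_, ?_, ?_, fun a ha => ?_, ?_⟩
  · rw [h' 12 (by omega), h.target]
  · rw [h' 20 (by omega), h.base]
  · rw [h' 21 (by omega), h.tgt]
  · rw [h' 22 (by omega), h.found]
  · rw [h' (32 + a) (by omega), h.flag a ha]
  · rw [ho, h.out]

theorem Layout.block_lt {i m B a : ℕ} (hi : i < m) (ha : a < B) : i * B + a < m * B := by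
  have : i * B + B ≤ m * B := by rw [← Nat.succ_mul]; exact Nat.mul_le_mul_right _ hi
  omega

/-- A position within a group encodes block and digit, so one flag per position is enough to detect
conflicts without storing the accepted tuples. -/
theorem Layout.conflict_iff (hB : 0 < Λ.B) {ch : List (ℕ × ℕ)} {k τ : ℕ} :
    Λ.Conflict ch k τ ↔ (∃ p ∈ ch, p.1 = k) ∨
      ∃ i < Λ.m, Λ.Used ch k (i * Λ.B + Λ.digit τ i) := by
  constructor
  · rintro ⟨p, hp, rfl | ⟨h, i, hi, hd⟩⟩
    · exact .inl ⟨p, hp, rfl⟩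
    · exact .inr ⟨i, hi, p, hp, h, i, hi, by rw [hd]⟩
  · rintro (⟨p, hp, rfl⟩ | ⟨i, hi, p, hp, h, i', hi', he⟩)
    · exact ⟨p, hp, .inl rfl⟩
    · refine ⟨p, hp, .inr ⟨h, i, hi, ?_⟩⟩
      have h1 := congrArg (· / Λ.B) he
      have h2 := Layout.digit_lt (Λ := Λ) hB p.2 i'
      have h3 := Layout.digit_lt (Λ := Λ) hB τ i
      simp only [mul_comm _ Λ.B, Nat.mul_add_div hB, Nat.div_eq_of_lt h2, Nat.div_eq_of_lt h3,
        add_zero] at h1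
      subst h1
      omega

/-- Set all flags to zero. -/
def clearProg : RamProg :=
  .forLoop 16 17 9 0 (.chain [.const 27 32, .arith .add 26 16 27, .const 27 0, .store 26 27])

/-- Add to register 23 the flags of the samples selected by the tuple in register 14. -/
def flagsProg : RamProg :=
  .chain [.const 26 0, .arith .add 24 14 26,
    .forLoop 16 17 5 0 (.chain [digitProg, .const 27 32, .arith .add 26 26 27, .load 26 26,
      .arith .add 23 23 26])]

/-- Add to register 23 the residues of the coordinates of the signed sum. -/
def residuesProg : RamProg :=
  .forLoop 18 19 1 0 (.chain [coordProg, .arith .mod 26 25 2, .arith .add 23 23 26])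

/-- Write the quotients of the coordinates of the signed sum on the output. -/
def quotientsProg : RamProg :=
  .forLoop 18 19 1 0 (.chain [coordProg, .arith .div 25 25 2, .emit 25])

/-- Set the flags of the samples selected by the tuple in register 14. -/
def markProg : RamProg :=
  .chain [.const 26 0, .arith .add 24 14 26,
    .forLoop 16 17 5 0 (.chain [digitProg, .const 27 32, .arith .add 26 26 27, .store 26 0])]

/-- Try the tuple in register 14 for the target in register 12. -/
def tupleProg : RamProg :=
  .chain [.const 26 0, .arith .add 23 22 26, flagsProg, residuesProg,
    .ite 23 .skip (.chain [.const 22 1, quotientsProg, markProg])]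

/-- Process the target in register 12. -/
def targetProg : RamProg :=
  .chain [.arith .div 26 12 6, .arith .mul 20 26 10, .arith .mod 26 12 6, .arith .add 21 20 9,
    .arith .add 21 21 26, .ite 26 .skip clearProg, .const 22 0, .forLoop 14 15 11 0 tupleProg]

theorem clearProg_halts (hS : RamSetup S W inp Λ n q K X) {σ : RamState}
    (hr : RamRegs Λ n q K σ) :
    RamHalts S W inp clearProg (Λ.m * Λ.B * 8 + 3) (fun σ' => LowFrame [16, 17, 26, 27] σ σ' ∧
      σ'.out = σ.out ∧ ∀ a < Λ.m * Λ.B, σ'.mem (32 + a) = 0) σ := by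
  have hS1 := hS.mem_le
  have hS2 := hS.mem_lt
  refine (RamHalts.forLoop (m := Λ.m * Λ.B) (T := 5)
    (fun j σ' => LowFrame [16, 17, 26, 27] σ σ' ∧ σ'.out = σ.out ∧
      ∀ a < j, σ'.mem (32 + a) = 0)
    (by omega) (by omega) (by omega) (by omega) (by omega) (by omega) (by omega) ?_ ?_ ?_).mono
    le_rfl fun σ' h => h
  · simp [hr.block]
  · refine ⟨fun a _ ha => ?_, rfl, fun a ha => absurd ha (by omega)⟩
    simp only [List.mem_cons, List.not_mem_nil, or_false, not_or] at ha
    simp [RamState.set_mem, ha]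
  · rintro j hj σ₁ ⟨hF, ho, hc⟩ h16
    have hR := hr.of_lowFrame hF (by decide)
    refine .const_cons (by omega) (by norm_num; omega) ?_
    refine .arithNat_cons (32 + j) (by omega) (by omega) (by omega)
      (by simp [RamOp.eval, RamState.set_mem, h16]; ring) (by omega) ?_
    refine .const_cons (by omega) (by simp) ?_
    refine .store_cons (32 + j) 0 (by omega) (by omega) (by simp [RamState.set_mem]) (by omega)
      (by simp [RamState.set_mem]) (by simp) ?_
    have n5 : 9 ≠ 32 + j ∧ 0 ≠ 32 + j ∧ 16 ≠ 32 + j := by omega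
    refine .nil ⟨by simp [RamState.set_mem, n5, hR.block], by simp [RamState.set_mem, n5, hR.one],
      by simp [RamState.set_mem, n5, h16], fun a ha ha' => ?_, ?_, fun a ha => ?_⟩
    · have h1 := hF a ha ha'
      have h2 : a ≠ 32 + j := by omega
      simp only [List.mem_cons, List.not_mem_nil, or_false, not_or] at ha'
      simp [RamState.set_mem, ha', h2, h1]
    · simp [RamState.set_out, ho]
    · rcases Nat.lt_succ_iff_lt_or_eq.1 ha with ha | rfl
      · have h1 : 32 + a ≠ 17 ∧ 32 + a ≠ 16 ∧ 32 + a ≠ 26 ∧ 32 + a ≠ 27 := by omega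
        simp [RamState.set_mem, hc a ha, h1]
      · have h1 : 32 + a ≠ 17 ∧ 32 + a ≠ 16 := by omega
        simp [RamState.set_mem, h1]

theorem flagsProg_halts (hS : RamSetup S W inp Λ n q K X) {τ : ℕ} (hτ : τ < Λ.B ^ Λ.m)
    {σ : RamState} (hr : RamRegs Λ n q K σ) (h14 : σ.mem 14 = τ) {F : ℕ → ℕ}
    (hF1 : ∀ a, F a ≤ 1) (hF : ∀ a < Λ.m * Λ.B, σ.mem (32 + a) = F a) {c : ℕ} (hc : c ≤ 1)
    (h23 : σ.mem 23 = c) :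
    RamHalts S W inp flagsProg (Λ.m * 13 + 6) (fun σ' => Frame [16, 17, 23, 24, 26, 27] σ σ' ∧
      σ'.out = σ.out ∧
      σ'.mem 23 = (c + ∑ i ∈ Finset.range Λ.m, F (i * Λ.B + Λ.digit τ i) : ℕ)) σ := by
  have hB := hS.B_pos
  have hS1 := hS.mem_le
  have hS2 := hS.mem_lt
  have hT := hS.tuples_lt
  have hbad := hS.bad_lt
  have hmB : Λ.m ≤ Λ.m * Λ.B := Nat.le_mul_of_pos_right _ hB
  have hsum : ∀ j, ∑ i ∈ Finset.range j, F (i * Λ.B + Λ.digit τ i) ≤ j := fun j =>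
    (Finset.sum_le_card_nsmul _ _ 1 fun i _ => hF1 _).trans (by simp)
  refine .const_cons (by omega) (by simp) ?_
  refine .arithNat_cons τ (by omega) (by omega) (by omega)
    (by simp [RamOp.eval, RamState.set_mem, h14]) (by omega) ?_
  refine .call (Λ.m * 13 + 3) 1 (RamHalts.forLoop (m := Λ.m) (T := 10)
    (fun j σ' => Frame [16, 17, 23, 24, 26, 27] σ σ' ∧ σ'.out = σ.out ∧
      σ'.mem 24 = (τ / Λ.B ^ j : ℕ) ∧
      σ'.mem 23 = (c + ∑ i ∈ Finset.range j, F (i * Λ.B + Λ.digit τ i) : ℕ))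
    (by omega) (by omega) (by omega) (by omega) (by omega) (by omega) (by omega) ?_ ?_ ?_)
    (by omega) fun σ₁ h => .nil ⟨h.1, h.2.1, h.2.2.2⟩
  · simp [RamState.set_mem, hr.m]
  · refine ⟨fun a ha => ?_, rfl, ?_, ?_⟩
    · simp only [List.mem_cons, List.not_mem_nil, or_false, not_or] at ha
      simp [RamState.set_mem, ha]
    · simp [RamState.set_mem]
    · simp [RamState.set_mem, h23]
  · rintro j hj σ₁ ⟨hF', ho, h24, h23'⟩ h16
    have hR := hr.of_lowFrame hF'.low (by decide)
    have hlt := Layout.block_lt hj (Layout.digit_lt hB τ j)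
    have hs1 := hsum (j + 1)
    rw [Finset.sum_range_succ] at hs1
    refine .call 5 5 (digitProg_halts hS hj hτ hR.B h16 h24) (by omega) ?_
    rintro σ₂ ⟨hF2, ho2, h24', h26⟩
    have g16 : σ₂.mem 16 = _ := (hF2 16 (by decide)).trans h16
    have g0 : σ₂.mem 0 = _ := (hF2 0 (by decide)).trans hR.one
    have g5 : σ₂.mem 5 = _ := (hF2 5 (by decide)).trans hR.m
    have g23 : σ₂.mem 23 = _ := (hF2 23 (by decide)).trans h23'
    have gF : σ₂.mem (32 + (j * Λ.B + Λ.digit τ j)) = F (j * Λ.B + Λ.digit τ j) := by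
      rw [hF2 _ (by simp only [List.mem_cons, List.not_mem_nil, or_false]; omega),
        hF' _ (by simp only [List.mem_cons, List.not_mem_nil, or_false]; omega), hF _ hlt]
    refine .const_cons (by omega) (by norm_num; omega) ?_
    refine .arithNat_cons (32 + (j * Λ.B + Λ.digit τ j)) (by omega) (by omega) (by omega)
      (by simp [RamOp.eval, RamState.set_mem, h26]; ring) (by omega) ?_
    have n27 : 32 + (j * Λ.B + Λ.digit τ j) ≠ 27 := by omega
    have n26 : 32 + (j * Λ.B + Λ.digit τ j) ≠ 26 := by omega
    refine .load_cons (32 + (j * Λ.B + Λ.digit τ j)) (F (j * Λ.B + Λ.digit τ j))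
      (by omega) (by omega) (by simp [RamState.set_mem]) (by omega)
      (by rw [RamState.set_mem, if_neg n26, RamState.set_mem, if_neg n27, gF])
      (by have := hF1 (j * Λ.B + Λ.digit τ j); rw [Int.natAbs_natCast]; omega) ?_
    refine .arithNat_cons (c + ∑ i ∈ Finset.range (j + 1), F (i * Λ.B + Λ.digit τ i))
      (by omega) (by omega) (by omega)
      (by simp [RamOp.eval, RamState.set_mem, g23, Finset.sum_range_succ]; ring)
      (by rw [Finset.sum_range_succ]; omega) ?_
    refine .nil ⟨by simp [RamState.set_mem, g5], by simp [RamState.set_mem, g0],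
      by simp [RamState.set_mem, g16], fun a ha => ?_, ?_, ?_, ?_⟩
    · have ha' := ha
      simp only [List.mem_cons, List.not_mem_nil, or_false, not_or] at ha'
      have h2 := hF2 a (by simp [ha'])
      have h1 := hF' a ha
      simp [RamState.set_mem, ha', h2, h1]
    · simp [RamState.set_out, ho2, ho]
    · simp [RamState.set_mem, h24']
    · simp [RamState.set_mem]

/-- The residues are nonnegative, so their sum vanishes exactly when all coordinates are divisible
by q; the vector itself need never be stored. -/
theorem residuesProg_halts (hS : RamSetup S W inp Λ n q K X) {k τ : ℕ} (hk : k < K)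
    (hτ : τ < Λ.B ^ Λ.m) {σ : RamState} (hr : RamRegs Λ n q K σ)
    (h14 : σ.mem 14 = τ) (h20 : σ.mem 20 = (k / Λ.P * Λ.size : ℕ)) (h21 : σ.mem 21 = Λ.tgt k)
    {c : ℕ} (hc : c ≤ 1 + Λ.m) (h23 : σ.mem 23 = c) :
    RamHalts S W inp residuesProg (n * (Λ.m * 16 + 19) + 3)
      (fun σ' => Frame [16, 17, 18, 19, 23, 24, 25, 26, 27] σ σ' ∧ σ'.out = σ.out ∧
      σ'.mem 23 = (c + ∑ l ∈ Finset.range n, (ramCoord inp Λ n k τ l % q).toNat : ℕ)) σ := by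
  have hS1 := hS.mem_le
  have hbad := hS.bad_lt
  have hq := hS.q_pos
  have hnq : n ≤ n * q := Nat.le_mul_of_pos_right _ hq
  set G : ℕ → ℕ := fun l => (ramCoord inp Λ n k τ l % q).toNat with hG
  have hGz : ∀ l, (G l : ℤ) = ramCoord inp Λ n k τ l % q := fun l =>
    Int.toNat_of_nonneg (Int.emod_nonneg _ (by omega))
  have hGq : ∀ l, G l < q := fun l => by
    have := Int.emod_lt_of_pos (ramCoord inp Λ n k τ l) (by exact_mod_cast hq : (0 : ℤ) < q)
    rw [← hGz] at this; exact_mod_cast this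
  have hsum : ∀ j ≤ n, ∑ l ∈ Finset.range j, G l ≤ n * q := fun j hj =>
    (Finset.sum_le_card_nsmul _ _ q fun l _ => (hGq l).le).trans (by
      rw [Finset.card_range, smul_eq_mul]; exact Nat.mul_le_mul_right _ hj)
  have hqW : q ≤ n * q := Nat.le_mul_of_pos_left _ hS.n_pos
  refine (RamHalts.forLoop (m := n) (T := Λ.m * 16 + 16)
    (fun j σ' => Frame [16, 17, 18, 19, 23, 24, 25, 26, 27] σ σ' ∧ σ'.out = σ.out ∧
      σ'.mem 23 = (c + ∑ l ∈ Finset.range j, G l : ℕ))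
    (by omega) (by omega) (by omega) (by omega) (by omega) (by omega) (by omega) hr.n ?_ ?_).mono
    le_rfl fun σ' h => h
  · refine ⟨fun a ha => ?_, rfl, ?_⟩
    · simp only [List.mem_cons, List.not_mem_nil, or_false, not_or] at ha
      simp [RamState.set_mem, ha]
    · simp [RamState.set_mem, h23]
  · rintro j hj σ₁ ⟨hF, ho, h23'⟩ h18
    have hR := hr.of_lowFrame hF.low (by decide)
    refine .call (Λ.m * 16 + 13) 3 (coordProg_halts hS hk hτ hj hR
      ((hF 14 (by decide)).trans h14) ((hF 20 (by decide)).trans h20)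
      ((hF 21 (by decide)).trans h21) h18) (by omega) ?_
    rintro σ₂ ⟨hF2, ho2, h25⟩
    have g2 : σ₂.mem 2 = _ := (hF2 2 (by decide)).trans hR.q
    have g1 : σ₂.mem 1 = _ := (hF2 1 (by decide)).trans hR.n
    have g0 : σ₂.mem 0 = _ := (hF2 0 (by decide)).trans hR.one
    have g18 : σ₂.mem 18 = _ := (hF2 18 (by decide)).trans h18
    have g23 : σ₂.mem 23 = _ := (hF2 23 (by decide)).trans h23'
    have hs1 := hsum (j + 1) hj
    refine .arithNat_cons (G j) (by omega) (by omega) (by omega)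
      (by rw [RamOp.eval, h25, g2, hGz]; rfl) (by have := hGq j; omega) ?_
    refine .arithNat_cons (c + ∑ l ∈ Finset.range (j + 1), G l) (by omega) (by omega) (by omega)
      (by simp [RamOp.eval, RamState.set_mem, g23, Finset.sum_range_succ]; ring) (by omega) ?_
    refine .nil ⟨by simp [RamState.set_mem, g1], by simp [RamState.set_mem, g0],
      by simp [RamState.set_mem, g18], fun a ha => ?_, ?_, ?_⟩
    · have ha' := ha
      simp only [List.mem_cons, List.not_mem_nil, or_false, not_or] at ha'
      have h2 := hF2 a (by simp [ha'])
      have h1 := hF a ha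
      simp [RamState.set_mem, ha', h2, h1]
    · simp [RamState.set_out, ho2, ho]
    · simp [RamState.set_mem]

theorem natAbs_ramCoord_le (hS : RamSetup S W inp Λ n q K X) (k τ l : ℕ) :
    (ramCoord inp Λ n k τ l).natAbs < 2 ^ W := by
  refine lt_of_le_of_lt ?_ hS.sum_lt
  rw [ramCoord, Layout.tupleVec, Nat.succ_mul]
  refine (Int.natAbs_sub_le _ _).trans (add_le_add ?_ (hS.entry_le _))
  refine (Int.natAbs_sum_le _ _).trans
    ((Finset.sum_le_card_nsmul _ _ X fun i _ => hS.entry_le _).trans ?_)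
  rw [Finset.card_range, smul_eq_mul]

theorem quotientsProg_halts (hS : RamSetup S W inp Λ n q K X) {k τ : ℕ} (hk : k < K)
    (hτ : τ < Λ.B ^ Λ.m) {σ : RamState} (hr : RamRegs Λ n q K σ)
    (h14 : σ.mem 14 = τ) (h20 : σ.mem 20 = (k / Λ.P * Λ.size : ℕ)) (h21 : σ.mem 21 = Λ.tgt k) :
    RamHalts S W inp quotientsProg (n * (Λ.m * 16 + 19) + 3)
      (fun σ' => Frame [16, 17, 18, 19, 24, 25, 26, 27] σ σ' ∧
      σ'.out = σ.out ++ (List.range n).map fun l => ramCoord inp Λ n k τ l / q) σ := by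
  have hS1 := hS.mem_le
  have hbad := hS.bad_lt
  have hq := hS.q_pos
  have hnq : n ≤ n * q := Nat.le_mul_of_pos_right _ hq
  refine (RamHalts.forLoop (m := n) (T := Λ.m * 16 + 16)
    (fun j σ' => Frame [16, 17, 18, 19, 24, 25, 26, 27] σ σ' ∧
      σ'.out = σ.out ++ (List.range j).map fun l => ramCoord inp Λ n k τ l / q)
    (by omega) (by omega) (by omega) (by omega) (by omega) (by omega) (by omega) hr.n ?_ ?_).mono
    le_rfl fun σ' h => h
  · refine ⟨fun a ha => ?_, by simp [RamState.set_out]⟩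
    simp only [List.mem_cons, List.not_mem_nil, or_false, not_or] at ha
    simp [RamState.set_mem, ha]
  · rintro j hj σ₁ ⟨hF, ho⟩ h18
    have hR := hr.of_lowFrame hF.low (by decide)
    refine .call (Λ.m * 16 + 13) 3 (coordProg_halts hS hk hτ hj hR
      ((hF 14 (by decide)).trans h14) ((hF 20 (by decide)).trans h20)
      ((hF 21 (by decide)).trans h21) h18) (by omega) ?_
    rintro σ₂ ⟨hF2, ho2, h25⟩
    have g2 : σ₂.mem 2 = _ := (hF2 2 (by decide)).trans hR.q
    have g1 : σ₂.mem 1 = _ := (hF2 1 (by decide)).trans hR.n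
    have g0 : σ₂.mem 0 = _ := (hF2 0 (by decide)).trans hR.one
    have g18 : σ₂.mem 18 = _ := (hF2 18 (by decide)).trans h18
    refine .arith_cons (ramCoord inp Λ n k τ j / q) (by omega) (by omega) (by omega)
      (by rw [RamOp.eval, h25, g2]; rfl)
      (lt_of_le_of_lt (Int.natAbs_ediv_le_natAbs _ _) (natAbs_ramCoord_le hS k τ j)) ?_
    refine .emit_cons (by omega) ?_
    refine .nil ⟨by simp [RamState.set_mem, g1], by simp [RamState.set_mem, g0],
      by simp [RamState.set_mem, g18], fun a ha => ?_, ?_⟩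
    · have ha' := ha
      simp only [List.mem_cons, List.not_mem_nil, or_false, not_or] at ha'
      have h2 := hF2 a (by simp [ha'])
      have h1 := hF a ha
      simp [RamState.set_mem, ha', h2, h1]
    · simp [RamState.set_out, RamState.set_mem, ho2, ho, List.range_succ]

open Classical in
theorem markProg_halts (hS : RamSetup S W inp Λ n q K X) {τ : ℕ} (hτ : τ < Λ.B ^ Λ.m)
    {σ : RamState} (hr : RamRegs Λ n q K σ) (h14 : σ.mem 14 = τ) {U : ℕ → Prop}
    (hU : ∀ a < Λ.m * Λ.B, σ.mem (32 + a) = ((if U a then 1 else 0 : ℕ) : ℤ)) :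
    RamHalts S W inp markProg (Λ.m * 12 + 6) (fun σ' => LowFrame [16, 17, 24, 26, 27] σ σ' ∧
      σ'.out = σ.out ∧ ∀ a < Λ.m * Λ.B, σ'.mem (32 + a) =
        ((if U a ∨ ∃ i < Λ.m, i * Λ.B + Λ.digit τ i = a then 1 else 0 : ℕ) : ℤ)) σ := by
  have hB := hS.B_pos
  have hS1 := hS.mem_le
  have hS2 := hS.mem_lt
  have hT := hS.tuples_lt
  have hmB : Λ.m ≤ Λ.m * Λ.B := Nat.le_mul_of_pos_right _ hB
  refine .const_cons (by omega) (by simp) ?_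
  refine .arithNat_cons τ (by omega) (by omega) (by omega)
    (by simp [RamOp.eval, RamState.set_mem, h14]) (by omega) ?_
  refine .call (Λ.m * 12 + 3) 1 (RamHalts.forLoop (m := Λ.m) (T := 9)
    (fun j σ' => LowFrame [16, 17, 24, 26, 27] σ σ' ∧ σ'.out = σ.out ∧
      σ'.mem 24 = (τ / Λ.B ^ j : ℕ) ∧ ∀ a < Λ.m * Λ.B, σ'.mem (32 + a) =
        ((if U a ∨ ∃ i < j, i * Λ.B + Λ.digit τ i = a then 1 else 0 : ℕ) : ℤ))
    (by omega) (by omega) (by omega) (by omega) (by omega) (by omega) (by omega) ?_ ?_ ?_)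
    (by omega) fun σ₁ h => .nil ⟨h.1, h.2.1, h.2.2.2⟩
  · simp [RamState.set_mem, hr.m]
  · refine ⟨fun a _ ha => ?_, rfl, ?_, fun a ha => ?_⟩
    · simp only [List.mem_cons, List.not_mem_nil, or_false, not_or] at ha
      simp [RamState.set_mem, ha]
    · simp [RamState.set_mem]
    · have h1 : 32 + a ≠ 17 ∧ 32 + a ≠ 16 ∧ 32 + a ≠ 24 ∧ 32 + a ≠ 26 := by omega
      simp [RamState.set_mem, h1, hU a ha]
  · rintro j hj σ₁ ⟨hF', ho, h24, hfl⟩ h16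
    have hR := hr.of_lowFrame hF' (by decide)
    have hlt := Layout.block_lt hj (Layout.digit_lt hB τ j)
    refine .call 5 4 (digitProg_halts hS hj hτ hR.B h16 h24) (by omega) ?_
    rintro σ₂ ⟨hF2, ho2, h24', h26⟩
    have g16 : σ₂.mem 16 = _ := (hF2 16 (by decide)).trans h16
    have g0 : σ₂.mem 0 = _ := (hF2 0 (by decide)).trans hR.one
    have g5 : σ₂.mem 5 = _ := (hF2 5 (by decide)).trans hR.m
    set a₀ := j * Λ.B + Λ.digit τ j with ha₀
    refine .const_cons (by omega) (by norm_num; omega) ?_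
    refine .arithNat_cons (32 + a₀) (by omega) (by omega) (by omega)
      (by simp [RamOp.eval, RamState.set_mem, h26]; ring) (by omega) ?_
    refine .store_cons (32 + a₀) 1
      (by omega) (by omega) (by simp [RamState.set_mem]) (by omega)
      (by simp [RamState.set_mem, g0]) (by rw [Int.natAbs_one]; omega) ?_
    have n5 : 5 ≠ 32 + a₀ ∧ 0 ≠ 32 + a₀ ∧ 16 ≠ 32 + a₀ ∧ 24 ≠ 32 + a₀ := by omega
    refine .nil ⟨by simp [RamState.set_mem, g5, n5], by simp [RamState.set_mem, g0, n5],
      by simp [RamState.set_mem, g16, n5], fun a ha32 ha => ?_, ?_, ?_, fun a ha => ?_⟩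
    · have ha' := ha
      simp only [List.mem_cons, List.not_mem_nil, or_false, not_or] at ha'
      have h2 := hF2 a (by simp [ha'])
      have h1 := hF' a ha32 ha
      have h3 : a ≠ 32 + a₀ := by omega
      simp [RamState.set_mem, ha', h2, h1, h3]
    · simp [RamState.set_out, ho2, ho]
    · simp [RamState.set_mem, h24', n5]
    · have h1 : 32 + a ≠ 17 ∧ 32 + a ≠ 16 ∧ 32 + a ≠ 26 ∧ 32 + a ≠ 27 := by omega
      -- The store hits exactly one flag; all other flags keep the meaning they had before this
      -- round.
      by_cases he : a = a₀
      · have h2 : U a ∨ ∃ i < j + 1, i * Λ.B + Λ.digit τ i = a := .inr ⟨j, by omega, he.symm⟩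
        rw [if_pos h2]
        rw [he] at h1
        simp [RamState.set_mem, h1, he]
      · have h2 : (U a ∨ ∃ i < j + 1, i * Λ.B + Λ.digit τ i = a) ↔
            (U a ∨ ∃ i < j, i * Λ.B + Λ.digit τ i = a) := by
          refine or_congr_right ⟨?_, fun ⟨i, hi, h⟩ => ⟨i, by omega, h⟩⟩
          rintro ⟨i, hi, h⟩
          rcases Nat.lt_succ_iff_lt_or_eq.1 hi with hi | rfl
          · exact ⟨i, hi, h⟩
          · exact absurd h.symm he
        have h3 := hF2 (32 + a) (by simp only [List.mem_cons, List.not_mem_nil, or_false]; omega)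
        simp only [h2]
        rw [← hfl a ha, ← h3]
        simp [RamState.set_mem, h1, he]

end RamMain

/-! ### The machine follows the greedy algorithm -/

section RamGreedy

variable {S W : ℕ} {inp : List ℤ} {Λ : Layout} {n q K X : ℕ}

theorem ramOut_concat (ch : List (ℕ × ℕ)) (k τ : ℕ) :
    ramOut inp Λ n q (ch ++ [(k, τ)]) =
      ramOut inp Λ n q ch ++ (List.range n).map fun l => ramCoord inp Λ n k τ l / q := by
  simp [ramOut]

theorem Layout.used_concat (ch : List (ℕ × ℕ)) (k τ a : ℕ) :
    Λ.Used (ch ++ [(k, τ)]) k a ↔ Λ.Used ch k a ∨ ∃ i < Λ.m, i * Λ.B + Λ.digit τ i = a := by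
  simp only [Layout.Used, List.mem_append, List.mem_singleton]
  constructor
  · rintro ⟨p, hp | rfl, h, h'⟩
    · exact .inl ⟨p, hp, h, h'⟩
    · exact .inr h'
  · rintro (⟨p, hp, h⟩ | h)
    · exact ⟨p, .inl hp, h⟩
    · exact ⟨(k, τ), .inr rfl, rfl, h⟩

/-- Register 23 accumulates nonnegative obstructions: the target is already served, a sample is
already used, a residue is nonzero. It vanishes exactly when the greedy step accepts. -/
theorem tupleProg_halts (hS : RamSetup S W inp Λ n q K X) {k τ : ℕ} (hk : k < K)
    (hτ : τ < Λ.B ^ Λ.m) {ch : List (ℕ × ℕ)} {σ : RamState}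
    (hM : RamMain inp Λ n q K ch k σ) (h14 : σ.mem 14 = τ) :
    RamHalts S W inp tupleProg (2 * (n * (Λ.m * 16 + 19)) + Λ.m * 25 + 24)
      (fun σ' => RamMain inp Λ n q K (Λ.step (RamOk inp Λ n q) ch k τ) k σ' ∧ σ'.mem 14 = τ) σ := by
  classical
  have hS1 := hS.mem_le
  have hS2 := hS.mem_lt
  have hq := hS.q_pos
  set c : ℕ := if ∃ p ∈ ch, p.1 = k then 1 else 0 with hc
  have hc1 : c ≤ 1 := by rw [hc]; split_ifs <;> omega
  set F : ℕ → ℕ := fun a => if Λ.Used ch k a then 1 else 0 with hF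
  have hF1 : ∀ a, F a ≤ 1 := fun a => by simp only [hF]; split_ifs <;> omega
  refine .const_cons (by omega) (by simp) ?_
  refine .arithNat_cons c (by omega) (by omega) (by omega)
    (by simp [RamOp.eval, RamState.set_mem, hM.found, hc]) (by omega) ?_
  have hM1 : RamMain inp Λ n q K ch k ((σ.set 26 0).set 23 c) :=
    hM.of_frame (l := [23, 26]) (fun a ha => by
      simp only [List.mem_cons, List.not_mem_nil, or_false, not_or] at ha
      simp [RamState.set_mem, ha]) rfl (by decide)
  refine .call (Λ.m * 13 + 6) (2 * (n * (Λ.m * 16 + 19)) + Λ.m * 12 + 16)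
    (flagsProg_halts hS hτ hM1.regs (by simp [RamState.set_mem, h14]) hF1
      (fun a ha => hM1.flag a ha) hc1 (by simp [RamState.set_mem])) (by omega) ?_
  rintro σ₁ ⟨hF₁, ho₁, h23⟩
  set c' : ℕ := c + ∑ i ∈ Finset.range Λ.m, F (i * Λ.B + Λ.digit τ i) with hc'
  have hc1' : c' ≤ 1 + Λ.m := by
    refine add_le_add hc1 ((Finset.sum_le_card_nsmul _ _ 1 fun i _ => hF1 _).trans (by simp))
  have hM2 := hM1.of_frame hF₁ ho₁ (by decide)
  have h14₁ : σ₁.mem 14 = τ := by rw [hF₁ 14 (by decide)]; simp [RamState.set_mem, h14]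
  refine .call (n * (Λ.m * 16 + 19) + 3) (n * (Λ.m * 16 + 19) + Λ.m * 12 + 13)
    (residuesProg_halts hS hk hτ hM2.regs h14₁ hM2.base hM2.tgt hc1' h23) (by omega) ?_
  rintro σ₂ ⟨hF₂, ho₂, h23'⟩
  have hM3 := hM2.of_frame hF₂ ho₂ (by decide)
  have h14₂ : σ₂.mem 14 = τ := (hF₂ 14 (by decide)).trans h14₁
  set c'' : ℕ := c' + ∑ l ∈ Finset.range n, (ramCoord inp Λ n k τ l % q).toNat with hc''
  have hiff : ¬ 0 < σ₂.mem 23 ↔ RamOk inp Λ n q k τ ∧ ¬ Λ.Conflict ch k τ := by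
    rw [h23', Layout.conflict_iff hS.B_pos]
    have h0 : ¬ (0 : ℤ) < (c'' : ℕ) ↔ c'' = 0 := by omega
    rw [h0, hc'', hc', Nat.add_eq_zero_iff, Nat.add_eq_zero_iff, Finset.sum_eq_zero_iff,
      Finset.sum_eq_zero_iff, and_comm]
    refine and_congr (forall_congr' fun l => ?_) ?_
    · rw [Finset.mem_range]
      refine imp_congr_right fun _ => ?_
      have := Int.emod_nonneg (ramCoord inp Λ n k τ l) (by omega : (q : ℤ) ≠ 0)
      rw [Int.dvd_iff_emod_eq_zero]
      omega
    · rw [not_or, hc]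
      refine and_congr (by simp only [ite_eq_right_iff, one_ne_zero, imp_false]) ?_
      rw [not_exists]
      refine forall_congr' fun i => ?_
      rw [Finset.mem_range, not_and]
      refine imp_congr_right fun _ => by simp [hF]
  refine .call (n * (Λ.m * 16 + 19) + Λ.m * 12 + 12) 1 (RamHalts.ite (T := n * (Λ.m * 16 + 19) +
    Λ.m * 12 + 11) (by omega) (fun h => ?_) fun h => ?_) (by omega) fun σ' h => .nil h
  · rw [Layout.step, if_neg fun h' => hiff.2 h' h]
    exact (RamHalts.skip ⟨hM3, h14₂⟩).mono (by omega) fun _ h => h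
  · rw [Layout.step, if_pos (hiff.1 h)]
    refine .const_cons (by omega) (by rw [Int.natAbs_one]; omega) ?_
    have e : ∀ a, a ≠ 22 → (σ₂.set 22 1).mem a = σ₂.mem a := fun a ha => by
      simp [RamState.set_mem, ha]
    have hR : RamRegs Λ n q K (σ₂.set 22 1) := hM3.regs.of_lowFrame (l := [22])
      (fun a _ ha => e a (by simpa using ha)) (by decide)
    refine .call (n * (Λ.m * 16 + 19) + 3) (Λ.m * 12 + 7)
      (quotientsProg_halts hS hk hτ hR ((e 14 (by omega)).trans h14₂)
        ((e 20 (by omega)).trans hM3.base) ((e 21 (by omega)).trans hM3.tgt)) (by omega) ?_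
    rintro σ₃ ⟨hF₃, ho₃⟩
    have hR3 := hR.of_lowFrame hF₃.low (by decide)
    have e3 : ∀ a, a ∉ [16, 17, 18, 19, 22, 24, 25, 26, 27] → σ₃.mem a = σ₂.mem a := fun a ha => by
      simp only [List.mem_cons, List.not_mem_nil, or_false, not_or] at ha
      rw [hF₃ a (by simp [ha]), e a (by omega)]
    refine .call (Λ.m * 12 + 6) 1 (markProg_halts hS hτ hR3 ((e3 14 (by decide)).trans h14₂)
      (U := Λ.Used ch k) fun a ha => by
        rw [e3 _ (by simp only [List.mem_cons, List.not_mem_nil, or_false]; omega), hM3.flag a ha])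
      (by omega) ?_
    rintro σ₄ ⟨hF₄, ho₄, hfl⟩
    refine .nil ⟨⟨hR3.of_lowFrame hF₄ (by decide), ?_, ?_, ?_, ?_, fun a ha => ?_, ?_⟩, ?_⟩
    · rw [hF₄ 12 (by decide) (by decide), e3 12 (by decide), hM3.target]
    · rw [hF₄ 20 (by decide) (by decide), e3 20 (by decide), hM3.base]
    · rw [hF₄ 21 (by decide) (by decide), e3 21 (by decide), hM3.tgt]
    · rw [hF₄ 22 (by decide) (by decide), hF₃ 22 (by decide), if_pos ⟨(k, τ), by simp, rfl⟩]
      simp [RamState.set_mem]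
    · rw [hfl a ha]; simp only [Layout.used_concat]
    · rw [ho₄, ho₃, RamState.set_out, hM3.out, ramOut_concat]
    · rw [hF₄ 14 (by decide) (by decide), e3 14 (by decide), h14₂]

/-- A bound for the time to process one target. -/
def targetTime (Λ : Layout) (n : ℕ) : ℕ :=
  Λ.B ^ Λ.m * (2 * (n * (Λ.m * 16 + 19)) + Λ.m * 25 + 27) + Λ.m * Λ.B * 8 + 15

-- The flags describe only the current group. They are assumed correct only inside a group; at its
-- first target they are cleared, which is right because no earlier target belongs to the new group.
open Classical in
theorem targetProg_halts (hS : RamSetup S W inp Λ n q K X) {k : ℕ} (hk : k < K)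
    {ch : List (ℕ × ℕ)} {σ : RamState} (hr : RamRegs Λ n q K σ) (h12 : σ.mem 12 = k)
    (hch : ∀ p ∈ ch, p.1 < k) (ho : σ.out = ramOut inp Λ n q ch)
    (hflag : k % Λ.P ≠ 0 → ∀ a < Λ.m * Λ.B,
      σ.mem (32 + a) = ((if Λ.Used ch k a then 1 else 0 : ℕ) : ℤ)) :
    RamHalts S W inp targetProg (targetTime Λ n)
      (RamMain inp Λ n q K (Λ.tryTuples (RamOk inp Λ n q) ch k (Λ.B ^ Λ.m)) k) σ := by
  have hS1 := hS.mem_le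
  have hS2 := hS.mem_lt
  have hT := hS.tuples_lt
  have hlen := hS.length k hk
  have hlW := hS.length_lt
  have hpos := hS.n_pos
  have htl := Layout.tgt_lt (Λ := Λ) (k := k) le_rfl hS.P_pos
  have hKW := hS.K_lt
  have hle : (k / Λ.P + 1) * Λ.size ≤ (k / Λ.P + 1) * Λ.size * n := Nat.le_mul_of_pos_right _ hpos
  rw [Layout.tgt] at htl
  have hdk : k / Λ.P ≤ k := Nat.div_le_self _ _
  have hmk : k % Λ.P ≤ k := Nat.mod_le _ _
  rw [targetTime]
  refine .arithNat_cons (k / Λ.P) (by omega) (by omega) (by omega)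
    (by rw [RamOp.eval, h12, hr.P]; push_cast; rfl) (by omega) ?_
  refine .arithNat_cons (k / Λ.P * Λ.size) (by omega) (by omega) (by omega)
    (by simp [RamOp.eval, RamState.set_mem, hr.size]) (by omega) ?_
  refine .arithNat_cons (k % Λ.P) (by omega) (by omega) (by omega)
    (by simp [RamOp.eval, RamState.set_mem, h12, hr.P]) (by omega) ?_
  refine .arithNat_cons (k / Λ.P * Λ.size + Λ.m * Λ.B) (by omega) (by omega) (by omega)
    (by simp [RamOp.eval, RamState.set_mem, hr.block]) (by omega) ?_
  refine .arithNat_cons (Λ.tgt k) (by omega) (by omega) (by omega)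
    (by simp [RamOp.eval, RamState.set_mem, Layout.tgt, add_assoc])
    (by rw [Layout.tgt]; omega) ?_
  set σ₁ := ((((σ.set 26 ((k / Λ.P : ℕ) : ℤ)).set 20 ((k / Λ.P * Λ.size : ℕ) : ℤ)).set 26
    ((k % Λ.P : ℕ) : ℤ)).set 21 ((k / Λ.P * Λ.size + Λ.m * Λ.B : ℕ) : ℤ)).set 21 (Λ.tgt k : ℤ)
    with hσ₁
  have hF₁ : Frame [20, 21, 26] σ σ₁ := fun a ha => by
    simp only [List.mem_cons, List.not_mem_nil, or_false, not_or] at ha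
    simp [hσ₁, RamState.set_mem, ha]
  have hR₁ := hr.of_lowFrame hF₁.low (by decide)
  have h26 : σ₁.mem 26 = (k % Λ.P : ℕ) := by simp [hσ₁, RamState.set_mem]
  have h20 : σ₁.mem 20 = (k / Λ.P * Λ.size : ℕ) := by simp [hσ₁, RamState.set_mem]
  have h21 : σ₁.mem 21 = Λ.tgt k := by simp [hσ₁, RamState.set_mem]
  have ho₁ : σ₁.out = σ.out := rfl
  refine .call (Λ.m * Λ.B * 8 + 4)
    (Λ.B ^ Λ.m * (2 * (n * (Λ.m * 16 + 19)) + Λ.m * 25 + 27) + 5)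
    (Q' := fun σ' => LowFrame [16, 17, 26, 27] σ₁ σ' ∧ σ'.out = σ₁.out ∧
      ∀ a < Λ.m * Λ.B, σ'.mem (32 + a) = ((if Λ.Used ch k a then 1 else 0 : ℕ) : ℤ))
    (.ite (T := Λ.m * Λ.B * 8 + 3) (by omega) (fun h => ?_) fun h => ?_) (by omega) ?_
  · refine (RamHalts.skip ⟨fun _ _ _ => rfl, rfl, fun a ha => ?_⟩).mono (by omega) fun _ h => h
    rw [hF₁ (32 + a) (by simp only [List.mem_cons, List.not_mem_nil, or_false]; omega)]
    exact hflag (by rw [h26] at h; omega) a ha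
  · refine (clearProg_halts hS hR₁).mono le_rfl fun σ' h' => ⟨h'.1, h'.2.1, fun a ha => ?_⟩
    rw [h'.2.2 a ha, if_neg]; · rfl
    rintro ⟨p, hp, hg, -⟩
    have h1 : k % Λ.P = 0 := by rw [h26] at h; omega
    -- A pair of the new group would have its target at or after k, while all accepted targets come
    -- before k.
    have h2 : p.1 / Λ.P * Λ.P ≤ p.1 := Nat.div_mul_le_self _ _
    rw [hg, Nat.div_mul_cancel (Nat.dvd_of_mod_eq_zero h1)] at h2
    exact absurd (hch p hp) (by omega)
  rintro σ₂ ⟨hF₂, ho₂, hfl⟩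
  have e : ∀ a < 32, a ∉ [16, 17, 22, 26, 27] → (σ₂.set 22 0).mem a = σ₁.mem a := fun a h ha => by
    simp only [List.mem_cons, List.not_mem_nil, or_false, not_or] at ha
    rw [RamState.set_mem, if_neg (by omega), hF₂ a h (by simp [ha])]
  refine .const_cons (by omega) (by simp) ?_
  have hM : RamMain inp Λ n q K ch k (σ₂.set 22 0) := by
    refine ⟨hR₁.of_lowFrame (l := [16, 17, 22, 26, 27]) (fun a h ha => e a h ha) (by decide),
      ?_, ?_, ?_, ?_, fun a ha => ?_, ?_⟩
    · rw [e 12 (by decide) (by decide), hF₁ 12 (by decide), h12]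
    · rw [e 20 (by decide) (by decide), h20]
    · rw [e 21 (by decide) (by decide), h21]
    · rw [if_neg]
      · simp [RamState.set_mem]
      · rintro ⟨p, hp, h⟩
        exact absurd (hch p hp) (by omega)
    · rw [RamState.set_mem, if_neg (by omega), hfl a ha]
    · rw [RamState.set_out, ho₂, ho₁, ho]
  refine .call (Λ.B ^ Λ.m * (2 * (n * (Λ.m * 16 + 19)) + Λ.m * 25 + 27) + 3) 1
    (RamHalts.forLoop (m := Λ.B ^ Λ.m) (T := 2 * (n * (Λ.m * 16 + 19)) + Λ.m * 25 + 24)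
      (fun t => RamMain inp Λ n q K (Λ.tryTuples (RamOk inp Λ n q) ch k t) k)
      (by omega) (by omega) (by omega) (by omega) (by omega) (by omega) hT hM.regs.tuples ?_ ?_)
    (by omega) fun σ' h => .nil h
  · exact hM.of_frame (l := [14, 15]) (fun a ha => by
      simp only [List.mem_cons, List.not_mem_nil, or_false, not_or] at ha
      simp [RamState.set_mem, ha]) rfl (by decide)
  · intro t ht σ₃ hM₃ h14
    refine (tupleProg_halts hS hk ht hM₃ h14).mono le_rfl fun σ₄ ⟨hM₄, h14'⟩ => ?_
    refine ⟨hM₄.regs.tuples, hM₄.regs.one, h14', ?_⟩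
    exact hM₄.of_frame (l := [14, 15]) (fun a ha => by
      simp only [List.mem_cons, List.not_mem_nil, or_false, not_or] at ha
      simp [RamState.set_mem, ha]) rfl (by decide)

/-- The greedy algorithm, once the registers are set up. -/
def greedyProg : RamProg := .forLoop 12 13 8 0 targetProg

theorem greedyProg_halts (hS : RamSetup S W inp Λ n q K X) {σ : RamState}
    (hr : RamRegs Λ n q K σ) (ho : σ.out = []) :
    RamHalts S W inp greedyProg (K * (targetTime Λ n + 3) + 3)
      (fun σ' => σ'.out = ramOut inp Λ n q (Λ.greedy (RamOk inp Λ n q) K)) σ := by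
  classical
  have hS1 := hS.mem_le
  have hfr : ∀ {σ : RamState} {v w : ℤ}, Frame [12, 13] σ ((σ.set 12 v).set 13 w) := by
    intro σ v w a ha
    simp only [List.mem_cons, List.not_mem_nil, or_false, not_or] at ha
    simp [RamState.set_mem, ha]
  refine (RamHalts.forLoop (m := K) (T := targetTime Λ n)
    (fun k σ' => RamRegs Λ n q K σ' ∧
      σ'.out = ramOut inp Λ n q (Λ.greedy (RamOk inp Λ n q) k) ∧
      (k % Λ.P ≠ 0 → ∀ a < Λ.m * Λ.B, σ'.mem (32 + a) =
        ((if Λ.Used (Λ.greedy (RamOk inp Λ n q) k) k a then 1 else 0 : ℕ) : ℤ)))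
    (by omega) (by omega) (by omega) (by omega) (by omega) (by omega) hS.K_lt hr.K ?_ ?_).mono
    le_rfl fun σ' h => h.2.1
  · exact ⟨hr.of_lowFrame hfr.low (by decide), ho, fun h => absurd (Nat.zero_mod _) h⟩
  · rintro k hk σ₁ ⟨hr₁, ho₁, hfl⟩ h12
    refine (targetProg_halts hS hk hr₁ h12 (Layout.valid_greedy _ k).2 ho₁ hfl).mono le_rfl
      fun σ₂ hM => ⟨hM.regs.K, hM.regs.one, hM.target,
        hM.regs.of_lowFrame hfr.low (by decide), hM.out, fun h a ha => ?_⟩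
    -- Unless a group has just been completed, the next target shares the group and the flags carry
    -- over.
    have h1 : (k + 1) / Λ.P = k / Λ.P := by
      rw [Nat.succ_div, if_neg fun h' => h (Nat.mod_eq_zero_of_dvd h'), add_zero]
    rw [hfr _ (by simp only [List.mem_cons, List.not_mem_nil, or_false]; omega), hM.flag a ha]
    have hu : Λ.Used (Λ.greedy (RamOk inp Λ n q) (k + 1)) (k + 1) a ↔
        Λ.Used (Λ.greedy (RamOk inp Λ n q) (k + 1)) k a := by simp only [Layout.Used, h1]
    simp only [hu]
    rfl

end RamGreedy

/-! ### Computing the parameters on the machine -/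

section RamSetupProgram

/-- `r` is the least natural number with `A ≤ r ^ d`. -/
def IsCeilRoot (d A r : ℕ) : Prop := A ≤ r ^ d ∧ ∀ x < r, x ^ d < A

/-- `M[dst] := M[base] ^ M[lim]`. -/
def powProg (dst base lim : ℕ) : RamProg :=
  .chain [.const dst 1, .forLoop 16 17 lim 0 (.arith .mul dst dst base)]

/-- `M[dst]` becomes the least `r` such that `M[25] ≤ r ^ M[3]`. -/
def rootProg (dst : ℕ) : RamProg :=
  .chain [.const dst 0, .const 26 0, .arith .add 19 25 26,
    .loop 19 (.chain [.arith .add dst dst 0, powProg 24 dst 3, .arith .sub 19 25 24])]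

/-- The layout used by the algorithm for the dimension `d`. -/
def paramLayout (d P : ℕ) : Layout := ⟨8 * d, 13 * d * P, P⟩

/-- The whole program. -/
def samplerProg : RamProg :=
  .chain [.const 0 1, .const 26 0, .read 1 26, .const 26 1, .read 2 26, .const 26 2, .read 3 26,
    .const 26 3, .read 4 26, powProg 25 2 1, rootProg 6, powProg 27 4 3, .arith .mul 25 25 27,
    rootProg 8, .const 26 8, .arith .mul 5 26 3, .const 26 13, .arith .mul 7 26 3,
    .arith .mul 7 7 6, .arith .mul 9 5 7, .arith .add 10 9 6, powProg 11 7 5, greedyProg]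

variable {S W : ℕ} {inp : List ℤ}

theorem powProg_halts {dst base lim x m : ℕ} (hdst : dst < 32 ∧ dst ≠ 0 ∧ dst ≠ 16 ∧ dst ≠ 17)
    (hbase : base < 32 ∧ base ≠ dst ∧ base ≠ 16 ∧ base ≠ 17)
    (hlim : lim < 32 ∧ lim ≠ dst ∧ lim ≠ 16 ∧ lim ≠ 17) (hS : 32 ≤ S) {σ : RamState}
    (h0 : σ.mem 0 = 1) (hx : σ.mem base = x) (hm : σ.mem lim = m) (hxpos : 0 < x)
    (hmW : m < 2 ^ W) (hxW : x ^ m < 2 ^ W) :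
    RamHalts S W inp (powProg dst base lim) (m * 4 + 5)
      (fun σ' => Frame [dst, 16, 17] σ σ' ∧ σ'.out = σ.out ∧ σ'.mem dst = (x ^ m : ℕ)) σ := by
  obtain ⟨hd, hd0, hd16, hd17⟩ := hdst
  obtain ⟨hb, hbd, hb16, hb17⟩ := hbase
  obtain ⟨hl, hld, hl16, hl17⟩ := hlim
  have h1W : 1 < 2 ^ W := lt_of_le_of_lt (Nat.one_le_pow _ _ hxpos) hxW
  refine .const_cons (by omega) (by rw [Int.natAbs_one]; omega) ?_
  refine .call (m * 4 + 3) 1 (RamHalts.forLoop (m := m) (T := 1)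
    (fun j σ' => Frame [dst, 16, 17] σ σ' ∧ σ'.out = σ.out ∧ σ'.mem dst = (x ^ j : ℕ))
    (by omega) (by omega) (by omega) (by omega) (by omega) hl16 hmW
    (by rw [RamState.set_mem, if_neg hld, hm]) ?_ ?_) (by omega) fun σ' h => .nil h
  · refine ⟨fun a ha => ?_, rfl, ?_⟩
    · simp only [List.mem_cons, List.not_mem_nil, or_false, not_or] at ha
      simp [RamState.set_mem, ha]
    · simp [RamState.set_mem, hd16, hd17]
  · rintro j hj σ₁ ⟨hF, ho, hp⟩ h16
    have e : ∀ a, a ≠ dst → a ≠ 16 → a ≠ 17 → σ₁.mem a = σ.mem a := fun a h1 h2 h3 =>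
      hF a (by simp [h1, h2, h3])
    refine .arith (x ^ (j + 1) : ℕ) (by omega) (by omega) (by omega) ?_ ?_ ⟨?_, ?_, ?_, ?_, ?_, ?_⟩
    · rw [RamOp.eval, hp, e _ hbd hb16 hb17, hx, pow_succ]; push_cast; rfl
    · rw [Int.natAbs_natCast]
      exact lt_of_le_of_lt (Nat.pow_le_pow_right hxpos hj) hxW
    · rw [RamState.set_mem, if_neg hld, e _ hld hl16 hl17, hm]
    · rw [RamState.set_mem, if_neg hd0.symm, e _ hd0.symm (by omega) (by omega), h0]
    · rw [RamState.set_mem, if_neg hd16.symm, h16]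
    · intro a ha
      have h1 := hF a ha
      simp only [List.mem_cons, List.not_mem_nil, or_false, not_or] at ha
      simp [RamState.set_mem, ha, h1]
    · rw [RamState.set_out, RamState.set_out, RamState.set_out, ho]
    · simp [RamState.set_mem, hd16, hd17]

/-- Linear search: register 19 holds A - x^d, which is positive exactly until x reaches the root.
The number of rounds is the root itself, negligible against the main loop. -/
theorem rootProg_halts {dst d A r : ℕ}
    (hdst : dst < 32 ∧ dst ≠ 0 ∧ dst ≠ 3 ∧ dst ≠ 16 ∧ dst ≠ 17 ∧ dst ≠ 19 ∧ dst ≠ 24 ∧ dst ≠ 25 ∧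
      dst ≠ 26) (hS : 32 ≤ S) {σ : RamState} (h0 : σ.mem 0 = 1) (h3 : σ.mem 3 = d)
    (h25 : σ.mem 25 = A) (hd : 0 < d) (hr : IsCeilRoot d A r) (hdW : d < 2 ^ W)
    (hAW : A < 2 ^ W) (hrW : r ^ d < 2 ^ W) :
    RamHalts S W inp (rootProg dst) (r * (d * 4 + 9) + 5)
      (fun σ' => Frame [dst, 16, 17, 19, 24, 26] σ σ' ∧ σ'.out = σ.out ∧ σ'.mem dst = r) σ := by
  obtain ⟨hd32, hd0, hd3, hd16, hd17, hd19, hd24, hd25, hd26⟩ := hdst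
  refine .const_cons (by omega) (by simp) ?_
  refine .const_cons (by omega) (by simp) ?_
  refine .arithNat_cons A (by omega) (by omega) (by omega)
    (by simp [RamOp.eval, RamState.set_mem, hd25.symm, h25]) hAW ?_
  refine .call (r * (d * 4 + 9) + 1) 1 ((RamHalts.loop (a := 19) (S := S) (W := W) (inp := inp) (T := d * 4 + 8) (by omega)
    -- Here j counts the rounds still to come, so the candidate is r - j. At the start the candidate
    -- is 0, and 0^d = 0 since d > 0.
    (fun j σ' => Frame [dst, 16, 17, 19, 24, 26] σ σ' ∧ σ'.out = σ.out ∧ j ≤ r ∧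
      σ'.mem dst = (r - j : ℕ) ∧ σ'.mem 19 = (A : ℤ) - ((r - j) ^ d : ℕ)) ?_ ?_ r
    ⟨fun a ha => ?_, rfl, le_rfl, ?_, ?_⟩)) (by omega)
    fun σ' h => .nil ⟨h.1, h.2.1, by simpa using h.2.2.2.1⟩
  · rintro σ₁ ⟨-, -, -, -, h⟩
    have h1 := hr.1
    rw [h, Nat.sub_zero]
    have : (A : ℤ) ≤ (r ^ d : ℕ) := by exact_mod_cast h1
    omega
  · rintro j σ₁ ⟨hF, ho, hj, hx, h19⟩
    have e : ∀ a, a ∉ [dst, 16, 17, 19, 24, 26] → σ₁.mem a = σ.mem a := hF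
    have g0 : σ₁.mem 0 = 1 := by rw [e 0 (by simp [hd0.symm]), h0]
    have g3 : σ₁.mem 3 = d := by rw [e 3 (by simp [hd3.symm]), h3]
    have g25 : σ₁.mem 25 = A := by rw [e 25 (by simp [hd25.symm]), h25]
    have e1 : r - (j + 1) + 1 = r - j := by omega
    have hle : (r - j) ^ d ≤ r ^ d := Nat.pow_le_pow_left (Nat.sub_le _ _) _
    have hself : r - j ≤ (r - j) ^ d := Nat.le_self_pow hd.ne' _
    refine ⟨?_, ?_⟩
    · have h1 := hr.2 (r - (j + 1)) (by omega)
      rw [h19]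
      have : (((r - (j + 1)) ^ d : ℕ) : ℤ) < A := by exact_mod_cast h1
      omega
    refine .arithNat_cons (r - j) (by omega) (by omega) (by omega)
      (by rw [RamOp.eval, hx, g0, ← e1]; push_cast; rfl) (by omega) ?_
    refine .call (d * 4 + 5) 2 (powProg_halts (x := r - j) (m := d)
      (by omega) (by omega) (by omega) hS (by simp [RamState.set_mem, hd0.symm, g0])
      (by simp [RamState.set_mem]) (by simp [RamState.set_mem, hd3.symm, g3]) (by omega) hdW
      (by omega)) (by omega) ?_
    rintro σ₂ ⟨hF₂, ho₂, h24⟩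
    have hg25 : σ₂.mem 25 = A := by
      rw [hF₂ 25 (by decide), RamState.set_mem, if_neg hd25.symm, g25]
    refine .arith_cons ((A : ℤ) - ((r - j) ^ d : ℕ)) (by omega) (by omega) (by omega)
      (by rw [RamOp.eval, hg25, h24]) (by omega) ?_
    refine .nil ⟨fun a ha => ?_, ?_, by omega, ?_, by simp [RamState.set_mem]⟩
    · have h1 := hF a ha
      simp only [List.mem_cons, List.not_mem_nil, or_false, not_or] at ha
      rw [RamState.set_mem, if_neg (by omega), hF₂ a (by simp [ha]), RamState.set_mem,
        if_neg ha.1, h1]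
    · rw [RamState.set_out, ho₂, RamState.set_out, ho]
    · rw [RamState.set_mem, if_neg (by omega), hF₂ dst (by simp [hd16, hd17, hd24]),
        RamState.set_mem, if_pos rfl]
  · simp only [List.mem_cons, List.not_mem_nil, or_false, not_or] at ha
    simp [RamState.set_mem, ha]
  · simp [RamState.set_mem, hd19, hd26]
  · simp [RamState.set_mem, zero_pow hd.ne']

/-- A bound for the running time of the whole program. -/
def samplerTime (n d P K : ℕ) : ℕ :=
  K * (targetTime (paramLayout d P) n + 3) + P * (d * 4 + 9) + K * (d * 4 + 9) + n * 4 + d * 36 + 47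

theorem samplerProg_halts {n q d C P K X : ℕ}
    (hS : RamSetup S W inp (paramLayout d P) n q K X) (hd : 0 < d) (hC : 0 < C)
    (hP : IsCeilRoot d (q ^ n) P) (hK : IsCeilRoot d (q ^ n * C ^ d) K)
    (h0 : inp.getD 0 0 = n) (h1 : inp.getD 1 0 = q) (h2 : inp.getD 2 0 = d)
    (h3 : inp.getD 3 0 = C) (hlen : 4 ≤ inp.length) (hnW : n < 2 ^ W) (hCW : C ^ d < 2 ^ W)
    (hPW : P ^ d < 2 ^ W) (hKW : K ^ d < 2 ^ W) :
    RamHalts S W inp samplerProg (samplerTime n d P K) (fun σ' => σ'.out =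
      ramOut inp (paramLayout d P) n q
        ((paramLayout d P).greedy (RamOk inp (paramLayout d P) n q) K)) ⟨fun _ => 0, []⟩ := by
  have hS1 := hS.mem_le
  have hS2 := hS.mem_lt
  have hqpos := hS.q_pos
  have hPpos : 0 < P := hS.P_pos
  have hBpos : 0 < 13 * d * P := hS.B_pos
  have hAW : q ^ n * C ^ d < 2 ^ W := lt_of_le_of_lt hK.1 hKW
  have hqn : q ^ n < 2 ^ W := lt_of_le_of_lt hP.1 hPW
  have hqW : q < 2 ^ W := lt_of_le_of_lt (Nat.le_self_pow hS.n_pos.ne' q) hqn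
  have hC1 : C < 2 ^ W := lt_of_le_of_lt (Nat.le_self_pow hd.ne' C) hCW
  have hPW1 : P < 2 ^ W := lt_of_le_of_lt (Nat.le_self_pow hd.ne' P) hPW
  have hT : (13 * d * P) ^ (8 * d) < 2 ^ W := hS.tuples_lt
  have hbad : 1 + 8 * d + n * q < 2 ^ W := hS.bad_lt
  have hm : (paramLayout d P).m = 8 * d := rfl
  have hB : (paramLayout d P).B = 13 * d * P := rfl
  have hPP : (paramLayout d P).P = P := rfl
  have hBW : 13 * d * P < 2 ^ W := lt_of_le_of_lt (Nat.le_self_pow (by omega) _) hT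
  have hdB : 13 * d ≤ 13 * d * P := Nat.le_mul_of_pos_right _ hPpos
  have hPB : P ≤ 13 * d * P := Nat.le_mul_of_pos_left _ (by omega)
  have hKpos : 0 < q ^ n * C ^ d := Nat.mul_pos (Nat.pow_pos hqpos) (Nat.pow_pos hC)
  rw [hm, hB] at hS1 hS2
  have hmBB : 13 * d * P ≤ 8 * d * (13 * d * P) := Nat.le_mul_of_pos_left _ (by omega)
  have hlW := hS.length_lt
  -- There is at least one target, so the length of the input already bounds the size of a group.
  have hsz := hS.length 0 (by
    by_contra h
    have hK0 : K = 0 := by omega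
    have := hK.1
    rw [hK0, zero_pow hd.ne'] at this; omega)
  have hsize : (paramLayout d P).size = 8 * d * (13 * d * P) + P := rfl
  rw [hsize, Nat.zero_div, Nat.zero_add, Nat.one_mul] at hsz
  have hszn : 8 * d * (13 * d * P) + P ≤ (8 * d * (13 * d * P) + P) * n :=
    Nat.le_mul_of_pos_right _ hS.n_pos
  have h8W : 8 < 2 ^ W := by omega
  rw [samplerTime]
  refine .const_cons (by omega) (by rw [Int.natAbs_one]; omega) ?_
  refine .const_cons (by omega) (by simp) ?_
  refine .read_cons 0 n (by omega) (by omega) (by simp [RamState.set_mem]) (by omega) h0 (by omega) ?_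
  refine .const_cons (by omega) (by rw [Int.natAbs_one]; omega) ?_
  refine .read_cons 1 q (by omega) (by omega) (by simp [RamState.set_mem]) (by omega) h1 (by omega) ?_
  refine .const_cons (by omega) (by norm_num; omega) ?_
  refine .read_cons 2 d (by omega) (by omega) (by simp [RamState.set_mem]) (by omega) h2 (by omega) ?_
  refine .const_cons (by omega) (by norm_num; omega) ?_
  refine .read_cons 3 C (by omega) (by omega) (by simp [RamState.set_mem]) (by omega) h3 (by omega) ?_
  set σ₀ : RamState := ((((((((RamState.set ⟨fun _ => 0, []⟩ 0 1).set 26 0).set 1 n).set 26 1).set 2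
    q).set 26 2).set 3 d).set 26 3).set 4 C with hσ₀
  have a0 : σ₀.mem 0 = 1 := by simp [hσ₀, RamState.set_mem]
  have a1 : σ₀.mem 1 = n := by simp [hσ₀, RamState.set_mem]
  have a2 : σ₀.mem 2 = q := by simp [hσ₀, RamState.set_mem]
  have a3 : σ₀.mem 3 = d := by simp [hσ₀, RamState.set_mem]
  have a4 : σ₀.mem 4 = C := by simp [hσ₀, RamState.set_mem]
  have ao : σ₀.out = [] := rfl
  refine .call (n * 4 + 5) (K * (targetTime (paramLayout d P) n + 3) + P * (d * 4 + 9) +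
    K * (d * 4 + 9) + d * 36 + 33)
    (powProg_halts (by decide) (by decide) (by decide) (by omega) a0 a2 a1 hqpos hnW hqn)
    (by omega) ?_
  rintro σ₁ ⟨F₁, o₁, b25⟩
  refine .call (P * (d * 4 + 9) + 5) (K * (targetTime (paramLayout d P) n + 3) +
    K * (d * 4 + 9) + d * 36 + 28)
    (rootProg_halts (by decide) (by omega) ((F₁ 0 (by decide)).trans a0)
      ((F₁ 3 (by decide)).trans a3) b25 hd hP (by omega) hqn hPW) (by omega) ?_
  rintro σ₂ ⟨F₂, o₂, c6⟩
  have c3 : σ₂.mem 3 = d := by rw [F₂ 3 (by decide), F₁ 3 (by decide), a3]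
  have c0 : σ₂.mem 0 = 1 := by rw [F₂ 0 (by decide), F₁ 0 (by decide), a0]
  have c25 : σ₂.mem 25 = (q ^ n : ℕ) := by rw [F₂ 25 (by decide), b25]
  refine .call (d * 4 + 5) (K * (targetTime (paramLayout d P) n + 3) +
    K * (d * 4 + 9) + d * 32 + 23)
    (powProg_halts (x := C) (m := d) (by decide) (by decide) (by decide) (by omega) c0
      (by rw [F₂ 4 (by decide), F₁ 4 (by decide), a4]) c3 hC (by omega) hCW) (by omega) ?_
  rintro σ₃ ⟨F₃, o₃, d27⟩
  refine .arithNat_cons (q ^ n * C ^ d) (by omega) (by omega) (by omega)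
    (by rw [RamOp.eval, F₃ 25 (by decide), c25, d27]; push_cast; rfl) hAW ?_
  have e0 : ∀ a, a ≠ 25 → (σ₃.set 25 (q ^ n * C ^ d : ℕ)).mem a = σ₃.mem a := fun a ha => by
    rw [RamState.set_mem, if_neg ha]
  refine .call (K * (d * 4 + 9) + 5) (K * (targetTime (paramLayout d P) n + 3) + d * 32 + 17)
    (rootProg_halts (d := d) (A := q ^ n * C ^ d) (by decide) (by omega)
      (by rw [e0 0 (by decide), F₃ 0 (by decide), c0])
      (by rw [e0 3 (by decide), F₃ 3 (by decide), c3])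
      (by simp [RamState.set_mem]) hd hK (by omega) hAW hKW) (by omega) ?_
  rintro σ₄ ⟨F₄, o₄, g8⟩
  have e4 : ∀ a, a ∉ [8, 16, 17, 19, 24, 25, 26, 27] → σ₄.mem a = σ₂.mem a := fun a ha => by
    simp only [List.mem_cons, List.not_mem_nil, or_false, not_or] at ha
    rw [F₄ a (by simp [ha]), e0 a (by omega), F₃ a (by simp [ha])]
  have g3 : σ₄.mem 3 = d := by rw [e4 3 (by decide), c3]
  have g6 : σ₄.mem 6 = P := by rw [e4 6 (by decide), c6]
  refine .const_cons (by omega) (by norm_num; omega) ?_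
  refine .arithNat_cons (8 * d) (by omega) (by omega) (by omega)
    (by simp [RamOp.eval, RamState.set_mem, g3]) (by omega) ?_
  refine .const_cons (by omega) (by norm_num; omega) ?_
  refine .arithNat_cons (13 * d) (by omega) (by omega) (by omega)
    (by simp [RamOp.eval, RamState.set_mem, g3]) (by omega) ?_
  refine .arithNat_cons (13 * d * P) (by omega) (by omega) (by omega)
    (by simp [RamOp.eval, RamState.set_mem, g6]) (by omega) ?_
  refine .arithNat_cons (8 * d * (13 * d * P)) (by omega) (by omega) (by omega)
    (by simp [RamOp.eval, RamState.set_mem]) (by omega) ?_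
  refine .arithNat_cons (8 * d * (13 * d * P) + P) (by omega) (by omega) (by omega)
    (by simp [RamOp.eval, RamState.set_mem, g6]) (by omega) ?_
  set σ₅ := ((((((σ₄.set 26 8).set 5 (8 * d : ℕ)).set 26 13).set 7 (13 * d : ℕ)).set 7
    (13 * d * P : ℕ)).set 9 (8 * d * (13 * d * P) : ℕ)).set 10 (8 * d * (13 * d * P) + P : ℕ)
    with hσ₅
  have e5 : ∀ a, a ∉ [5, 7, 8, 9, 10, 16, 17, 19, 24, 25, 26, 27] → σ₅.mem a = σ₂.mem a :=
    fun a ha => by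
      simp only [List.mem_cons, List.not_mem_nil, or_false, not_or] at ha
      rw [← e4 a (by simp [ha])]
      simp [hσ₅, RamState.set_mem, ha]
  have i5 : σ₅.mem 5 = (8 * d : ℕ) := by simp [hσ₅, RamState.set_mem]
  have i7 : σ₅.mem 7 = (13 * d * P : ℕ) := by simp [hσ₅, RamState.set_mem]
  have i8 : σ₅.mem 8 = K := by simp [hσ₅, RamState.set_mem, g8]
  have i9 : σ₅.mem 9 = (8 * d * (13 * d * P) : ℕ) := by simp [hσ₅, RamState.set_mem]
  have i10 : σ₅.mem 10 = (8 * d * (13 * d * P) + P : ℕ) := by simp [hσ₅, RamState.set_mem]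
  have i0 : σ₅.mem 0 = 1 := by rw [e5 0 (by decide), c0]
  refine .call (8 * d * 4 + 5) (K * (targetTime (paramLayout d P) n + 3) + 4)
    (powProg_halts (by decide) (by decide) (by decide) (by omega) i0 i7 i5 hBpos (by omega) hT)
    (by omega) ?_
  rintro σ₆ ⟨F₆, o₆, j11⟩
  refine .call (K * (targetTime (paramLayout d P) n + 3) + 3) 1 (greedyProg_halts hS
    ⟨?_, ?_, ?_, ?_, ?_, ?_, ?_, ?_, ?_, j11⟩ ?_) le_rfl fun σ' h => .nil h
  · rw [F₆ 0 (by decide), i0]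
  · rw [F₆ 1 (by decide), e5 1 (by decide), F₂ 1 (by decide), F₁ 1 (by decide), a1]
  · rw [F₆ 2 (by decide), e5 2 (by decide), F₂ 2 (by decide), F₁ 2 (by decide), a2]
  · rw [F₆ 5 (by decide), i5]; rfl
  · rw [F₆ 6 (by decide), e5 6 (by decide), c6]; rfl
  · rw [F₆ 7 (by decide), i7]; rfl
  · rw [F₆ 8 (by decide), i8]
  · rw [F₆ 9 (by decide), i9]; rfl
  · rw [F₆ 10 (by decide), i10]; rfl
  · rw [o₆, hσ₅]; simp only [RamState.set_out]; rw [o₄, RamState.set_out, o₃, o₂, o₁, ao]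

end RamSetupProgram

/-! ### Coordinates of lattice vectors as machine input and output -/

section LatticeProgram

variable {n : ℕ} (b : Module.Basis (Fin n) ℝ (EuclideanSpace ℝ (Fin n)))

theorem length_coordList (xs : List (latticeOf b)) : (coordList b xs).length = xs.length * n := by
  simp [coordList]

theorem getD_coordList (xs : List (latticeOf b)) (i : ℕ) (l : Fin n) :
    (coordList b xs).getD (i * n + l) 0 = (b.restrictScalars ℤ).repr (xs.getD i 0) l := by
  induction xs generalizing i with
  | nil => simp [coordList]
  | cons x xs ih =>
    have h : coordList b (x :: xs) =
        (List.ofFn fun i => (b.restrictScalars ℤ).repr x i) ++ coordList b xs := by simp [coordList]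
    rw [h]
    cases i with
    | zero =>
      rw [List.getD_append _ _ _ _ (by simp), Nat.zero_mul, Nat.zero_add,
        List.getD_eq_getElem _ _ (by simp)]
      simp
    | succ i =>
      rw [List.getD_append_right _ _ _ _ (by rw [List.length_ofFn, Nat.succ_mul]; omega)]
      rw [List.length_ofFn, Nat.succ_mul, show i * n + n + (l : ℕ) - n = i * n + l by omega, ih]
      simp

/-- The input of the program. -/
noncomputable def samplerInput (q d C : ℕ) (xs : List (latticeOf b)) : List ℤ :=
  [(n : ℤ), (q : ℤ), (d : ℤ), (C : ℤ)] ++ coordList b xs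

variable {b} {q d C : ℕ} {Λ : Layout} (xs : List (latticeOf b))

theorem ramCoord_samplerInput (k τ : ℕ) (l : Fin n) :
    ramCoord (samplerInput b q d C xs) Λ n k τ l =
      (b.restrictScalars ℤ).repr (Λ.tupleVec (fun i => xs.getD i 0) k τ) l := by
  let f : latticeOf b →+ ℤ :=
    ((Finsupp.lapply l).comp (b.restrictScalars ℤ).repr.toLinearMap).toAddMonoidHom
  have h := Layout.tupleVec_map (Λ := Λ) f (fun i => xs.getD i 0) k τ
  refine Eq.trans ?_ h.symm
  rw [ramCoord]
  congr 1
  ext1 i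
  rw [samplerInput, List.getD_append_right _ _ _ _ (by simp; omega)]
  refine Eq.trans ?_ (getD_coordList b xs i l)
  congr 1
  simp only [List.length_cons, List.length_nil]
  omega

theorem ramOk_samplerInput (k τ : ℕ) :
    RamOk (samplerInput b q d C xs) Λ n q k τ ↔
      latticeMod b q (Λ.tupleVec (fun i => xs.getD i 0) k τ) = 0 := by
  rw [funext_iff, RamOk, ← Fin.forall_iff (p := fun l =>
    (q : ℤ) ∣ ramCoord (samplerInput b q d C xs) Λ n k τ l)]
  refine forall_congr' fun l => ?_
  rw [latticeMod_apply, Pi.zero_apply, ZMod.intCast_zmod_eq_zero_iff_dvd, ramCoord_samplerInput]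

/-- Taking coordinates is additive, so the divisibility tests and quotients of the machine are those
of the lattice vectors, and the two greedy runs coincide. -/
theorem ramOut_samplerInput (K : ℕ) :
    ramOut (samplerInput b q d C xs) Λ n q
      (Λ.greedy (RamOk (samplerInput b q d C xs) Λ n q) K) =
      coordList b (Λ.latticeAlg b q K xs) := by
  have h : RamOk (samplerInput b q d C xs) Λ n q =
      fun k τ => latticeMod b q (Λ.tupleVec (fun i => xs.getD i 0) k τ) = 0 := by
    ext k τ; exact ramOk_samplerInput xs k τ
  rw [h, ramOut, coordList, Layout.latticeAlg, Layout.accepted, List.flatMap_map]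
  congr 1
  ext1 p
  rw [List.ofFn_eq_map, ← List.map_coe_finRange_eq_range, List.map_map]
  refine List.map_congr_left fun l _ => ?_
  rw [Function.comp_apply, ramCoord_samplerInput, Layout.divVec]
  have h2 := congrFun ((b.restrictScalars ℤ).equivFun.apply_symm_apply
    fun i => (b.restrictScalars ℤ).repr (Λ.tupleVec (fun i => xs.getD i 0) p.1 p.2) i / q) l
  rw [Module.Basis.equivFun_apply] at h2
  exact h2.symm

theorem natAbs_lt_two_pow_maxBitLength {l : List ℤ} {z : ℤ} (h : z ∈ l) :
    z.natAbs < 2 ^ maxBitLength l := by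
  refine (Nat.lt_size_self _).trans_le (Nat.pow_le_pow_right (by norm_num) ?_)
  induction l with
  | nil => simp at h
  | cons y l ih =>
    have he : maxBitLength (y :: l) = max y.natAbs.size (maxBitLength l) := rfl
    rw [he]
    rcases List.mem_cons.1 h with rfl | h
    · exact le_max_left _ _
    · exact (ih h).trans (le_max_right _ _)

theorem natAbs_getD_le {l : List ℤ} (i : ℕ) : (l.getD i 0).natAbs ≤ 2 ^ maxBitLength l := by
  by_cases h : i < l.length
  · rw [List.getD_eq_getElem _ _ h]
    exact (natAbs_lt_two_pow_maxBitLength (List.getElem_mem h)).le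
  · rw [List.getD_eq_default _ _ (by omega)]
    simp

end LatticeProgram

/-! ### Word length -/

section Words

/-- All numbers that occur in a run of the program have few bits. -/
theorem ramSetup_samplerInput {n q d C P K N : ℕ}
    (b : Module.Basis (Fin n) ℝ (EuclideanSpace ℝ (Fin n))) (hq : 2 ≤ q) (hd : 0 < d) (hdn : d ≤ n)
    (hP0 : 0 < P) (hP : P ≤ q ^ n) (hK : K ≤ C * P) (hN1 : N ≤ 160 * d ^ 2 * C * q ^ n)
    (hN : ∀ k < K, (k / P + 1) * (paramLayout d P).size ≤ N)
    {xs : List (latticeOf b)} (hxs : xs.length = N) {W : ℕ}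
    (hW : W = 100 * (n + maxBitLength (samplerInput b q d C xs) + 1) ^ 3) :
    RamSetup (32 + 8 * d * (13 * d * P)) W (samplerInput b q d C xs) (paramLayout d P) n q K
      (2 ^ maxBitLength (samplerInput b q d C xs)) ∧
    n < 2 ^ W ∧ C ^ d < 2 ^ W ∧ P ^ d < 2 ^ W ∧ K ^ d < 2 ^ W := by
  set mb := maxBitLength (samplerInput b q d C xs) with hmb
  -- Each parameter is at most 2^ℓ, so every number that occurs is bounded by a power of 2 with
  -- exponent polynomial in ℓ.
  set ℓ := n + mb with hℓ
  have hent : ∀ v : ℕ, (v : ℤ) ∈ samplerInput b q d C xs → v ≤ 2 ^ ℓ := fun v hv => by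
    have h := natAbs_lt_two_pow_maxBitLength hv
    rw [Int.natAbs_natCast] at h
    exact h.le.trans (Nat.pow_le_pow_right (by norm_num) (by omega))
  have hnL : n ≤ 2 ^ ℓ := hent n (by simp [samplerInput])
  have hqL : q ≤ 2 ^ ℓ := hent q (by simp [samplerInput])
  have hdL : d ≤ 2 ^ ℓ := hent d (by simp [samplerInput])
  have hCL : C ≤ 2 ^ ℓ := hent C (by simp [samplerInput])
  have hnl : n ≤ ℓ := by omega
  have hlen : (samplerInput b q d C xs).length = 4 + N * n := by
    rw [samplerInput, List.length_append, length_coordList, hxs]; rfl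
  have key : ∀ {x e : ℕ}, x ≤ 2 ^ e → e < W → x < 2 ^ W := fun h he =>
    h.trans_lt (Nat.pow_lt_pow_right (by norm_num) he)
  have hW' : W = 100 * ℓ ^ 3 + 300 * ℓ ^ 2 + 300 * ℓ + 100 := by rw [hW]; ring
  have hqn : q ^ n ≤ 2 ^ (ℓ ^ 2) := by
    refine (Nat.pow_le_pow_left hqL n).trans ?_
    rw [← pow_mul, sq]
    exact Nat.pow_le_pow_right (by norm_num) (Nat.mul_le_mul_left _ hnl)
  have hPl : P ≤ 2 ^ (ℓ ^ 2) := hP.trans hqn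
  have hKl : K ≤ 2 ^ (ℓ + ℓ ^ 2) := by
    rw [pow_add]; exact hK.trans (Nat.mul_le_mul hCL hPl)
  have hBl : 13 * d * P ≤ 2 ^ (4 + ℓ + ℓ ^ 2) := by
    rw [pow_add, pow_add]
    exact Nat.mul_le_mul (Nat.mul_le_mul (by norm_num) hdL) hPl
  have powd : ∀ {x e : ℕ}, x ≤ 2 ^ e → x ^ d ≤ 2 ^ (e * ℓ) := fun {x e} h => by
    refine (Nat.pow_le_pow_left h d).trans ?_
    rw [← pow_mul]
    exact Nat.pow_le_pow_right (by norm_num) (Nat.mul_le_mul_left _ (hdn.trans hnl))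
  have hmBl : 8 * d * (13 * d * P) ≤ 2 ^ (3 + ℓ + (4 + ℓ + ℓ ^ 2)) := by
    rw [pow_add, pow_add]
    exact Nat.mul_le_mul (Nat.mul_le_mul (by norm_num) hdL) hBl
  have hNn : N * n ≤ 2 ^ (8 + 4 * ℓ + ℓ ^ 2) := by
    have e : 2 ^ (8 + 4 * ℓ + ℓ ^ 2) = 2 ^ 8 * (2 ^ ℓ) ^ 2 * 2 ^ ℓ * 2 ^ (ℓ ^ 2) * 2 ^ ℓ := by ring
    rw [e]
    refine Nat.mul_le_mul (hN1.trans (Nat.mul_le_mul (Nat.mul_le_mul (Nat.mul_le_mul (by norm_num)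
      (Nat.pow_le_pow_left hdL 2)) hCL) hqn)) hnL
  have one_le : ∀ e : ℕ, 1 ≤ 2 ^ e := fun e => Nat.one_le_two_pow
  refine ⟨⟨by omega, by omega, Nat.mul_pos (by omega) hP0, hP0, fun k hk => ?_, ?_,
    fun i => natAbs_getD_le i, ?_, ?_, key hKl (by omega), ?_, le_rfl, ?_⟩, key hnL (by omega),
    key (powd hCL) ?_, key (powd hPl) ?_, key (powd hKl) ?_⟩
  · rw [hlen]
    exact Nat.add_le_add_left (Nat.mul_le_mul_right _ (hN k hk)) 4
  · rw [hlen]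
    refine key (e := 11 + 4 * ℓ + ℓ ^ 2) ?_ (by omega)
    have e : 2 ^ (11 + 4 * ℓ + ℓ ^ 2) = 8 * 2 ^ (8 + 4 * ℓ + ℓ ^ 2) := by ring
    have := one_le (8 + 4 * ℓ + ℓ ^ 2)
    omega
  · change (8 * d + 1) * 2 ^ mb < 2 ^ W
    refine key (e := 4 + ℓ + ℓ) ?_ (by omega)
    rw [pow_add, pow_add]
    refine Nat.mul_le_mul (by omega) (Nat.pow_le_pow_right (by norm_num) (by omega))
  -- The number of tuples is what makes the word length cubic: its base has O(ℓ²) bits and its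
  -- exponent is O(ℓ).
  · change (13 * d * P) ^ (8 * d) < 2 ^ W
    refine key (e := (4 + ℓ + ℓ ^ 2) * (8 * ℓ)) ?_ ?_
    · refine (Nat.pow_le_pow_left hBl _).trans ?_
      rw [← pow_mul]
      exact Nat.pow_le_pow_right (by norm_num) (Nat.mul_le_mul_left _ (by omega))
    · rw [hW']; ring_nf; omega
  · change 1 + 8 * d + n * q < 2 ^ W
    refine key (e := 5 + ℓ + ℓ) ?_ (by omega)
    have h1 : n * q ≤ 2 ^ ℓ * 2 ^ ℓ := Nat.mul_le_mul hnL hqL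
    have h2 := one_le ℓ
    have h3 : 2 ^ ℓ ≤ 2 ^ ℓ * 2 ^ ℓ := Nat.le_mul_of_pos_right _ h2
    have e : 2 ^ (5 + ℓ + ℓ) = 32 * (2 ^ ℓ * 2 ^ ℓ) := by ring
    omega
  · change 32 + 8 * d * (13 * d * P) < 2 ^ W
    refine key (e := 6 + (3 + ℓ + (4 + ℓ + ℓ ^ 2))) ?_ (by omega)
    have e : 2 ^ (6 + (3 + ℓ + (4 + ℓ + ℓ ^ 2))) = 64 * 2 ^ (3 + ℓ + (4 + ℓ + ℓ ^ 2)) := by ring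
    have := one_le (3 + ℓ + (4 + ℓ + ℓ ^ 2))
    omega
  · rw [hW', ← sq]; omega
  · rw [hW', show ℓ ^ 2 * ℓ = ℓ ^ 3 by ring]; omega
  · rw [hW', show (ℓ + ℓ ^ 2) * ℓ = ℓ ^ 2 + ℓ ^ 3 by ring]; omega

end Words

/-! ### Numerical estimates for the chosen parameters -/

section Parameters

variable {n q d C : ℕ}

theorem rpow_div_pow (hd : 1 ≤ d) : ((q : ℝ) ^ ((n : ℝ) / d)) ^ d = (q : ℝ) ^ n := by
  have hd' : (d : ℝ) ≠ 0 := by positivity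
  rw [← Real.rpow_natCast, ← Real.rpow_mul (Nat.cast_nonneg q), div_mul_cancel₀ _ hd',
    Real.rpow_natCast]

/-- This is how the machine obtains the ceilings of real powers from integer arithmetic. -/
theorem isCeilRoot_ceil {x : ℝ} (hx : 0 ≤ x) {A : ℕ} (hd : 1 ≤ d) (h : x ^ d = A) :
    IsCeilRoot d A ⌈x⌉₊ := by
  constructor
  · have : (A : ℝ) ≤ (⌈x⌉₊ : ℝ) ^ d := by rw [← h]; exact pow_le_pow_left₀ hx (Nat.le_ceil x) d
    exact_mod_cast this
  · intro y hy
    have : (y : ℝ) ^ d < A := by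
      rw [← h]; exact pow_lt_pow_left₀ (Nat.lt_ceil.1 hy) (Nat.cast_nonneg y) (by omega)
    exact_mod_cast this

theorem two_le_rpow_div (hq : 2 ≤ q) (hd : 1 ≤ d) (hdn : d ≤ n) :
    2 ≤ (q : ℝ) ^ ((n : ℝ) / d) := by
  have hd' : (0 : ℝ) < d := by positivity
  have hq' : (2 : ℝ) ≤ q := by exact_mod_cast hq
  have h1 : (1 : ℝ) ≤ (n : ℝ) / d := by rw [le_div_iff₀ hd', one_mul]; exact_mod_cast hdn
  exact hq'.trans (Real.self_le_rpow_of_one_le (by linarith) h1)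

theorem targetTime_paramLayout_le {P : ℕ} (hd : 1 ≤ d) (hdn : d ≤ n) (hP : 1 ≤ P) :
    targetTime (paramLayout d P) n ≤ 705 * n ^ 2 * (13 * d * P) ^ (8 * d) := by
  change (13 * d * P) ^ (8 * d) * (2 * (n * (8 * d * 16 + 19)) + 8 * d * 25 + 27) +
    8 * d * (13 * d * P) * 8 + 15 ≤ _
  have hB : 1 ≤ 13 * d * P := Nat.mul_pos (by omega) hP
  have h1 : 13 * d * P ≤ (13 * d * P) ^ (8 * d) := Nat.le_self_pow (by omega) _
  generalize 13 * d * P = B at *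
  generalize B ^ (8 * d) = Y at *
  have hY : 1 ≤ Y := hB.trans h1
  have hn : 1 ≤ n := hd.trans hdn
  have hnn : n ≤ n ^ 2 := Nat.le_self_pow (by norm_num) n
  have hnd : n * d ≤ n ^ 2 := by rw [sq]; exact Nat.mul_le_mul_left _ hdn
  have h2 : 2 * (n * (8 * d * 16 + 19)) + 8 * d * 25 + 27 ≤ 521 * n ^ 2 := by
    have e : 2 * (n * (8 * d * 16 + 19)) = 256 * (n * d) + 38 * n := by ring
    omega
  have h3 : 8 * d * B * 8 ≤ 64 * (n ^ 2 * Y) := by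
    have e : 8 * d * B * 8 = 64 * (d * B) := by ring
    rw [e]
    exact Nat.mul_le_mul_left _ (Nat.mul_le_mul (by omega) h1)
  have h4 : 1 ≤ n ^ 2 * Y := Nat.mul_pos (by omega) hY
  have h5 : Y * (2 * (n * (8 * d * 16 + 19)) + 8 * d * 25 + 27) ≤ 521 * (n ^ 2 * Y) := by
    refine (Nat.mul_le_mul_left Y h2).trans (le_of_eq (by ring))
  have e : 705 * n ^ 2 * Y = 705 * (n ^ 2 * Y) := by ring
  omega

theorem samplerTime_le {P K : ℕ} (hd : 1 ≤ d) (hdn : d ≤ n) (hP : 1 ≤ P) (hPK : P ≤ K) :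
    samplerTime n d P K ≤ 1000 * n ^ 2 * (K * (13 * d * P) ^ (8 * d)) := by
  have h1 := targetTime_paramLayout_le hd hdn hP
  have hB : 1 ≤ (13 * d * P) ^ (8 * d) := Nat.one_le_pow _ _ (Nat.mul_pos (by omega) hP)
  rw [samplerTime]
  generalize (13 * d * P) ^ (8 * d) = Y at *
  generalize targetTime (paramLayout d P) n = t at *
  have hn : 1 ≤ n := hd.trans hdn
  have hnn : n ≤ n ^ 2 := Nat.le_self_pow (by norm_num) n
  have hK : 1 ≤ K := hP.trans hPK
  have hnY : n ^ 2 ≤ n ^ 2 * Y := Nat.le_mul_of_pos_right _ hB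
  have h2 : K * (t + 3) ≤ K * (708 * (n ^ 2 * Y)) := Nat.mul_le_mul_left _ (by
    have e : 705 * n ^ 2 * Y = 705 * (n ^ 2 * Y) := by ring
    omega)
  have h3 : K * (d * 4 + 9) ≤ K * (13 * (n ^ 2 * Y)) := Nat.mul_le_mul_left _ (by omega)
  have h4 : P * (d * 4 + 9) ≤ K * (13 * (n ^ 2 * Y)) := Nat.mul_le_mul hPK (by omega)
  have h5 : n ^ 2 * Y ≤ K * (n ^ 2 * Y) := Nat.le_mul_of_pos_left _ hK
  have e1 : K * (708 * (n ^ 2 * Y)) = 708 * (K * (n ^ 2 * Y)) := by ring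
  have e2 : K * (13 * (n ^ 2 * Y)) = 13 * (K * (n ^ 2 * Y)) := by ring
  have e3 : 1000 * n ^ 2 * (K * Y) = 1000 * (K * (n ^ 2 * Y)) := by ring
  omega

/-- The exponent that absorbs the polynomial factor of the running time. -/
noncomputable def timeExponent (n : ℕ) : ℝ := 11 + 2 * Real.logb 2 n

theorem timeExponent_isLittleO : timeExponent =o[atTop] (fun n : ℕ => (n : ℝ)) := by
  refine IsLittleO.add ?_ ?_
  · exact (isLittleO_const_left.2 (Or.inr (tendsto_norm_atTop_atTop.comp
      tendsto_natCast_atTop_atTop)))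
  · refine IsLittleO.const_mul_left ?_ 2
    simp only [Real.logb, div_eq_inv_mul]
    exact (Real.isLittleO_log_id_atTop.comp_tendsto tendsto_natCast_atTop_atTop).const_mul_left _

theorem le_rpow_timeExponent (hq : 2 ≤ q) (hn : 1 ≤ n) :
    2048 * (n : ℝ) ^ 2 ≤ (q : ℝ) ^ timeExponent n := by
  have hn' : (1 : ℝ) ≤ n := by exact_mod_cast hn
  have h0 : 0 ≤ timeExponent n := by
    have := Real.logb_nonneg (b := 2) (by norm_num) hn'
    rw [timeExponent]; positivity
  have h1 : (2 : ℝ) ^ timeExponent n = 2048 * (n : ℝ) ^ 2 := by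
    rw [timeExponent, Real.rpow_add (by norm_num), mul_comm (2 : ℝ) (Real.logb 2 n),
      Real.rpow_mul (by norm_num), Real.rpow_logb (by norm_num) (by norm_num) (by linarith)]
    norm_num
  rw [← h1]
  exact Real.rpow_le_rpow (by norm_num) (by exact_mod_cast hq) h0

/-- Since Q^d = q^n, the tuple count (13dP)^(8d) is of order q^(8n); the K targets give the factor
C·Q, and the polynomial factor goes into q^f(n). -/
theorem time_bound {Q : ℝ} (hQ : Q = (q : ℝ) ^ ((n : ℝ) / d)) (hQ2 : 2 ≤ Q) (hq : 2 ≤ q)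
    (hd : 1 ≤ d) (hdn : d ≤ n) (hC : 1 ≤ C) {P K : ℕ} (hP : (P : ℝ) ≤ 3 / 2 * Q)
    (hK : (K : ℝ) ≤ 3 / 2 * (C * Q)) {t : ℕ}
    (ht : t ≤ 1000 * n ^ 2 * (K * (13 * d * P) ^ (8 * d))) :
    (t : ℝ) ≤ C * (10 * Real.exp 1 * d) ^ (8 * d) *
      (q : ℝ) ^ (8 * (n : ℝ) + (n : ℝ) / d + timeExponent n) := by
  have hq' : (0 : ℝ) < q := by positivity
  have ht' : (t : ℝ) ≤ 1000 * (n : ℝ) ^ 2 * (K * (13 * d * P) ^ (8 * d)) := by exact_mod_cast ht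
  have hexp := Real.add_one_le_exp (1 : ℝ)
  have h1 : (13 * d * P : ℝ) ^ (8 * d) ≤ (10 * Real.exp 1 * d) ^ (8 * d) * (q : ℝ) ^ (8 * n) := by
    have e : (q : ℝ) ^ (8 * n) = Q ^ (8 * d) := by
      rw [hQ, mul_comm 8 d, pow_mul _ d 8, rpow_div_pow hd, ← pow_mul, mul_comm]
    rw [e, ← mul_pow]
    refine pow_le_pow_left₀ (by positivity) ?_ _
    have hdQ : 0 ≤ (d : ℝ) * Q := by positivity
    have h2 : (d : ℝ) * P ≤ d * (3 / 2 * Q) := mul_le_mul_of_nonneg_left hP (by positivity)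
    -- Rounding costs at most a factor 3/2, and 13 · 3/2 = 19.5 ≤ 20 ≤ 10e, using only e ≥ 2.
    nlinarith
  have h3 := le_rpow_timeExponent hq (hd.trans hdn)
  rw [Real.rpow_add hq', Real.rpow_add hq', ← hQ,
    show (q : ℝ) ^ (8 * (n : ℝ)) = (q : ℝ) ^ (8 * n) by rw [← Real.rpow_natCast]; push_cast; rfl]
  have hn0 : (0 : ℝ) ≤ n := Nat.cast_nonneg n
  have hX : 0 ≤ (10 * Real.exp 1 * d : ℝ) ^ (8 * d) * (q : ℝ) ^ (8 * n) := by positivity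
  calc (t : ℝ) ≤ 1000 * (n : ℝ) ^ 2 * (K * (13 * d * P) ^ (8 * d)) := ht'
    _ ≤ 1000 * (n : ℝ) ^ 2 * ((3 / 2 * (C * Q)) *
        ((10 * Real.exp 1 * d) ^ (8 * d) * (q : ℝ) ^ (8 * n))) := by gcongr
    _ = 1500 * (n : ℝ) ^ 2 * (C * Q * ((10 * Real.exp 1 * d) ^ (8 * d) * (q : ℝ) ^ (8 * n))) := by
        ring
    _ ≤ (q : ℝ) ^ timeExponent n *
        (C * Q * ((10 * Real.exp 1 * d) ^ (8 * d) * (q : ℝ) ^ (8 * n))) := by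
        refine mul_le_mul_of_nonneg_right ?_ (by positivity)
        -- The constant is 1000 · 3/2 = 1500, below 2048 = 2^11.
        nlinarith [sq_nonneg (n : ℝ)]
    _ = _ := by ring

/-- Of the 8d factors B, four cancel the polynomial terms and the rest give at least (q^n)^4,
because B ≥ P and P^d ≥ q^n. This leaves C·q^(-3n), better than required. -/
theorem failure_bound (hq : 2 ≤ q) (hd : 1 ≤ d) {P K : ℕ} (hP : 2 ≤ P)
    (hPq : q ^ n ≤ P ^ d) (hK : K ≤ C * P) :
    (K : ℝ) * (25 * (q : ℝ) ^ n / ((13 * d * P : ℕ) : ℝ) ^ (8 * d) *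
      (1 + ((8 * d : ℕ) : ℝ) * ((13 * d * P : ℕ) : ℝ) ^ 2)) ≤
      11 * C * (q : ℝ) ^ (-(5 * (n : ℝ) / 2)) := by
  have hq1 : (1 : ℝ) ≤ q := by exact_mod_cast (by omega : 1 ≤ q)
  have hq0 : (0 : ℝ) < q := by linarith
  have hd1 : (1 : ℝ) ≤ d := by exact_mod_cast hd
  have hP2 : (2 : ℝ) ≤ P := by exact_mod_cast hP
  have hK' : (K : ℝ) ≤ C * P := by exact_mod_cast hK
  set B : ℝ := ((13 * d * P : ℕ) : ℝ) with hB
  have hBv : B = 13 * d * P := by rw [hB]; push_cast; ring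
  have hB26 : 26 ≤ B := by rw [hBv]; nlinarith
  have hPB : (P : ℝ) ≤ B := by rw [hBv]; nlinarith
  have hpow : B ^ 4 * ((q : ℝ) ^ n) ^ 4 ≤ B ^ (8 * d) := by
    have h1 : ((q : ℝ) ^ n) ^ 4 ≤ B ^ (8 * d - 4) := by
      have h2 : (q : ℝ) ^ n ≤ (P : ℝ) ^ d := by exact_mod_cast hPq
      calc ((q : ℝ) ^ n) ^ 4 ≤ ((P : ℝ) ^ d) ^ 4 := pow_le_pow_left₀ (by positivity) h2 4
        _ ≤ (B ^ d) ^ 4 := by gcongr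
        _ = B ^ (d * 4) := by rw [pow_mul]
        _ ≤ B ^ (8 * d - 4) := pow_le_pow_right₀ (by linarith) (by omega)
    have e : B ^ (8 * d) = B ^ 4 * B ^ (8 * d - 4) := by rw [← pow_add]; congr 1; omega
    rw [e]
    exact mul_le_mul_of_nonneg_left h1 (by positivity)
  have hsum : 1 + ((8 * d : ℕ) : ℝ) * B ^ 2 ≤ 9 * d * B ^ 2 := by
    push_cast
    nlinarith [sq_nonneg B, mul_le_mul hB26 hB26 (by norm_num) (by linarith)]
  have hqn : (0 : ℝ) < (q : ℝ) ^ n := by positivity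
  have hmain : (K : ℝ) * (25 * (q : ℝ) ^ n / B ^ (8 * d) * (1 + ((8 * d : ℕ) : ℝ) * B ^ 2)) ≤
      C * (((q : ℝ) ^ n) ^ 3)⁻¹ := by
    calc (K : ℝ) * (25 * (q : ℝ) ^ n / B ^ (8 * d) * (1 + ((8 * d : ℕ) : ℝ) * B ^ 2))
        ≤ (C * P) * (25 * (q : ℝ) ^ n / (B ^ 4 * ((q : ℝ) ^ n) ^ 4) * (9 * d * B ^ 2)) := by
          gcongr
      _ = C * (((q : ℝ) ^ n) ^ 3)⁻¹ * (225 / 13 * (13 * d * P) / B ^ 2) := by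
          field_simp
          ring
      _ = C * (((q : ℝ) ^ n) ^ 3)⁻¹ * (225 / 13 / B) := by
          rw [← hBv]; field_simp
      _ ≤ C * (((q : ℝ) ^ n) ^ 3)⁻¹ * 1 := by
          refine mul_le_mul_of_nonneg_left ?_ (by positivity)
          -- The constants combine to 25·9/13 < 26 ≤ B.
          rw [div_le_one (by linarith)]; linarith
      _ = _ := mul_one _
  refine hmain.trans ?_
  have hle : (((q : ℝ) ^ n) ^ 3)⁻¹ ≤ (q : ℝ) ^ (-(5 * (n : ℝ) / 2)) := by
    rw [← pow_mul, ← Real.rpow_natCast, ← Real.rpow_neg hq0.le]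
    refine Real.rpow_le_rpow_of_exponent_le hq1 ?_
    push_cast
    have : (0 : ℝ) ≤ n := Nat.cast_nonneg n
    linarith
  have hC0 : (0 : ℝ) ≤ C := Nat.cast_nonneg C
  have := mul_le_mul_of_nonneg_left hle hC0
  have h3 : 0 ≤ (C : ℝ) * (q : ℝ) ^ (-(5 * (n : ℝ) / 2)) := by positivity
  linarith

/-- The width s/(√2 q) is √(2d) times s/(2√d q), and the latter is at least the smoothing parameter.
-/
theorem dualMass_le_of_le {ι E : Type*} [Fintype ι] [Nonempty ι] [NormedAddCommGroup E]
    [InnerProductSpace ℝ E] [FiniteDimensional ℝ E] (b : Module.Basis ι ℝ E) {ε s : ℝ} (hε : 0 < ε)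
    (hs : 0 < s) (hq : 1 ≤ q) (hd : 1 ≤ d)
    (h : 2 * √(d : ℝ) * q * smoothingParam ε (Submodule.span ℤ (Set.range b)) ≤ s) :
    ∑' k : ι → ℤ, gaussianRho (1 / (s / √2 / q)) (dualVec b k) ≤ 1 + ε ^ (2 * d) := by
  have hq' : (0 : ℝ) < q := by positivity
  have hd' : 0 < √(d : ℝ) := Real.sqrt_pos.2 (by positivity)
  have h1 := dualMass_le_of_smoothingParam_le b hε (s := s / (2 * √(d : ℝ) * q)) (by positivity)
    (by rw [le_div_iff₀ (by positivity), mul_comm]; exact h)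
  have h2 := dualMass_sub_one_le_pow b (by positivity) (t := 2 * d) (by omega) h1
  have e : s / √2 / q = √((2 * d : ℕ) : ℝ) * (s / (2 * √(d : ℝ) * q)) := by
    have h3 : √2 * √2 = (2 : ℝ) := Real.mul_self_sqrt (by norm_num)
    push_cast
    rw [Real.sqrt_mul (by norm_num)]
    have h4 : (0 : ℝ) < √2 := by positivity
    field_simp
    linear_combination (-1 : ℝ) * h3
  rw [e]
  exact h2

/-- The parameters computed by the algorithm, with `Q = q ^ (n / d)`. -/
structure SamplerParams (n q d C N P K : ℕ) (Q : ℝ) : Prop where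
  Q_eq : Q = (q : ℝ) ^ ((n : ℝ) / d)
  two_le_Q : 2 ≤ Q
  two_le_q : 2 ≤ q
  one_le_d : 1 ≤ d
  d_le : d ≤ n
  one_le_C : 1 ≤ C
  two_le_P : 2 ≤ P
  P_root : IsCeilRoot d (q ^ n) P
  K_root : IsCeilRoot d (q ^ n * C ^ d) K
  P_le : (P : ℝ) ≤ 3 / 2 * Q
  K_le : (K : ℝ) ≤ 3 / 2 * (C * Q)
  P_le_K : P ≤ K
  K_le_mul : K ≤ C * P
  P_le_pow : P ≤ q ^ n
  N_le : N ≤ 160 * d ^ 2 * C * q ^ n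
  blocks : ∀ k < K, (k / P + 1) * (paramLayout d P).size ≤ N

theorem samplerParams (hq : 2 ≤ q) (hd : 1 ≤ d) (hdn : d ≤ n) (hC : 1 ≤ C) {N K : ℕ}
    (hN : N = ⌈160 * (d : ℝ) ^ 2 * C * (q : ℝ) ^ ((n : ℝ) / d)⌉₊)
    (hK : K = ⌈(C : ℝ) * (q : ℝ) ^ ((n : ℝ) / d)⌉₊) :
    SamplerParams n q d C N ⌈(q : ℝ) ^ ((n : ℝ) / d)⌉₊ K ((q : ℝ) ^ ((n : ℝ) / d)) := by
  set Q : ℝ := (q : ℝ) ^ ((n : ℝ) / d) with hQ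
  set P := ⌈Q⌉₊ with hP
  have hQ2 : 2 ≤ Q := two_le_rpow_div hq hd hdn
  have hQd : Q ^ d = (q : ℝ) ^ n := rpow_div_pow hd
  have hC1 : (1 : ℝ) ≤ C := by exact_mod_cast hC
  have hd1 : (1 : ℝ) ≤ d := by exact_mod_cast hd
  have hrP : IsCeilRoot d (q ^ n) P := isCeilRoot_ceil (by linarith) hd (by rw [hQd]; push_cast; rfl)
  have hrK : IsCeilRoot d (q ^ n * C ^ d) K := by
    rw [hK]
    refine isCeilRoot_ceil (by positivity) hd ?_
    rw [mul_pow, hQd]; push_cast; ring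
  have hQP : Q ≤ P := Nat.le_ceil Q
  have hP2 : 2 ≤ P := by
    have : (2 : ℝ) ≤ P := hQ2.trans hQP
    exact_mod_cast this
  have hPQ : (P : ℝ) ≤ 3 / 2 * Q := by
    have := Nat.ceil_lt_add_one (by linarith : 0 ≤ Q); linarith
  have hCQ : 2 ≤ C * Q := by nlinarith
  have hKQ : (K : ℝ) ≤ 3 / 2 * (C * Q) := by
    have := Nat.ceil_lt_add_one (by linarith : 0 ≤ C * Q); rw [hK]; linarith
  have hKP : K ≤ C * P := by
    rw [hK]
    refine Nat.ceil_le.2 ?_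
    push_cast
    exact mul_le_mul_of_nonneg_left hQP (by positivity)
  have hPK : P ≤ K := by
    rw [hK]
    exact Nat.ceil_mono (le_mul_of_one_le_left (by linarith) hC1)
  have hPqn : P ≤ q ^ n := by
    refine Nat.ceil_le.2 ?_
    push_cast
    rw [← hQd]
    exact le_self_pow₀ (by linarith) (by omega)
  have hNle : N ≤ 160 * d ^ 2 * C * q ^ n := by
    rw [hN]
    refine Nat.ceil_le.2 ?_
    push_cast
    rw [← hQd]
    exact mul_le_mul_of_nonneg_left (le_self_pow₀ (by linarith) (by omega)) (by positivity)
  have hblocks : ∀ k < K, (k / P + 1) * (paramLayout d P).size ≤ N := by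
    intro k hk
    have h1 : k / P < C := (Nat.div_lt_iff_lt_mul (by omega)).2 (hk.trans_le hKP)
    refine (Nat.mul_le_mul_right _ h1).trans ?_
    have h2 : ((C * (8 * d * (13 * d * P) + P) : ℕ) : ℝ) ≤ N := by
      refine le_trans ?_ (hN ▸ Nat.le_ceil _)
      push_cast
      -- A group has 104d²P + P ≤ 105d²P samples, and 105 · 3/2 = 157.5 ≤ 160, so C groups fit into
      -- the input.
      have h3 : (8 * d * (13 * d * P) + P : ℝ) ≤ 105 * d ^ 2 * (3 / 2 * Q) := by
        have h5 : (P : ℝ) ≤ d ^ 2 * P :=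
          le_mul_of_one_le_left (Nat.cast_nonneg P) (one_le_pow₀ hd1)
        have h6 : (d : ℝ) ^ 2 * P ≤ d ^ 2 * (3 / 2 * Q) :=
          mul_le_mul_of_nonneg_left hPQ (by positivity)
        linarith
      nlinarith [mul_le_mul_of_nonneg_left h3 (by linarith : (0 : ℝ) ≤ C),
        (by positivity : (0 : ℝ) ≤ C * d ^ 2 * Q)]
    exact_mod_cast h2
  exact ⟨hQ, hQ2, hq, hd, hdn, hC, hP2, hrP, hrK, hPQ, hKQ, hPK, hKP, hPqn, hNle, hblocks⟩

theorem samplerProg_ramComputes {n q d C N P K : ℕ} {Q : ℝ} (hp : SamplerParams n q d C N P K Q)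
    (b : Module.Basis (Fin n) ℝ (EuclideanSpace ℝ (Fin n))) {xs : List (latticeOf b)}
    (hxs : xs.length = N) :
    ∃ t ≤ samplerTime n d P K, RamComputes samplerProg (32 + 8 * d * (13 * d * P))
      (100 * (n + maxBitLength (samplerInput b q d C xs) + 1) ^ 3) (samplerInput b q d C xs)
      (coordList b ((paramLayout d P).latticeAlg b q K xs)) t := by
  have hP2 := hp.two_le_P
  obtain ⟨hS, hnW, hCW, hPW, hKW⟩ := ramSetup_samplerInput b hp.two_le_q hp.one_le_d hp.d_le
    (by omega) hp.P_le_pow hp.K_le_mul hp.N_le hp.blocks hxs rfl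
  obtain ⟨⟨M, out⟩, t, hexec, ht, hout⟩ := samplerProg_halts hS hp.one_le_d hp.one_le_C hp.P_root
    hp.K_root rfl rfl rfl rfl (by simp [samplerInput]) hnW hCW hPW hKW
  rw [ramOut_samplerInput] at hout
  exact ⟨t, ht, M, hout ▸ hexec⟩

theorem memory_bound {n q d C N P K : ℕ} {Q : ℝ} (hp : SamplerParams n q d C N P K Q) :
    ((32 + 8 * d * (13 * d * P) : ℕ) : ℝ) ≤ ((156 * d ^ 2 + 32 : ℕ) : ℝ) * Q := by
  have h1 := mul_le_mul_of_nonneg_left hp.P_le (by positivity : (0 : ℝ) ≤ 104 * d ^ 2)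
  have h2 := hp.two_le_Q
  push_cast
  linarith

theorem statDist_latticeAlg_paramLayout_le {n q d C N P K : ℕ} {Q : ℝ}
    (hp : SamplerParams n q d C N P K Q)
    (b : Module.Basis (Fin n) ℝ (EuclideanSpace ℝ (Fin n))) {ε s : ℝ} (hε : 0 < ε) (hs : 0 < s)
    (hsm : 2 * √(d : ℝ) * q * smoothingParam ε (latticeOf b) ≤ s) :
    statDist
      ((iidSamples (discreteGaussian (latticeOf b) s) N).map ((paramLayout d P).latticeAlg b q K))
      (iidSamples (discreteGaussian (latticeOf b) (√(8 * (d : ℝ) + 1) / q * s)) K) ≤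
      4 * ε ^ (2 * d) * N + 11 * C * (q : ℝ) ^ (-(5 * (n : ℝ) / 2)) := by
  have hq := hp.two_le_q
  have hd := hp.one_le_d
  have hdn := hp.d_le
  have hP2 := hp.two_le_P
  have hPK := hp.P_le_K
  have hblocks := hp.blocks
  have hBpos : 0 < 13 * d * P := Nat.mul_pos (by omega) (by omega)
  have : Nonempty (Fin n) := ⟨⟨0, by omega⟩⟩
  have : NeZero q := ⟨by omega⟩
  have hδ0 : 0 < ε ^ (2 * d) := pow_pos hε _
  have hfail0 : (0 : ℝ) ≤ 11 * C * (q : ℝ) ^ (-(5 * (n : ℝ) / 2)) := by positivity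
  -- When the Poisson error exceeds 1 the claimed bound exceeds 1 as well, because N ≥ 1, and
  -- nothing has to be shown about the algorithm.
  rcases le_or_gt (ε ^ (2 * d)) 1 with hδ1 | hδ1
  · obtain ⟨c₀, hc₀⟩ := exists_abs_tsum_gaussianRho_sub_le b
    have h := Layout.statDist_latticeAlg_le (Λ := paramLayout d P) (q := q) (K := K) (N := N)
      (c₀ := c₀) (b := b) hc₀ hs hδ0.le hδ1
      (dualMass_le_of_le b hε hs (by omega) hd hsm) (by change 0 < 8 * d; omega) hBpos
      (by change 0 < P; omega) (by
        -- The factor 13 in the block length is chosen for this: 24d(P-1) < 26dP.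
        change 3 * (8 * d * (P - 1)) < 2 * (13 * d * P)
        have e : 2 * (13 * d * P) = 26 * (d * P) := by ring
        have e' : 3 * (8 * d * (P - 1)) = 24 * (d * (P - 1)) := by ring
        have h1 : d * (P - 1) ≤ d * P := Nat.mul_le_mul_left _ (Nat.sub_le _ _)
        have h2 : 0 < d * P := Nat.mul_pos (by omega) (by omega)
        omega) hblocks
    have hf := failure_bound (C := C) hq hd hP2 hp.P_root.1 hp.K_le_mul
    have e : √(8 * (d : ℝ) + 1) / q * s =
        s * √((((paramLayout d P).m + 1 : ℕ) : ℕ) : ℝ) / q := by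
      change _ = s * √(((8 * d + 1 : ℕ) : ℕ) : ℝ) / q
      push_cast; ring
    rw [e]
    refine h.trans (add_le_add ?_ ?_)
    · nlinarith [mul_nonneg (Nat.cast_nonneg (α := ℝ) N) hδ0.le]
    · rw [Fintype.card_fin]; exact hf
  · have hN1 : (1 : ℝ) ≤ N := by
      have h1 := hblocks 0 (by omega)
      have h2 : 1 ≤ (0 / P + 1) * (paramLayout d P).size :=
        Nat.mul_pos (Nat.succ_pos _) (Nat.add_pos_right _ (by change 0 < P; omega))
      exact_mod_cast h2.trans h1
    refine (statDist_le_of_le _ _ le_rfl fun z => by simp).trans ?_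
    nlinarith

end Parameters

/-! ### The theorem -/

theorem mainTheorem4 :
    ∃ (prog : RamProg) (f : ℕ → ℝ) (Pmem Pword : Polynomial ℕ),
      f =o[atTop] (fun n : ℕ => (n : ℝ)) ∧
      ∀ (n q d C : ℕ), 2 ≤ q → 1 ≤ d → d ≤ n → 1 ≤ C →
      ∀ (N K : ℕ), N = ⌈160 * (d : ℝ) ^ 2 * C * (q : ℝ) ^ ((n : ℝ) / d)⌉₊ →
        K = ⌈(C : ℝ) * (q : ℝ) ^ ((n : ℝ) / d)⌉₊ →
      ∀ b : Module.Basis (Fin n) ℝ (EuclideanSpace ℝ (Fin n)),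
      ∃ alg : List (latticeOf b) → List (latticeOf b),
        (∀ xs : List (latticeOf b), xs.length = N →
          (∃ t S W : ℕ,
            RamComputes prog S W ([(n : ℤ), (q : ℤ), (d : ℤ), (C : ℤ)] ++ coordList b xs)
              (coordList b (alg xs)) t ∧
            (t : ℝ) ≤ C * (10 * Real.exp 1 * d) ^ (8 * d) *
              (q : ℝ) ^ (8 * (n : ℝ) + (n : ℝ) / d + f n) ∧
            (S : ℝ) ≤ (Pmem.eval d : ℕ) * (q : ℝ) ^ ((n : ℝ) / d) ∧
            W ≤ Pword.eval
              (n + maxBitLength ([(n : ℤ), (q : ℤ), (d : ℤ), (C : ℤ)] ++ coordList b xs))) ∧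
          (∀ y ∈ alg xs, ∃ (I : Finset (Fin xs.length)) (j : Fin xs.length),
            I.card = 8 * d ∧ j ∉ I ∧ (q : ℤ) • y = ∑ i ∈ I, xs.get i - xs.get j)) ∧
        (∀ ε s : ℝ, 0 < ε → 0 < s →
          2 * √(d : ℝ) * q * smoothingParam ε (latticeOf b) ≤ s →
          statDist
            ((iidSamples (discreteGaussian (latticeOf b) s) N).map alg)
            (iidSamples (discreteGaussian (latticeOf b) (√(8 * (d : ℝ) + 1) / q * s)) K)
          ≤ 4 * ε ^ (2 * d) * N + 11 * C * (q : ℝ) ^ (-(5 * (n : ℝ) / 2))) := by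
  -- The memory consists of 32 registers and 104d²P flags, and 104 · 3/2 = 156. The program is
  -- fixed; only the description of its output as lattice vectors depends on the basis.
  refine ⟨samplerProg, timeExponent, 156 * Polynomial.X ^ 2 + 32, 100 * (Polynomial.X + 1) ^ 3,
    timeExponent_isLittleO, ?_⟩
  intro n q d C hq hd hdn hC N K hN hK b
  have hp := samplerParams hq hd hdn hC hN hK
  set P := ⌈(q : ℝ) ^ ((n : ℝ) / d)⌉₊
  have hP2 := hp.two_le_P
  refine ⟨(paramLayout d P).latticeAlg b q K, fun xs hxs => ⟨?_, fun y hy => ?_⟩,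
    fun ε s hε hs hsm => statDist_latticeAlg_paramLayout_le hp b hε hs hsm⟩
  · obtain ⟨t, ht, hrun⟩ := samplerProg_ramComputes hp b hxs
    refine ⟨t, _, _, hrun, time_bound hp.Q_eq hp.two_le_Q hq hd hdn hC hp.P_le hp.K_le
      (ht.trans (samplerTime_le hd hdn (by omega) hp.P_le_K)), ?_, ?_⟩
    · have e : (156 * Polynomial.X ^ 2 + 32 : Polynomial ℕ).eval d = 156 * d ^ 2 + 32 := by simp
      rw [e]
      exact memory_bound hp
    · simp [samplerInput]
  · exact Layout.exists_of_mem_latticeAlg b (Nat.mul_pos (by omega) (by omega) : 0 < 13 * d * P)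
      (by change 0 < P; omega) (by rw [hxs]; exact hp.blocks) hy
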